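/- Let $\Gamma$ be a finite group, $\Gamma_*$ its set of conjugacy classes, $\Gamma^*$ its set of irreducible complex characters, $\zeta_c=|\Gamma|/|c|$ for $c\in\Gamma_*$, and let $\xi$ be a self-dual complex class function on $\Gamma$, i.e. $\xi(x^{-1})=\xi(x)$ (for instance a self-dual virtual character). For class functions $\phi,\psi$ on a finite group $G$ put $\langle \phi,\psi\rangle_G=|G|^{-1}\sum_{x\in G}\phi(x)\psi(x^{-1})$, and for class functions on $\Gamma$ put $\langle \phi,\psi\rangle_\xi=\langle \xi\phi,\psi\rangle_\Gamma$. Groups. For $n\ge 0$ let $\Pi_n$ be the group generated by $a_1,\dots,a_n$ and a central element $z$ with relations $a_i^2=z$, $z^2=1$, $a_ia_j=za_ja_i$ ($i\ne j$). The symmetric group $S_n$ acts on $\Pi_n$ by $s(a_i)=a_{s(i)}$ (fixing $z$) and on $\Gamma^n$ by permuting coordinates, $s(g_1,\dots,g_n)=(g_{s^{-1}(1)},\dots,g_{s^{-1}(n)})$. Let $\Gamma_n=\Gamma^n\rtimes S_n$ and $\widetilde\Gamma_n=(\Gamma^n\times\Pi_n)\rtimes S_n$, with the parity $p:\widetilde\Gamma_n\to\mathbb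 Z/2$ for which each $a_i$ is odd and $\Gamma^n$, $S_n$ are even. The type of $(g,s)\in\Gamma_n$ is the family $\rho=(\rho(c))_{c\in\Gamma_*}$ of partitions in which the parts of $\rho(c)$ are the lengths of the cycles $(j_1\,j_2\cdots j_m)$ of $s$ (fixed points included) whose cycle-product $g_{j_m}g_{j_{m-1}}\cdots g_{j_1}$ lies in $c$. The space $R^-_\Gamma$. Let $R^-(\widetilde\Gamma_n)$ be the space of class functions $f:\widetilde\Gamma_n\to\mathbb C$ with $f(zx)=-f(x)$ for all $x$ and $f(x)=0$ for all odd $x$, and let $R^-_\Gamma=\bigoplus_{n\ge0}R^-(\widetilde\Gamma_n)$. Let $\eta_n(\xi)$ be the class function on $\Gamma_n$ whose value at elements of type $\rho$ is $\prod_{c}\xi(c)^{l(\rho(c))}$, where $l$ denotes the number of parts (for the character $\xi$ of a $\Gamma$-module $V$ this is the character of $V^{\otimes n}$). For $f,h\in R^-(\widetilde\Gamma_n)$ put $\langle f,h\rangle_\xi=\langle \eta_n(\xi)\circledast f,h\rangle_{\widetilde\Gamma_n}$, where $(\eta_n(\xi)\circledast f)(x)=\eta_n(\xi)(g,s)\,f(x)$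 for $x=((g,a),s)$ with $g\in\Gamma^n$, $a\in\Pi_n$, $s\in S_n$; and for $u=\sum_n u_n$, $v=\sum_n v_n$ in $R^-_\Gamma$ put $\langle u,v\rangle_\xi=\sum_n\langle u_n,v_n\rangle_\xi$. The Fock space $S^-_\Gamma$ is the symmetric (polynomial) algebra over $\mathbb C$ on generators $a_{-m}(\gamma)$, $m$ odd positive, $\gamma\in\Gamma^*$. For $m$ odd positive, $a_{-m}(\gamma)$ acts on it by multiplication, and $a_m(\gamma)$ acts as the derivation with $a_m(\gamma)\cdot a_{-k}(\gamma')=\tfrac m2\,\delta_{m,k}\langle\gamma,\gamma'\rangle_\xi$. The characteristic map. Let $\mathcal{OP}(\Gamma_*)$ be the set of families $\rho=(\rho(c))_{c\in\Gamma_*}$ of partitions with all parts odd, and $\mathcal{OP}_n(\Gamma_*)$ its subset with $\sum_c|\rho(c)|=n$. For $\rho\in\mathcal{OP}(\Gamma_*)$ let $Z_\rho=\prod_{c}\bigl(\zeta_c^{l(\rho(c))}\prod_{i\ge1}m_i(c)!\,i^{m_i(c)}\bigr)$, with $m_i(c)$ the multiplicity of $i$ in $\rho(c)$, and let $\overline\rho(c)=\rho(c^{-1})$.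 Put $a_{-m}(c)=\sum_{\gamma\in\Gamma^*}\gamma(c^{-1})a_{-m}(\gamma)$ and let $a'_{-\rho}$ be the product of the $a_{-m}(c)$ over all $c\in\Gamma_*$ and all parts $m$ of $\rho(c)$. For $f\in R^-(\widetilde\Gamma_n)$ and $\rho\in\mathcal{OP}_n(\Gamma_*)$ let $f_\rho$ be the value of $f$ on the conjugacy class $D_\rho^+$ of $\widetilde\Gamma_n$ containing the elements $(g,s)$, $g\in\Gamma^n$, $s\in S_n$, of type $\rho$. Let $\mathrm{ch}:R^-_\Gamma\to S^-_\Gamma$ be the linear map with $$\mathrm{ch}(f)=\sum_{\rho\in\mathcal{OP}_n(\Gamma_*)}\frac1{Z_\rho}\,f_\rho\,a'_{-\overline\rho}\qquad (f\in R^-(\widetilde\Gamma_n)).$$ Theorem. There is exactly one bilinear form $\langle\cdot,\cdot\rangle'_\xi$ on $S^-_\Gamma$ with $\langle1,1\rangle'_\xi=1$ and $a_m(\gamma)^*=a_{-m}(\gamma)$ for all odd integers $m$ and all $\gamma\in\Gamma^*$, where $*$ denotes the adjoint, i.e. $\langle a_m(\gamma)u,v\rangle'_\xi=\langle u,a_{-m}(\gamma)v\rangle'_\xi$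 for all $u,v$. The map $\mathrm{ch}$ is an isometry from $(R^-_\Gamma,\langle\cdot,\cdot\rangle_\xi)$ onto $(S^-_\Gamma,\langle\cdot,\cdot\rangle'_\xi)$: it is bijective, and $\langle \mathrm{ch}(u),\mathrm{ch}(v)\rangle'_\xi=\langle u,v\rangle_\xi$ for all $u,v\in R^-_\Gamma$. The same holds for the map defined in the same way with $a'_{-\rho}$ in place of $a'_{-\overline\rho}$. -/

import Mathlib

namespace SpinWreath

noncomputable section

open scoped Classical

/-! ## The group `Π_n` -/

/-- The group `Π_n` generated by `a_1, …, a_n` and a central element `z` subject to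
`a_i² = z`, `z² = 1`, `a_i a_j = z a_j a_i` (`i ≠ j`), in normal form: the pair `(ε, u)` is
`z^ε a_{i_1} ⋯ a_{i_k}`, where `i_1 < ⋯ < i_k` are the indices `i` with `u i = 1`. -/
@[ext]
structure PiGroup (n : ℕ) where
  sgn : ZMod 2
  vec : Fin n → ZMod 2

namespace PiGroup

variable {n : ℕ}

/-- `a_I a_J = z^{β(I, J)} a_{I △ J}` with `β(I, J) = #{(i, j) ∈ I × J | j ≤ i}`. -/
def cocycle (u v : Fin n → ZMod 2) : ZMod 2 :=
  ∑ i, ∑ j, if j ≤ i then u i * v j else 0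

/-- `a_{s(i_1)} ⋯ a_{s(i_k)} = z^{inv(s, I)} a_{s(I)}` for `I = {i_1 < ⋯ < i_k}`, where
`inv(s, I)` is the number of inversions of `s` on `I`. -/
def inversions (s : Equiv.Perm (Fin n)) (u : Fin n → ZMod 2) : ZMod 2 :=
  ∑ i, ∑ j, if i < j ∧ s j < s i then u i * u j else 0

theorem cocycle_add_left (u u' v : Fin n → ZMod 2) :
    cocycle (u + u') v = cocycle u v + cocycle u' v := by
  simp only [cocycle, ← Finset.sum_add_distrib, Pi.add_apply]
  refine Finset.sum_congr rfl fun i _ => Finset.sum_congr rfl fun j _ => ?_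
  split_ifs <;> ring

theorem cocycle_add_right (u v v' : Fin n → ZMod 2) :
    cocycle u (v + v') = cocycle u v + cocycle u v' := by
  simp only [cocycle, ← Finset.sum_add_distrib, Pi.add_apply]
  refine Finset.sum_congr rfl fun i _ => Finset.sum_congr rfl fun j _ => ?_
  split_ifs <;> ring

instance : Mul (PiGroup n) := ⟨fun x y => ⟨x.sgn + y.sgn + cocycle x.vec y.vec, x.vec + y.vec⟩⟩
instance : One (PiGroup n) := ⟨⟨0, 0⟩⟩
instance : Inv (PiGroup n) := ⟨fun x => ⟨x.sgn + cocycle x.vec x.vec, x.vec⟩⟩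

@[simp] theorem mul_sgn (x y : PiGroup n) :
    (x * y).sgn = x.sgn + y.sgn + cocycle x.vec y.vec := rfl
@[simp] theorem mul_vec (x y : PiGroup n) : (x * y).vec = x.vec + y.vec := rfl
@[simp] theorem one_sgn : (1 : PiGroup n).sgn = 0 := rfl
@[simp] theorem one_vec : (1 : PiGroup n).vec = 0 := rfl
@[simp] theorem inv_sgn (x : PiGroup n) : x⁻¹.sgn = x.sgn + cocycle x.vec x.vec := rfl
@[simp] theorem inv_vec (x : PiGroup n) : x⁻¹.vec = x.vec := rfl

instance : Group (PiGroup n) :=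
  Group.ofLeftAxioms
    (fun x y w => by
      ext1
      · simp only [mul_sgn, mul_vec, cocycle_add_left, cocycle_add_right]; ring
      · simp only [mul_vec, add_assoc])
    (fun x => by
      ext1
      · simp [cocycle]
      · simp)
    (fun x => by
      ext1
      · simp only [mul_sgn, inv_sgn, inv_vec, one_sgn]
        have h : (2 : ZMod 2) = 0 := rfl
        linear_combination (x.sgn + cocycle x.vec x.vec) * h
      · funext i
        exact CharTwo.add_self_eq_zero _)

/-- The generator `a_i`. -/
def gen (i : Fin n) : PiGroup n := ⟨0, Pi.single i 1⟩

/-- The central element `z`. -/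
def z : PiGroup n := ⟨1, 0⟩

def equivProd (n : ℕ) : PiGroup n ≃ ZMod 2 × (Fin n → ZMod 2) where
  toFun x := (x.sgn, x.vec)
  invFun p := ⟨p.1, p.2⟩

instance : Fintype (PiGroup n) := Fintype.ofEquiv _ (equivProd n).symm

theorem cocycle_single (i j : Fin n) :
    cocycle (Pi.single i 1) (Pi.single j 1) = if j ≤ i then 1 else 0 := by
  unfold cocycle
  rw [Finset.sum_eq_single i, Finset.sum_eq_single j]
  · simp
  · intro b _ hb; simp [hb]
  · simp
  · intro b _ hb; simp [hb]
  · simp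

theorem z_central (x : PiGroup n) : z * x = x * z := by
  ext1
  · simp [z, cocycle, add_comm]
  · simp [z]

theorem z_sq : (z : PiGroup n) ^ 2 = 1 := by
  rw [pow_two]
  ext1
  · simp [z, cocycle]; rfl
  · simp [z]

theorem gen_sq (i : Fin n) : gen i ^ 2 = z := by
  rw [pow_two]
  ext1
  · simp [gen, z, cocycle_single]
  · funext k
    exact CharTwo.add_self_eq_zero _

theorem gen_mul_gen (i j : Fin n) (h : i ≠ j) : gen i * gen j = z * (gen j * gen i) := by
  ext1
  · simp only [gen, z, mul_sgn, mul_vec, cocycle_single]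
    rcases lt_or_gt_of_ne h with h | h
    · simp [h.le, not_le.2 h, cocycle]; rfl
    · simp [h.le, not_le.2 h, cocycle]
  · simp [gen, z, add_comm]

theorem card_eq : Fintype.card (PiGroup n) = 2 ^ (n + 1) := by
  rw [Fintype.card_congr (equivProd n)]
  simp [pow_succ, mul_comm]

theorem closure_gen : Subgroup.closure (insert z (Set.range (gen (n := n)))) = ⊤ := by
  rw [eq_top_iff]
  have key : ∀ (S : Finset (Fin n)) (x : PiGroup n), (∀ i, i ∉ S → x.vec i = 0) →
      x ∈ Subgroup.closure (insert z (Set.range (gen (n := n)))) := by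
    intro S
    induction S using Finset.induction_on with
    | empty =>
      intro x hx
      have hv : x.vec = 0 := funext fun i => hx i (Finset.notMem_empty i)
      have h2 : ∀ e : ZMod 2, e = 0 ∨ e = 1 := by decide
      rcases h2 x.sgn with h | h
      · rw [show x = 1 from PiGroup.ext h hv]; exact one_mem _
      · rw [show x = z from PiGroup.ext h hv]
        exact Subgroup.subset_closure (Set.mem_insert _ _)
    | insert i S hi ih =>
      intro x hx
      have h2 : ∀ e : ZMod 2, e = 0 ∨ e = 1 := by decide
      rcases h2 (x.vec i) with h | h
      · refine ih x fun k hk => ?_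
        by_cases hki : k = i
        · rw [hki, h]
        · exact hx k (by simp [hki, hk])
      · have hg : gen i ∈ Subgroup.closure (insert z (Set.range (gen (n := n)))) :=
          Subgroup.subset_closure (Set.mem_insert_of_mem _ ⟨i, rfl⟩)
        refine (Subgroup.mul_mem_cancel_left _ hg).1 (ih _ fun k hk => ?_)
        by_cases hki : k = i
        · subst hki
          simp [gen, h]; rfl
        · simp [gen, hki, hx k (by simp [hki, hk])]
  exact fun x _ => key Finset.univ x fun i hi => absurd (Finset.mem_univ i) hi

theorem cocycle_perm (s : Equiv.Perm (Fin n)) (u v : Fin n → ZMod 2) :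
    inversions s (u + v) + cocycle u v =
      inversions s u + inversions s v + cocycle (u ∘ s.symm) (v ∘ s.symm) := by
  have hc : cocycle (u ∘ s.symm) (v ∘ s.symm) =
      ∑ i, ∑ j, if s j ≤ s i then u i * v j else 0 := by
    unfold cocycle
    rw [← Equiv.sum_comp s]
    refine Finset.sum_congr rfl fun i _ => ?_
    rw [← Equiv.sum_comp s]
    simp
  have hi : inversions s (u + v) = inversions s u + inversions s v +
      (∑ i, ∑ j, if i < j ∧ s j < s i then u i * v j else 0) +
      ∑ i, ∑ j, if j < i ∧ s i < s j then u i * v j else 0 := by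
    rw [Finset.sum_comm (f := fun i j => if j < i ∧ s i < s j then u i * v j else 0)]
    simp only [inversions, ← Finset.sum_add_distrib, Pi.add_apply]
    refine Finset.sum_congr rfl fun i _ => Finset.sum_congr rfl fun j _ => ?_
    split_ifs <;> ring
  have h0 : (∑ i, ∑ j, if i < j ∧ s j < s i then u i * v j else 0) +
      (∑ i, ∑ j, if j < i ∧ s i < s j then u i * v j else 0) + cocycle u v =
      ∑ i, ∑ j, if s j ≤ s i then u i * v j else 0 := by
    simp only [cocycle, ← Finset.sum_add_distrib]
    refine Finset.sum_congr rfl fun i _ => Finset.sum_congr rfl fun j _ => ?_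
    have h2 : (2 : ZMod 2) = 0 := rfl
    rcases lt_trichotomy i j with h | h | h
    · rcases lt_or_gt_of_ne (s.injective.ne h.ne) with h' | h' <;>
        simp [h, h', h'.le, not_le.2 h, not_lt.2 h.le, not_lt.2 h'.le, not_le.2 h']
    · subst h; simp
    · rcases lt_or_gt_of_ne (s.injective.ne h.ne) with h' | h' <;>
        simp [h, h', h.le, h'.le, not_lt.2 h.le, not_lt.2 h'.le, not_le.2 h']
      linear_combination (u i * v j) * h2
  rw [hi, hc, ← h0]; ring

theorem inversions_mul (s t : Equiv.Perm (Fin n)) (u : Fin n → ZMod 2) :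
    inversions (s * t) u = inversions t u + inversions s (u ∘ t.symm) := by
  have hs : inversions s (u ∘ t.symm) =
      ∑ i, ∑ j, if t i < t j ∧ s (t j) < s (t i) then u i * u j else 0 := by
    unfold inversions
    rw [← Equiv.sum_comp t]
    refine Finset.sum_congr rfl fun i _ => ?_
    rw [← Equiv.sum_comp t]
    simp
  have hsplit : (∑ i, ∑ j, if t i < t j ∧ s (t j) < s (t i) then u i * u j else 0) =
      (∑ i, ∑ j, if i < j ∧ t i < t j ∧ s (t j) < s (t i) then u i * u j else 0) +
      ∑ i, ∑ j, if i < j ∧ t j < t i ∧ s (t i) < s (t j) then u i * u j else 0 := by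
    rw [Finset.sum_comm
      (f := fun i j => if i < j ∧ t j < t i ∧ s (t i) < s (t j) then u i * u j else 0)]
    simp only [← Finset.sum_add_distrib]
    refine Finset.sum_congr rfl fun i _ => Finset.sum_congr rfl fun j _ => ?_
    rcases lt_trichotomy i j with h | h | h
    · simp [h, not_lt.2 h.le]
    · subst h; simp
    · simp [h, not_lt.2 h.le, mul_comm]
  rw [hs, hsplit]
  simp only [inversions, ← Finset.sum_add_distrib, Equiv.Perm.mul_apply]
  refine Finset.sum_congr rfl fun i _ => Finset.sum_congr rfl fun j _ => ?_
  have h2 : (2 : ZMod 2) = 0 := rfl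
  by_cases h : i < j
  · rcases lt_or_gt_of_ne (t.injective.ne h.ne) with h' | h' <;>
      rcases lt_or_gt_of_ne (s.injective.ne (t.injective.ne h.ne)) with h'' | h'' <;>
        simp [h, h', h'', not_lt.2 h'.le, not_lt.2 h''.le]
    linear_combination (-(u i * u j)) * h2
  · simp [h]

/-- The action of `S_n` on `Π_n` by `s(a_i) = a_{s(i)}`. -/
def perm (n : ℕ) : Equiv.Perm (Fin n) →* MulAut (PiGroup n) :=
  MonoidHom.mk'
    (fun s =>
      { toFun := fun x => ⟨x.sgn + inversions s x.vec, x.vec ∘ s.symm⟩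
        invFun := fun x => ⟨x.sgn + inversions s (x.vec ∘ s), x.vec ∘ s⟩
        left_inv := fun x => by
          ext1
          · have h2 : (2 : ZMod 2) = 0 := rfl
            simp only [Function.comp_assoc, Equiv.symm_comp_self, Function.comp_id]
            linear_combination (inversions s x.vec) * h2
          · simp [Function.comp_assoc]
        right_inv := fun x => by
          ext1
          · have h2 : (2 : ZMod 2) = 0 := rfl
            simp only
            linear_combination (inversions s (x.vec ∘ s)) * h2
          · simp [Function.comp_assoc]
        map_mul' := fun x y => by
          ext1
          · simp only [mul_sgn, mul_vec]
            linear_combination cocycle_perm s x.vec y.vec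
          · rfl })
    (fun s t => by
      ext1 x
      ext1
      · show x.sgn + inversions (s * t) x.vec =
          x.sgn + inversions t x.vec + inversions s (x.vec ∘ t.symm)
        rw [inversions_mul, add_assoc]
      · rfl)

theorem perm_gen (s : Equiv.Perm (Fin n)) (i : Fin n) : perm n s (gen i) = gen (s i) := by
  have hz : inversions s (Pi.single i 1) = 0 := by
    unfold inversions
    refine Finset.sum_eq_zero fun k _ => Finset.sum_eq_zero fun l _ => ?_
    split_ifs with h
    · by_cases hk : k = i
      · have hl : l ≠ i := fun hl => by rw [hk, hl] at h; exact lt_irrefl _ h.1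
        simp [hl]
      · simp [hk]
    · rfl
  ext1
  · show 0 + inversions s (Pi.single i 1) = 0
    rw [hz, add_zero]
  · funext k
    show (Pi.single i 1 : Fin n → ZMod 2) (s.symm k) = (Pi.single (s i) 1 : Fin n → ZMod 2) k
    simp [Pi.single_apply, Equiv.symm_apply_eq]

theorem perm_z (s : Equiv.Perm (Fin n)) : perm n s z = z := by
  ext1
  · show 1 + inversions s 0 = 1
    simp [inversions]
  · rfl

end PiGroup

/-! ## The groups `Γ_n = Γ^n ⋊ S_n` and `Γ̃_n = (Γ^n × Π_n) ⋊ S_n` -/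

/-- `S_n` acts on `Γ^n` by `s(g_1, …, g_n) = (g_{s⁻¹(1)}, …, g_{s⁻¹(n)})`. -/
def permPow (Γ : Type*) [Group Γ] (n : ℕ) :
    Equiv.Perm (Fin n) →* MulAut (Fin n → Γ) :=
  MonoidHom.mk'
    (fun s =>
      { toFun := fun g => g ∘ s.symm
        invFun := fun g => g ∘ s
        left_inv := fun g => by simp [Function.comp_assoc]
        right_inv := fun g => by simp [Function.comp_assoc]
        map_mul' := fun _ _ => rfl })
    (fun _ _ => rfl)

/-- The wreath product `Γ_n = Γ^n ⋊ S_n`. -/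
abbrev Wreath (Γ : Type*) [Group Γ] (n : ℕ) : Type _ :=
  (Fin n → Γ) ⋊[permPow Γ n] Equiv.Perm (Fin n)

/-- `S_n` acts simultaneously on `Γ^n` and on `Π_n`. -/
def permBoth (Γ : Type*) [Group Γ] (n : ℕ) :
    Equiv.Perm (Fin n) →* MulAut ((Fin n → Γ) × PiGroup n) :=
  MonoidHom.mk' (fun s => MulEquiv.prodCongr (permPow Γ n s) (PiGroup.perm n s))
    (fun s t => by
      ext1 x
      rw [map_mul, map_mul]
      rfl)

/-- The group `Γ̃_n = (Γ^n × Π_n) ⋊ S_n`. -/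
abbrev SpinGroup (Γ : Type*) [Group Γ] (n : ℕ) : Type _ :=
  ((Fin n → Γ) × PiGroup n) ⋊[permBoth Γ n] Equiv.Perm (Fin n)

section Groups

variable {Γ : Type*} [Group Γ] {n : ℕ}

instance [Fintype Γ] : Fintype (SpinGroup Γ n) :=
  Fintype.ofEquiv _ SemidirectProduct.equivProd.symm

/-- The central element `z` of `Γ̃_n`. -/
def zed : SpinGroup Γ n := ⟨(1, PiGroup.z), 1⟩

/-- The parity `p`: `a_i` is odd, elements of `S_n` and `Γ^n` are even. -/
def parity (x : SpinGroup Γ n) : ZMod 2 := ∑ i, x.left.2.vec i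

/-- The element `(g, s)` of `Γ̃_n`, for `g ∈ Γ^n` and `s ∈ S_n`. -/
def evenLift (w : Wreath Γ n) : SpinGroup Γ n := ⟨(w.left, 1), w.right⟩

/-- The projection `(g, a_I s) ↦ (g, s)` from `Γ̃_n` to `Γ_n`. -/
def toWreath (x : SpinGroup Γ n) : Wreath Γ n := ⟨x.left.1, x.right⟩

end Groups

/-! ## Partition-valued functions and types -/

/-- The class `c⁻¹ = {g | g⁻¹ ∈ c}`. -/
def classInv {Γ : Type*} [Group Γ] : ConjClasses Γ → ConjClasses Γ :=
  Quotient.map (fun g => g⁻¹) fun _ _ h => by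
    obtain ⟨c, hc⟩ := isConj_iff.1 h
    exact isConj_iff.2 ⟨c, by rw [← hc]; group⟩

/-- The odd positive integers. -/
abbrev OddNat : Type := {m : ℕ // Odd m}

/-- `OP_n(X)`: families `(ρ(x))_{x ∈ X}` of partitions (given as multisets of parts) all of whose
parts are odd, with `‖ρ‖ = ∑_x |ρ(x)| = n`. -/
abbrev OddPart (X : Type*) [Fintype X] (n : ℕ) : Type _ :=
  {ρ : X → Multiset OddNat // ∑ x, ((ρ x).map Subtype.val).sum = n}

instance oddPart_finite (X : Type*) [Fintype X] (n : ℕ) : Finite (OddPart X n) := by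
  let B : Multiset OddNat :=
    n • ((Finset.range (n + 1)).subtype (fun m => Odd m)).val
  have hfin : (Set.pi Set.univ fun _ : X => Set.Iic B).Finite :=
    Set.Finite.pi fun _ => Set.finite_Iic B
  refine (hfin.subset ?_ : Set.Finite
    {ρ : X → Multiset OddNat | ∑ x, ((ρ x).map Subtype.val).sum = n}).to_subtype
  intro ρ hρ x _
  have hx : ((ρ x).map Subtype.val).sum ≤ n := by
    rw [← show _ = n from hρ]
    exact Finset.single_le_sum (f := fun x => ((ρ x).map Subtype.val).sum)
      (fun _ _ => Nat.zero_le _) (Finset.mem_univ x)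
  refine Multiset.le_iff_count.2 fun m => ?_
  by_cases hm : m ∈ ρ x
  · have hmn : m.1 ≤ n :=
      (Multiset.single_le_sum (fun _ _ => Nat.zero_le _) _
        (Multiset.mem_map_of_mem Subtype.val hm)).trans hx
    have hB : Multiset.count m B = n := by
      simp only [B, Multiset.count_nsmul]
      rw [Multiset.count_eq_one_of_mem (Finset.nodup _)
        (by simpa using Nat.lt_succ_of_le hmn), mul_one]
    rw [hB]
    refine (Multiset.count_le_card _ _).trans (le_trans ?_ hx)
    rw [← Multiset.card_map Subtype.val (ρ x)]
    have := Multiset.card_nsmul_le_sum (s := (ρ x).map Subtype.val) (a := 1) (by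
      intro k hk
      obtain ⟨k', -, rfl⟩ := Multiset.mem_map.1 hk
      exact k'.2.pos)
    simpa using this
  · rw [Multiset.count_eq_zero_of_notMem hm]; exact Nat.zero_le _

instance oddPart_fintype (X : Type*) [Fintype X] (n : ℕ) : Fintype (OddPart X n) :=
  Fintype.ofFinite _

section Types

variable {Γ : Type*} [Group Γ] {n : ℕ}

/-- The set of cycles (fixed points included) of a permutation. -/
abbrev Cycles (s : Equiv.Perm (Fin n)) : Type := Quotient (Equiv.Perm.SameCycle.setoid s)

/-- The length of a cycle of `s`. -/
def cycleLen {s : Equiv.Perm (Fin n)} (q : Cycles s) : ℕ := Function.minimalPeriod s q.out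

/-- The cycle-product `g_{j_m} g_{j_{m-1}} ⋯ g_{j_1}` of the cycle `(j_1 j_2 … j_m)` of `s`,
where `j_1` is a chosen element of the cycle (the conjugacy class of the cycle-product does not
depend on this choice). -/
def cycleProd (g : Fin n → Γ) {s : Equiv.Perm (Fin n)} (q : Cycles s) : Γ :=
  ((List.range (cycleLen q)).map fun k => g ((s ^ k) q.out)).reverse.prod

/-- The type of `(g, s) ∈ Γ_n`: the partition attached to a class `c` consists of the lengths of
the cycles of `s` whose cycle-product lies in `c`. -/
def wreathType (w : Wreath Γ n) (c : ConjClasses Γ) : Multiset ℕ :=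
  (Finset.univ.filter fun q : Cycles w.right =>
    ConjClasses.mk (cycleProd w.left q) = c).val.map cycleLen

/-- The conjugacy class `D_ρ^+` of `Γ̃_n` that contains the elements `(g, s)` of type `ρ`
with `g ∈ Γ^n` and `s ∈ S_n`. -/
def classD [Fintype Γ] (ρ : OddPart (ConjClasses Γ) n) : Set (SpinGroup Γ n) :=
  {x | ∃ w : Wreath Γ n, (∀ c, wreathType w c = (ρ.1 c).map Subtype.val) ∧ IsConj (evenLift w) x}

/-- `ζ_c = |Γ| / |c|`. -/
def zeta [Fintype Γ] (c : ConjClasses Γ) : ℂ := (Nat.card Γ : ℂ) / (Nat.card c.carrier : ℂ)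

/-- `Z_ρ = ∏_{c, i} m_i(c)! i^{m_i(c)} · ∏_c ζ_c^{l(ρ(c))}`, where `m_i(c)` is the multiplicity of
`i` in `ρ(c)`. -/
def bigZ [Fintype Γ] (ρ : OddPart (ConjClasses Γ) n) : ℂ :=
  ∏ c, ((∏ i ∈ (ρ.1 c).toFinset,
      ((Nat.factorial ((ρ.1 c).count i) : ℂ) * (i.1 : ℂ) ^ (ρ.1 c).count i)) *
    zeta c ^ Multiset.card (ρ.1 c))

end Types

/-! ## The space `R_Γ^-` and its weighted bilinear form -/

section Functions

variable (Γ : Type*) [Group Γ] (n : ℕ)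

/-- `R^-(Γ̃_n)`: the spin super class functions on `Γ̃_n`, that is, the class functions `f` with
`f(zx) = -f(x)` that vanish on odd elements. -/
def RMinus : Submodule ℂ (SpinGroup Γ n → ℂ) where
  carrier := {f | (∀ x y, f (y * x * y⁻¹) = f x) ∧ (∀ x, f (zed * x) = -f x) ∧
    ∀ x, parity x = 1 → f x = 0}
  zero_mem' := by simp
  add_mem' := by
    rintro f f' ⟨h1, h2, h3⟩ ⟨h1', h2', h3'⟩
    exact ⟨fun x y => by simp [h1, h1'], fun x => by simp [h2, h2', add_comm],
      fun x hx => by simp [h3 x hx, h3' x hx]⟩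
  smul_mem' := by
    rintro a f ⟨h1, h2, h3⟩
    exact ⟨fun x y => by simp [h1], fun x => by simp [h2], fun x hx => by simp [h3 x hx]⟩

/-- `R_Γ^- = ⨁_{n ≥ 0} R^-(Γ̃_n)`. -/
abbrev RSpace : Type _ := DirectSum ℕ fun n => RMinus Γ n

variable {Γ n}

/-- The class function `η_n(ξ)` on `Γ_n` attached to a class function `ξ` on `Γ`. For the character
`ξ` of a `Γ`-module `V` it is the character of the `Γ_n`-module `V^{⊗ n}`; its value at an element
of type `ρ` is `∏_c ξ(c)^{l(ρ(c))}`, each cycle contributing the value of `ξ` at its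
cycle-product. -/
def eta (ξ : Γ → ℂ) (w : Wreath Γ n) : ℂ := ∏ q : Cycles w.right, ξ (cycleProd w.left q)

/-- The product `φ ⊛ f` of a class function on `Γ_n` and a function on `Γ̃_n`:
`(φ ⊛ f)(g, a_I s) = φ(g, s) f(g, a_I s)`. -/
def circ (φ : Wreath Γ n → ℂ) (f : SpinGroup Γ n → ℂ) : SpinGroup Γ n → ℂ :=
  fun x => φ (toWreath x) * f x

/-- The standard form `⟨f, h⟩ = |G|⁻¹ ∑_{x ∈ G} f(x) h(x⁻¹)` of a finite group `G`. -/
def stdForm {G : Type*} [Group G] [Fintype G] (f h : G → ℂ) : ℂ :=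
  (Fintype.card G : ℂ)⁻¹ * ∑ x : G, f x * h x⁻¹

/-- The weighted form `⟨f, h⟩_ξ = ⟨η_n(ξ) ⊛ f, h⟩` on `R^-(Γ̃_n)`. -/
def weightedForm [Fintype Γ] (ξ : Γ → ℂ) (n : ℕ) : LinearMap.BilinForm ℂ (RMinus Γ n) :=
  LinearMap.mk₂ ℂ (fun f h => stdForm (circ (eta ξ) f.1) h.1)
    (fun f f' h => by
      simp only [stdForm, circ, Submodule.coe_add, Pi.add_apply, ← mul_add,
        ← Finset.sum_add_distrib]
      congr 1
      exact Finset.sum_congr rfl fun x _ => by ring)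
    (fun a f h => by
      simp only [stdForm, circ, Submodule.coe_smul, Pi.smul_apply, smul_eq_mul]
      rw [mul_left_comm a, Finset.mul_sum _ _ a]
      congr 1
      exact Finset.sum_congr rfl fun x _ => by ring)
    (fun f h h' => by
      simp only [stdForm, circ, Submodule.coe_add, Pi.add_apply, ← mul_add,
        ← Finset.sum_add_distrib])
    (fun a f h => by
      simp only [stdForm, circ, Submodule.coe_smul, Pi.smul_apply, smul_eq_mul]
      rw [mul_left_comm a, Finset.mul_sum _ _ a]
      congr 1
      exact Finset.sum_congr rfl fun x _ => by ring)

/-- The weighted form on `R_Γ^-`: `⟨u, v⟩_ξ = ∑_n ⟨u_n, v_n⟩_ξ`. -/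
def RForm [Fintype Γ] (ξ : Γ → ℂ) : LinearMap.BilinForm ℂ (RSpace Γ) :=
  DirectSum.toModule ℂ ℕ _ fun n =>
    (weightedForm ξ n).compl₂ (DirectSum.component ℂ ℕ (fun n => RMinus Γ n) n)

theorem RForm_apply [Fintype Γ] (ξ : Γ → ℂ) (u v : RSpace Γ) :
    RForm ξ u v = ∑ n ∈ DFinsupp.support u, weightedForm ξ n (u n) (v n) := by
  conv_lhs => rw [← DirectSum.sum_support_of u]
  simp only [map_sum, LinearMap.sum_apply]
  refine Finset.sum_congr rfl fun n _ => ?_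
  erw [DirectSum.toModule_lof]
  rfl

end Functions

/-! ## The Fock space `S_Γ^-` and its bilinear form -/

section Fock

variable (Γ : Type*) [Group Γ]

/-- `Γ^*`: the set of irreducible complex characters of `Γ`. -/
abbrev IrrChar : Type _ :=
  {χ : Γ → ℂ // ∃ (d : ℕ) (r : Representation ℂ Γ (Fin d → ℂ)),
    r.IsIrreducible ∧ r.character = χ}

/-- The Fock space `S_Γ^-`: the symmetric algebra generated by `a_{-m}(γ)`, `m` odd positive,
`γ ∈ Γ^*`, i.e. the polynomial algebra in these generators. -/
abbrev Fock : Type _ := MvPolynomial (OddNat × IrrChar Γ) ℂ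

variable {Γ}

/-- Distinct irreducible characters are orthonormal for the standard form. -/
theorem stdForm_irrChar [Fintype Γ] (χ ψ : IrrChar Γ) :
    stdForm χ.1 ψ.1 = if χ = ψ then 1 else 0 := by
  obtain ⟨χ, d, r, hr, rfl⟩ := χ
  obtain ⟨ψ, e, t, ht, rfl⟩ := ψ
  have : Invertible (Nat.card Γ : ℂ) :=
    invertibleOfNonzero (Nat.cast_ne_zero.2 Nat.card_pos.ne')
  have := hr
  have := ht
  have h := Representation.char_orthonormal r t
  rw [stdForm, ← Nat.card_eq_fintype_card, h]
  by_cases hE : Nonempty (Representation.Equiv t r)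
  · have : r.character = t.character := (Representation.char_iso hE.some).symm
    rw [if_pos hE, if_pos (Subtype.ext this)]
  · rw [if_neg hE, if_neg]
    intro hc
    have hc' : r.character = t.character := congrArg Subtype.val hc
    have h' := Representation.char_orthonormal r r
    rw [if_pos ⟨Representation.Equiv.refl r⟩] at h'
    rw [← hc', h', if_neg hE] at h
    exact one_ne_zero h

instance irrChar_finite [Fintype Γ] : Finite (IrrChar Γ) := by
  have hli : LinearIndependent ℂ (fun χ : IrrChar Γ => χ.1) := by
    rw [linearIndependent_iff']
    intro S a ha ψ hψ
    have h0 : stdForm (∑ χ ∈ S, a χ • χ.1) ψ.1 = ∑ χ ∈ S, a χ * stdForm χ.1 ψ.1 := by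
      simp only [stdForm, Finset.sum_apply, Pi.smul_apply, smul_eq_mul, Finset.sum_mul]
      rw [Finset.sum_comm, Finset.mul_sum]
      refine Finset.sum_congr rfl fun χ _ => ?_
      rw [mul_left_comm (a χ), Finset.mul_sum _ _ (a χ)]
      congr 1
      exact Finset.sum_congr rfl fun x _ => by ring
    rw [ha] at h0
    simp only [stdForm_irrChar, mul_ite, mul_one, mul_zero, Finset.sum_ite_eq', hψ, if_true] at h0
    rw [← h0]
    simp [stdForm]
  exact hli.finite

instance irrChar_fintype [Fintype Γ] : Fintype (IrrChar Γ) := Fintype.ofFinite _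

/-- The weighted form `⟨φ, ψ⟩_ξ = ⟨ξ φ, ψ⟩` for functions on `Γ`. -/
def pairing [Fintype Γ] (ξ φ ψ : Γ → ℂ) : ℂ := stdForm (ξ * φ) ψ

/-- The generator `a_{-m}(γ)` of the Fock space. -/
def aNeg (m : OddNat) (γ : IrrChar Γ) : Fock Γ := MvPolynomial.X (m, γ)

/-- The operator `a_{-m}(γ)`, `m > 0`: multiplication by the generator `a_{-m}(γ)`. -/
def creation (m : OddNat) (γ : IrrChar Γ) : Fock Γ →ₗ[ℂ] Fock Γ :=
  LinearMap.mulLeft ℂ (aNeg m γ)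

/-- The operator `a_m(γ)`, `m > 0`: the derivation of the algebra `S_Γ^-` with
`a_m(γ) · a_{-k}(γ') = (m / 2) δ_{m,k} ⟨γ, γ'⟩_ξ`. -/
def annihilation [Fintype Γ] (ξ : Γ → ℂ) (m : OddNat) (γ : IrrChar Γ) : Fock Γ →ₗ[ℂ] Fock Γ :=
  (MvPolynomial.mkDerivation ℂ fun p : OddNat × IrrChar Γ =>
    (if m = p.1 then MvPolynomial.C ((m.1 : ℂ) / 2 * pairing ξ γ.1 p.2.1) else 0 : Fock Γ)
    : Derivation ℂ (Fock Γ) (Fock Γ)).toLinearMap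

/-- The defining properties of the bilinear form on `S_Γ^-`: `⟨1, 1⟩ = 1` and
`a_m(γ)^* = a_{-m}(γ)` for all odd integers `m`, positive or negative. -/
structure IsFockForm [Fintype Γ] (ξ : Γ → ℂ) (B : LinearMap.BilinForm ℂ (Fock Γ)) : Prop where
  one_one : B 1 1 = 1
  adjoint_annihilation : ∀ m γ u v, B (annihilation ξ m γ u) v = B u (creation m γ v)
  adjoint_creation : ∀ m γ u v, B (creation m γ u) v = B u (annihilation ξ m γ v)

/-! ## The characteristic map -/

/-- `a_{-m}(c) = ∑_{γ ∈ Γ^*} γ(c⁻¹) a_{-m}(γ)`. -/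
def aNegClass [Fintype Γ] (m : OddNat) (c : ConjClasses Γ) : Fock Γ :=
  ∑ γ : IrrChar Γ, γ.1 (Quotient.out c)⁻¹ • aNeg m γ

/-- `a'_{-ρ} = ∏_c a_{-ρ(c)}(c)`, for a family `ρ` of partitions with odd parts. -/
def aPrime [Fintype Γ] (ρ : ConjClasses Γ → Multiset OddNat) : Fock Γ :=
  ∏ c, ((ρ c).map fun m => aNegClass m c).prod

/-- The value `f_ρ` of `f ∈ R^-(Γ̃_n)` on the conjugacy class `D_ρ^+`. -/
def valueAt [Fintype Γ] {n : ℕ} (ρ : OddPart (ConjClasses Γ) n) : RMinus Γ n →ₗ[ℂ] ℂ :=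
  if h : (classD ρ).Nonempty then (LinearMap.proj h.some).comp (RMinus Γ n).subtype else 0

variable (Γ)

/-- The characteristic map `ch(f) = ∑_{ρ ∈ OP(Γ_*)} Z_ρ⁻¹ f_ρ a'_{-ρ̄}`, where
`ρ̄(c) = ρ(c⁻¹)`. -/
def ch [Fintype Γ] : RSpace Γ →ₗ[ℂ] Fock Γ :=
  DirectSum.toModule ℂ ℕ _ fun n =>
    ∑ ρ : OddPart (ConjClasses Γ) n,
      (valueAt ρ).smulRight ((bigZ ρ)⁻¹ • aPrime fun c => ρ.1 (classInv c))

/-- The variant `f ↦ ∑_{ρ ∈ OP(Γ_*)} Z_ρ⁻¹ f_ρ a'_{-ρ}` of the characteristic map. -/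
def chPlain [Fintype Γ] : RSpace Γ →ₗ[ℂ] Fock Γ :=
  DirectSum.toModule ℂ ℕ _ fun n =>
    ∑ ρ : OddPart (ConjClasses Γ) n, (valueAt ρ).smulRight ((bigZ ρ)⁻¹ • aPrime ρ.1)

end Fock

end

end SpinWreath

/-! Both spaces have a basis indexed by $\mathcal{OP}(\Gamma_*)$, the characteristic map carries one
basis to a rescaling of the other, and the two Gram matrices agree.

Fock side. The form exists because a polynomial can act as a constant-coefficient differential
operator, after which one takes the constant term; it is unique because the adjoint relations peel
variables off one by one. By character orthogonality the elements `aNegClass m c` are free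
polynomial generators (`classesEquiv`). Multiplication by `aNegClass m c` is adjoint to a derivation
sending `aNegClass k d` to $\frac m2\zeta_c\xi(c)$ if $k=m$, $d=c^{-1}$, and to $0$ otherwise.
Induction on the degree gives $\langle
a'_{-\rho},a'_{-\sigma}\rangle'_\xi=\delta_{\sigma,\bar\rho}\,Z_\rho\prod_c(\xi(c)/2)^{l(\rho(c))}$
(`IsFockForm.aPrime_aPrime`).

Group side. An even $x=((g,a),s)$ is conjugate to $zx$, so that spin class functions vanish at it,
unless all cycles of $s$ are odd and the $\mathbb F_2$-vector of $a$ has the form $u+su$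
(`RMinus.odd_minimalPeriod`, `RMinus.exists_coboundary`). If both hold, $x$ is conjugate to $(g,s)$
up to a power of $z$. If $s$ has $l$ cycles there are $2^{n-l}$ such vectors, so averaging over the
fibre $\Pi_n$ of order $2^{n+1}$ leaves a factor $2^{-l}$ (`RMinus.sum_piGroup`). Elements of type
$\rho$ in $\Gamma_n$ have centralizers of order $Z_\rho$ (`HasType.card_centralizer`), whence
$\langle f,h\rangle_\xi=\sum_\rho Z_\rho^{-1}\prod_c(\xi(c)/2)^{l(\rho(c))}f_\rho h_{\bar\rho}$
(`weightedForm_eq`). The values $f_\rho$ can be prescribed freely (`values_bijective`), because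
$(g,s)$ of odd type is not conjugate to $z(g,s)$.

The function with $f_\rho=1$ and all other values $0$ goes to $Z_\rho^{-1}a'_{-\bar\rho}$, or to
$Z_\rho^{-1}a'_{-\rho}$ under the plain map. Self-duality of $\xi$ makes the weights invariant under
$\rho\mapsto\bar\rho$, so the Gram entries coincide in both cases (`bijective_isometry`). -/

namespace SpinWreath
noncomputable section
open scoped Classical

/-! ### Completeness and second orthogonality of irreducible characters -/

section Characters

open scoped MonoidAlgebra

variable {Γ : Type*} [Group Γ]

/-- A representation on a finite-dimensional space, written in coordinates. -/
def coordRep {S : Type*} [AddCommGroup S] [Module ℂ S] [FiniteDimensional ℂ S]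
    (ρ : Representation ℂ Γ S) :
    Representation ℂ Γ (Fin (Module.finrank ℂ S) → ℂ) :=
  ((Module.finBasis ℂ S).equivFun.conjRingEquiv : _ →* _).comp ρ

theorem coordRep_apply {S : Type*} [AddCommGroup S] [Module ℂ S] [FiniteDimensional ℂ S]
    (ρ : Representation ℂ Γ S) (x : Γ) (v : Fin (Module.finrank ℂ S) → ℂ) :
    coordRep ρ x v =
      (Module.finBasis ℂ S).equivFun (ρ x ((Module.finBasis ℂ S).equivFun.symm v)) := rfl

theorem coordRep_character {S : Type*} [AddCommGroup S] [Module ℂ S] [FiniteDimensional ℂ S]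
    (ρ : Representation ℂ Γ S) : (coordRep ρ).character = ρ.character := by
  funext x
  exact LinearMap.trace_conj' (ρ x) (Module.finBasis ℂ S).equivFun

/-- `IrrChar` only admits representations on `Fin d → ℂ`, so simple submodules of the group algebra
have to be moved there. The coordinate map is linear over the group algebra, hence preserves
simplicity. -/
theorem coordRep_isIrreducible {S : Type*} [AddCommGroup S] [Module ℂ S] [FiniteDimensional ℂ S]
    [Module ℂ[Γ] S] [IsSimpleModule ℂ[Γ] S] (ρ : Representation ℂ Γ S)
    (hρ : ∀ (a : ℂ[Γ]) (s : S), ρ.asAlgebraHom a s = a • s) : (coordRep ρ).IsIrreducible := by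
  rw [Representation.irreducible_iff_isSimpleModule_asModule]
  set b := (Module.finBasis ℂ S).equivFun
  have key : ∀ (a : ℂ[Γ]) (v : Fin (Module.finrank ℂ S) → ℂ),
      b.symm ((coordRep ρ).asAlgebraHom a v) = a • b.symm v := by
    intro a v
    rw [← hρ]
    induction a using MonoidAlgebra.induction_on with
    | of g => simp [coordRep_apply, b]
    | add f g hf hg => simp [hf, hg]
    | smul r f hf => simp [hf]
  let e : (coordRep ρ).asModule ≃ₗ[ℂ[Γ]] S :=
    { ((coordRep ρ).asModuleEquiv.trans b.symm).toAddEquiv with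
      map_smul' := fun a v => by
        have h := key a ((coordRep ρ).asModuleEquiv v)
        rw [← Representation.asModuleEquiv_map_smul] at h
        exact h }
  exact IsSimpleModule.congr e

/-- A class function orthogonal to all irreducible characters is zero. -/
theorem classFunction_eq_zero [Fintype Γ] (φ : Γ → ℂ) (hφ : ∀ x y, φ (y * x * y⁻¹) = φ x)
    (h : ∀ χ : IrrChar Γ, ∑ x, φ x * χ.1 x = 0) : φ = 0 := by
  have : NeZero (Nat.card Γ : ℂ) := ⟨Nat.cast_ne_zero.2 Nat.card_pos.ne'⟩
  -- A class function gives a central element, which acts on each simple submodule by a scalar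
  -- (Schur). Orthogonality to the character makes the trace, hence the scalar, zero.
  let u : ℂ[Γ] := ∑ x, φ x • MonoidAlgebra.of ℂ Γ x
  have hu : ∀ a : ℂ[Γ], u * a = a * u := by
    intro a
    induction a using MonoidAlgebra.induction_on with
    | of g =>
      simp only [u, Finset.sum_mul, Finset.mul_sum, smul_mul_assoc, mul_smul_comm, ← map_mul]
      rw [← Equiv.sum_comp (MulAut.conj g).toEquiv]
      refine Finset.sum_congr rfl fun x _ => ?_
      simp [MulAut.conj_apply, hφ]
    | add f g hf hg => rw [mul_add, add_mul, hf, hg]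
    | smul r f hf => rw [mul_smul_comm, smul_mul_assoc, hf]
  have key : ∀ S : Submodule ℂ[Γ] ℂ[Γ], IsSimpleModule ℂ[Γ] S → ∀ s ∈ S, u * s = 0 := by
    intro S hS
    let ρ : Representation ℂ Γ S := Representation.ofModule' S
    have hρ : ∀ (a : ℂ[Γ]) (s : S), ρ.asAlgebraHom a s = a • s := by
      intro a s
      induction a using MonoidAlgebra.induction_on with
      | of g => simp [ρ, Representation.ofModule']
      | add f g hf hg => simp [hf, hg, add_smul]
      | smul r f hf => simp [hf]
    let T : Module.End ℂ[Γ] S :=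
      { toFun := fun s => u • s
        map_add' := fun s t => smul_add _ _ _
        map_smul' := fun a s => by simp only [RingHom.id_apply, smul_smul, hu] }
    obtain ⟨c, hc⟩ := (IsSimpleModule.algebraMap_end_bijective_of_isAlgClosed (A := ℂ[Γ])
      (V := S) ℂ).2 T
    have hT : ∀ s : S, u • s = c • s := fun s => by
      have := LinearMap.congr_fun hc s
      exact this.symm
    have htr : LinearMap.trace ℂ S (ρ.asAlgebraHom u) = 0 := by
      have h1 := h ⟨(coordRep ρ).character, _, _, coordRep_isIrreducible ρ hρ, rfl⟩
      simp only [coordRep_character] at h1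
      rw [← h1]
      simp [u, Representation.character]
    have hu' : ρ.asAlgebraHom u = c • LinearMap.id := by
      ext1 s
      rw [hρ, hT]; rfl
    have hnt : Nontrivial S := IsSimpleModule.nontrivial ℂ[Γ] S
    rw [hu', map_smul, LinearMap.trace_id, smul_eq_mul, mul_eq_zero] at htr
    have hc0 : c = 0 := htr.resolve_right (Nat.cast_ne_zero.2 Module.finrank_pos.ne')
    intro s hs
    have := congrArg Subtype.val (hT ⟨s, hs⟩)
    simpa [hc0] using this
  -- The regular module is the sum of its simple submodules, so `u` kills all of it, and in
  -- particular `1`.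
  have htop : (⊤ : Submodule ℂ[Γ] ℂ[Γ]) ≤ LinearMap.ker (LinearMap.toSpanSingleton ℂ[Γ] ℂ[Γ] u) := by
    rw [← IsSemisimpleModule.sSup_simples_eq_top ℂ[Γ] ℂ[Γ]]
    refine sSup_le fun S hS s hs => ?_
    simp [← hu, key S hS s hs]
  have hu0 : u = 0 := by
    have : (1 : ℂ[Γ]) ∈ LinearMap.ker (LinearMap.toSpanSingleton ℂ[Γ] ℂ[Γ] u) := htop trivial
    simpa using this
  funext y
  have := congrArg (fun a : ℂ[Γ] => a.coeff y) hu0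
  simpa [u, MonoidAlgebra.of_apply, Finsupp.single_apply] using this

theorem IrrChar.conj (γ : IrrChar Γ) (x y : Γ) : γ.1 (y * x * y⁻¹) = γ.1 x := by
  obtain ⟨_, d, r, -, rfl⟩ := γ
  exact r.char_conj x y

theorem conj_invariant_of_isConj {φ : Γ → ℂ} (hφ : ∀ x y, φ (y * x * y⁻¹) = φ x) {x y : Γ}
    (h : IsConj x y) : φ x = φ y := by
  obtain ⟨c, rfl⟩ := isConj_iff.1 h
  exact (hφ x c).symm

theorem card_carrier_eq_sum [Fintype Γ] (y : Γ) :
    (Nat.card (ConjClasses.mk y).carrier : ℂ) = ∑ x : Γ, if IsConj x y then 1 else 0 := by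
  rw [Finset.sum_boole, Nat.card_eq_fintype_card, Fintype.card_subtype]
  simp only [ConjClasses.mem_carrier_iff_mk_eq, ConjClasses.mk_eq_mk_iff_isConj]

theorem zeta_ne_zero [Fintype Γ] (c : ConjClasses Γ) : zeta c ≠ 0 := by
  obtain ⟨y, rfl⟩ := ConjClasses.exists_rep c
  have : Nonempty (ConjClasses.mk y).carrier := ⟨⟨y, ConjClasses.mem_carrier_mk⟩⟩
  exact div_ne_zero (Nat.cast_ne_zero.2 Nat.card_pos.ne') (Nat.cast_ne_zero.2 Nat.card_pos.ne')

/-- Second orthogonality relation for irreducible characters. -/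
theorem sum_irrChar_mul_inv [Fintype Γ] (x y : Γ) :
    ∑ γ : IrrChar Γ, γ.1 x * γ.1 y⁻¹ = if IsConj x y then zeta (ConjClasses.mk y) else 0 := by
  let φ : Γ → ℂ := fun x => (∑ γ : IrrChar Γ, γ.1 x * γ.1 y⁻¹) -
    if IsConj x y then zeta (ConjClasses.mk y) else 0
  have hG : (Fintype.card Γ : ℂ) ≠ 0 := Nat.cast_ne_zero.2 Fintype.card_ne_zero
  -- The inversion turns the sums in `classFunction_eq_zero`, which carry no inverse, into the
  -- standard form.
  suffices h : (fun x => φ x⁻¹) = 0 by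
    have := congrFun h x⁻¹
    simp only [inv_inv] at this
    exact sub_eq_zero.1 this
  have hconj : ∀ x g, IsConj (g * x * g⁻¹) y ↔ IsConj x y := fun x g =>
    have hg : IsConj x (g * x * g⁻¹) := isConj_iff.2 ⟨g, rfl⟩
    ⟨hg.trans, hg.symm.trans⟩
  refine classFunction_eq_zero _ (fun x g => ?_) fun χ => ?_
  · have hx : (g * x * g⁻¹)⁻¹ = g * x⁻¹ * g⁻¹ := by group
    simp only [φ, hx, IrrChar.conj, hconj]
  · rw [← Equiv.sum_comp (Equiv.inv Γ)]
    simp only [Equiv.inv_apply, inv_inv, φ, sub_mul, Finset.sum_sub_distrib, Finset.sum_mul]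
    have h1 : ∑ x : Γ, ∑ γ : IrrChar Γ, γ.1 x * γ.1 y⁻¹ * χ.1 x⁻¹ =
        Fintype.card Γ * χ.1 y⁻¹ := by
      rw [Finset.sum_comm]
      have : ∀ γ : IrrChar Γ, ∑ x : Γ, γ.1 x * γ.1 y⁻¹ * χ.1 x⁻¹ =
          if γ = χ then Fintype.card Γ * γ.1 y⁻¹ else 0 := by
        intro γ
        have := stdForm_irrChar γ χ
        rw [stdForm, inv_mul_eq_iff_eq_mul₀ hG] at this
        simp only [mul_right_comm _ (γ.1 y⁻¹), ← Finset.sum_mul, this]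
        split_ifs <;> simp
      simp [this]
    have h2 : ∑ x : Γ, (if IsConj x y then zeta (ConjClasses.mk y) else 0) * χ.1 x⁻¹ =
        Fintype.card Γ * χ.1 y⁻¹ := by
      have : ∀ x : Γ, (if IsConj x y then zeta (ConjClasses.mk y) else 0) * χ.1 x⁻¹ =
          zeta (ConjClasses.mk y) * χ.1 y⁻¹ * if IsConj x y then 1 else 0 := by
        intro x
        split_ifs with h
        · obtain ⟨c, rfl⟩ := isConj_iff.1 h
          have hx : (c * x * c⁻¹)⁻¹ = c * x⁻¹ * c⁻¹ := by group
          rw [hx, χ.conj, mul_one]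
        · simp
      have hne : Nonempty (ConjClasses.mk y).carrier := ⟨⟨y, ConjClasses.mem_carrier_mk⟩⟩
      have hc : (Nat.card (ConjClasses.mk y).carrier : ℂ) ≠ 0 :=
        Nat.cast_ne_zero.2 Nat.card_pos.ne'
      rw [Finset.sum_congr rfl fun x _ => this x, ← Finset.mul_sum, ← card_carrier_eq_sum, zeta,
        Nat.card_eq_fintype_card (α := Γ)]
      field_simp
    rw [h1, h2, sub_self]

end Characters

/-! ### Polynomials as differential operators, and the form they define -/

section PolynomialForm

open MvPolynomial

variable {σ : Type*} (c : σ → σ → ℂ)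

/-- The derivation `X q ↦ c p q` of a polynomial algebra. -/
def constDer (p : σ) : Derivation ℂ (MvPolynomial σ ℂ) (MvPolynomial σ ℂ) :=
  mkDerivation ℂ fun q => C (c p q)

@[simp] theorem constDer_X (p q : σ) : constDer c p (X q) = C (c p q) :=
  mkDerivation_X _ _ _

theorem constDer_comm (p q : σ) (u : MvPolynomial σ ℂ) :
    constDer c p (constDer c q u) = constDer c q (constDer c p u) := by
  have : ⁅constDer c p, constDer c q⁆ = 0 := by
    refine derivation_ext fun i => ?_
    simp [Derivation.commutator_apply]
  have := DFunLike.congr_fun this u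
  rwa [Derivation.commutator_apply, Derivation.zero_apply, sub_eq_zero] at this

open scoped IsMulCommutative in
/-- A polynomial `u`, as a differential operator with constant coefficients: `X p` acts by
`constDer c p`. -/
def polyOp : MvPolynomial σ ℂ →ₐ[ℂ] Module.End ℂ (MvPolynomial σ ℂ) :=
  let s : Set (Module.End ℂ (MvPolynomial σ ℂ)) := Set.range fun p => (constDer c p).toLinearMap
  -- `aeval` needs a commutative target, hence the passage through the subalgebra generated by the
  -- commuting derivations.
  haveI : IsMulCommutative (Algebra.adjoin ℂ s) := Algebra.isMulCommutative_adjoin ℂ <| by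
    rintro _ ⟨p, rfl⟩ _ ⟨q, rfl⟩
    exact LinearMap.ext fun u => constDer_comm c p q u
  (Algebra.adjoin ℂ s).val.comp
    (aeval fun p => (⟨(constDer c p).toLinearMap, Algebra.subset_adjoin ⟨p, rfl⟩⟩ :
      Algebra.adjoin ℂ s))

@[simp] theorem polyOp_X (p : σ) (v : MvPolynomial σ ℂ) :
    polyOp c (X p) v = constDer c p v := by
  simp [polyOp]

/-- The Weyl relation: commuting `constDer c q` past multiplication by `X p` leaves the constant `c
q p`, so commuting `polyOp c u` past it differentiates `u`. Symmetry of `c` makes the derivation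
that appears `constDer c p`. -/
theorem polyOp_X_mul (hc : ∀ p q, c p q = c q p) (u v : MvPolynomial σ ℂ) (p : σ) :
    polyOp c u (X p * v) = X p * polyOp c u v + polyOp c (constDer c p u) v := by
  induction u using MvPolynomial.induction_on generalizing v with
  | C a =>
    have : (C a : MvPolynomial σ ℂ) = algebraMap ℂ _ a := rfl
    simp [this, Module.algebraMap_end_apply]
  | add u u' hu hu' => simp only [map_add, LinearMap.add_apply, hu, hu']; ring
  | mul_X u q hu =>
    have h1 : constDer c q (X p * v) = X p * constDer c q v + c p q • v := by
      simp [Derivation.leibniz, hc p q, smul_eq_C_mul, mul_comm v]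
    have h2 : constDer c p (u * X q) = c p q • u + constDer c p u * X q := by
      simp [Derivation.leibniz, smul_eq_C_mul, mul_comm]
    simp only [h2, map_mul, map_add, map_smul, Module.End.mul_apply, polyOp_X, h1, hu,
      LinearMap.add_apply, LinearMap.smul_apply]
    ring

/-- The form `⟨u, v⟩` on polynomials for which `X p` is adjoint to `constDer c p`. -/
def polyForm : LinearMap.BilinForm ℂ (MvPolynomial σ ℂ) :=
  (polyOp c).toLinearMap.compr₂ (lcoeff ℂ (0 : σ →₀ ℕ))

theorem polyForm_apply (u v : MvPolynomial σ ℂ) :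
    polyForm c u v = constantCoeff (polyOp c u v) := rfl

theorem polyForm_one_one : polyForm c 1 1 = 1 := by
  simp [polyForm_apply]

theorem polyForm_X_mul (p : σ) (u v : MvPolynomial σ ℂ) :
    polyForm c (X p * u) v = polyForm c u (constDer c p v) := by
  rw [polyForm_apply, polyForm_apply, mul_comm, map_mul, Module.End.mul_apply, polyOp_X]

/-- In `polyOp_X_mul` the term with the factor `X p` has no constant term, so only the commutator
survives. -/
theorem polyForm_constDer (hc : ∀ p q, c p q = c q p) (p : σ) (u v : MvPolynomial σ ℂ) :
    polyForm c (constDer c p u) v = polyForm c u (X p * v) := by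
  simp [polyForm_apply, polyOp_X_mul c hc]

end PolynomialForm

/-! ### Existence and uniqueness of the form on the Fock space -/

section FockForm

open MvPolynomial

variable {Γ : Type*} [Group Γ] [Fintype Γ] {ξ : Γ → ℂ}

/-- The commutators of the annihilation and creation operators. -/
def fockPairing (ξ : Γ → ℂ) (p q : OddNat × IrrChar Γ) : ℂ :=
  if p.1 = q.1 then (p.1.1 : ℂ) / 2 * pairing ξ p.2.1 q.2.1 else 0

theorem annihilation_apply (m : OddNat) (γ : IrrChar Γ) (u : Fock Γ) :
    annihilation ξ m γ u = constDer (fockPairing ξ) (m, γ) u := by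
  have : (fun p : OddNat × IrrChar Γ =>
      (if m = p.1 then C ((m.1 : ℂ) / 2 * pairing ξ γ.1 p.2.1) else 0 : Fock Γ)) =
      fun q => C (fockPairing ξ (m, γ) q) := by
    funext q
    unfold fockPairing
    split_ifs <;> simp
  simp only [annihilation, this, constDer]
  rfl

/-- Substitute `x⁻¹` for `x`. This symmetry is what self-duality of `ξ` contributes to the existence
of the form. -/
theorem pairing_comm (hdual : ∀ x, ξ x⁻¹ = ξ x) (φ ψ : Γ → ℂ) :
    pairing ξ φ ψ = pairing ξ ψ φ := by
  unfold pairing stdForm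
  rw [← Equiv.sum_comp (Equiv.inv Γ)]
  simp only [Equiv.inv_apply, inv_inv, Pi.mul_apply, hdual]
  congr 1
  exact Finset.sum_congr rfl fun x _ => by ring

theorem fockPairing_comm (hdual : ∀ x, ξ x⁻¹ = ξ x) (p q : OddNat × IrrChar Γ) :
    fockPairing ξ p q = fockPairing ξ q p := by
  unfold fockPairing
  by_cases h : p.1 = q.1
  · simp [h, pairing_comm hdual p.2.1]
  · simp [h, Ne.symm h]

theorem isFockForm_polyForm (hdual : ∀ x, ξ x⁻¹ = ξ x) :
    IsFockForm ξ (polyForm (fockPairing ξ)) where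
  one_one := polyForm_one_one _
  adjoint_annihilation m γ u v := by
    rw [annihilation_apply, polyForm_constDer _ (fockPairing_comm hdual)]
    rfl
  adjoint_creation m γ u v := by
    rw [annihilation_apply, ← polyForm_X_mul]
    rfl

/-- Annihilation operators kill the vacuum `1`, so it is orthogonal to the image of every creation
operator. -/
theorem IsFockForm.one_X_mul {B : LinearMap.BilinForm ℂ (Fock Γ)} (hB : IsFockForm ξ B)
    (p : OddNat × IrrChar Γ) (v : Fock Γ) : B 1 (X p * v) = 0 := by
  have := hB.adjoint_annihilation p.1 p.2 1 v
  rw [annihilation_apply, (constDer _ _).map_one_eq_zero, map_zero, LinearMap.zero_apply] at this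
  exact this.symm

theorem IsFockForm.X_mul {B : LinearMap.BilinForm ℂ (Fock Γ)} (hB : IsFockForm ξ B)
    (p : OddNat × IrrChar Γ) (u v : Fock Γ) :
    B (X p * u) v = B u (constDer (fockPairing ξ) p v) := by
  rw [← annihilation_apply]
  exact hB.adjoint_creation p.1 p.2 u v

/-- Adjointness of creation peels the variables off the left argument. Once that is `1`, only the
constant term of the right argument counts. -/
theorem IsFockForm.unique {B B' : LinearMap.BilinForm ℂ (Fock Γ)} (hB : IsFockForm ξ B)
    (hB' : IsFockForm ξ B') : B = B' := by
  have h1 : ∀ v, B 1 v = B' 1 v := by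
    intro v
    induction v using MvPolynomial.induction_on with
    | C a =>
      have : (C a : Fock Γ) = a • 1 := by rw [smul_eq_C_mul, mul_one]
      rw [this, map_smul, map_smul, hB.one_one, hB'.one_one]
    | add u v hu hv => rw [map_add, map_add, hu, hv]
    | mul_X u p _ => rw [mul_comm, hB.one_X_mul, hB'.one_X_mul]
  refine LinearMap.ext fun u => ?_
  induction u using MvPolynomial.induction_on with
  | C a =>
    have : (C a : Fock Γ) = a • 1 := by rw [smul_eq_C_mul, mul_one]
    rw [this, map_smul, map_smul]
    exact LinearMap.ext fun v => by simp only [LinearMap.smul_apply, h1]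
  | add u v hu hv => rw [map_add, map_add, hu, hv]
  | mul_X u p hu =>
    refine LinearMap.ext fun v => ?_
    rw [mul_comm, hB.X_mul, hB'.X_mul, hu]

theorem existsUnique_fockForm (hdual : ∀ x, ξ x⁻¹ = ξ x) : ∃! B, IsFockForm ξ B :=
  ⟨_, isFockForm_polyForm hdual, fun _ hB => hB.unique (isFockForm_polyForm hdual)⟩

end FockForm

/-! ### Generators of the Fock space attached to conjugacy classes -/

section ClassGenerators

open MvPolynomial

variable {Γ : Type*} [Group Γ]

theorem classInv_mk (x : Γ) : classInv (ConjClasses.mk x) = ConjClasses.mk x⁻¹ := rfl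

theorem mk_out (c : ConjClasses Γ) : ConjClasses.mk (Quotient.out c) = c := Quotient.out_eq c

theorem isConj_out (x : Γ) : IsConj (Quotient.out (ConjClasses.mk x)) x :=
  ConjClasses.mk_eq_mk_iff_isConj.1 (mk_out _)

theorem classInv_classInv (c : ConjClasses Γ) : classInv (classInv c) = c := by
  obtain ⟨x, rfl⟩ := ConjClasses.exists_rep c
  rw [classInv_mk, classInv_mk, inv_inv]

/-- The involution `c ↦ c⁻¹` on conjugacy classes. -/
@[simps]
def classInvEquiv : ConjClasses Γ ≃ ConjClasses Γ :=
  ⟨classInv, classInv, classInv_classInv, classInv_classInv⟩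

variable [Fintype Γ] {ξ : Γ → ℂ}

theorem zeta_classInv (c : ConjClasses Γ) : zeta (classInv c) = zeta c := by
  unfold zeta
  congr 2
  refine Nat.card_congr ((Equiv.inv Γ).subtypeEquiv fun x => ?_)
  change x ∈ (classInv c).carrier ↔ x⁻¹ ∈ c.carrier
  rw [ConjClasses.mem_carrier_iff_mk_eq, ConjClasses.mem_carrier_iff_mk_eq, ← classInv_mk]
  exact ⟨fun h => by rw [h, classInv_classInv], fun h => by rw [← h, classInv_classInv]⟩

theorem sum_irrChar_class (x : Γ) (c : ConjClasses Γ) :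
    ∑ γ : IrrChar Γ, γ.1 x * γ.1 (Quotient.out c)⁻¹ =
      if ConjClasses.mk x = c then zeta c else 0 := by
  have h := sum_irrChar_mul_inv x (Quotient.out c)
  rw [mk_out] at h
  have hiff : IsConj x (Quotient.out c) ↔ ConjClasses.mk x = c := by
    rw [← ConjClasses.mk_eq_mk_iff_isConj, mk_out]
  rw [h]
  exact if_congr hiff rfl rfl

/-- `(zeta c)⁻¹` is the proportion of the elements of `Γ` that lie in `c`. -/
theorem sum_classes (φ : Γ → ℂ) (hφ : ∀ x y, φ (y * x * y⁻¹) = φ x) :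
    ∑ c : ConjClasses Γ, (zeta c)⁻¹ * φ (Quotient.out c) =
      (Fintype.card Γ : ℂ)⁻¹ * ∑ x, φ x := by
  rw [← Finset.sum_fiberwise (s := Finset.univ) (g := ConjClasses.mk) (f := φ), Finset.mul_sum]
  refine Finset.sum_congr rfl fun c _ => ?_
  have h1 : ∀ x ∈ Finset.univ.filter (fun x => ConjClasses.mk x = c), φ x = φ (Quotient.out c) := by
    intro x hx
    rw [Finset.mem_filter] at hx
    rw [← hx.2]
    exact (conj_invariant_of_isConj hφ (isConj_out x)).symm
  have h2 : (Nat.card c.carrier) = (Finset.univ.filter (fun x => ConjClasses.mk x = c)).card := by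
    rw [Nat.card_eq_fintype_card, Fintype.card_subtype]
    simp only [ConjClasses.mem_carrier_iff_mk_eq]
  rw [Finset.sum_congr rfl h1, Finset.sum_const, nsmul_eq_mul, zeta, inv_div, h2,
    Nat.card_eq_fintype_card]
  ring

/-- The polynomial algebra on generators indexed by classes, mapped to the Fock space. -/
def ofClasses : MvPolynomial (ConjClasses Γ × OddNat) ℂ →ₐ[ℂ] Fock Γ :=
  aeval fun p => aNegClass p.2 p.1

@[simp] theorem ofClasses_X (p : ConjClasses Γ × OddNat) :
    ofClasses (X p) = aNegClass p.2 p.1 := aeval_X _ _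

/-- The inverse of `ofClasses`. -/
def toClasses : Fock Γ →ₐ[ℂ] MvPolynomial (ConjClasses Γ × OddNat) ℂ :=
  aeval fun q => ∑ c, ((zeta c)⁻¹ * q.2.1 (Quotient.out c)) • X (c, q.1)

/-- The change of generators is given by the character table: first orthogonality inverts it on this
side, second orthogonality on the other. -/
theorem ofClasses_comp_toClasses :
    (ofClasses.comp toClasses : Fock Γ →ₐ[ℂ] Fock Γ) = AlgHom.id ℂ _ := by
  refine algHom_ext fun q => ?_
  have h : ∀ γ : IrrChar Γ, ∑ c, (zeta c)⁻¹ * q.2.1 (Quotient.out c) * γ.1 (Quotient.out c)⁻¹ =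
      if q.2 = γ then 1 else 0 := by
    intro γ
    rw [← stdForm_irrChar, stdForm,
      ← sum_classes (fun x => q.2.1 x * γ.1 x⁻¹)]
    · simp only [mul_assoc]
    · intro x y
      have hx : (y * x * y⁻¹)⁻¹ = y * x⁻¹ * y⁻¹ := by group
      simp only [hx, IrrChar.conj]
  simp only [toClasses, AlgHom.comp_apply, aeval_X, map_sum, map_smul, ofClasses_X, aNegClass,
    Finset.smul_sum, smul_smul, AlgHom.id_apply]
  rw [Finset.sum_comm]
  simp [← Finset.sum_smul, h, aNeg]

theorem toClasses_comp_ofClasses :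
    toClasses.comp ofClasses = AlgHom.id ℂ (MvPolynomial (ConjClasses Γ × OddNat) ℂ) := by
  refine algHom_ext fun p => ?_
  have h : ∀ c, ∑ γ : IrrChar Γ, γ.1 (Quotient.out p.1)⁻¹ * ((zeta c)⁻¹ * γ.1 (Quotient.out c)) =
      if c = p.1 then 1 else 0 := by
    intro c
    have := sum_irrChar_class (Quotient.out c) p.1
    rw [mk_out] at this
    simp only [mul_comm _ ((zeta c)⁻¹ * _), mul_assoc, ← Finset.mul_sum, this]
    split_ifs with hc
    · rw [hc, inv_mul_cancel₀ (zeta_ne_zero _)]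
    · simp
  simp only [AlgHom.comp_apply, ofClasses_X, aNegClass, aNeg, map_sum, map_smul, toClasses, aeval_X,
    Finset.smul_sum, smul_smul, AlgHom.id_apply]
  rw [Finset.sum_comm]
  simp [← Finset.sum_smul, h]

/-- The Fock space is the polynomial algebra in the generators `a_{-m}(c)`. -/
def classesEquiv : MvPolynomial (ConjClasses Γ × OddNat) ℂ ≃ₐ[ℂ] Fock Γ :=
  AlgEquiv.ofAlgHom ofClasses toClasses ofClasses_comp_toClasses toClasses_comp_ofClasses

/-- The scalars `(m / 2) ζ_c ξ(c)`. -/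
def classWeight (ξ : Γ → ℂ) (p : ConjClasses Γ × OddNat) : ℂ :=
  (p.2.1 : ℂ) / 2 * (zeta p.1 * ξ (Quotient.out p.1))

/-- Write each pairing as a sum over classes `e`. Second orthogonality in `γ` forces `e = c`, in
`γ'` it forces `d = classInv e`, and `(zeta e)⁻¹` cancels one of the two resulting factors `zeta`.
-/
theorem sum_pairing (hclass : ∀ x y, ξ (y * x * y⁻¹) = ξ x) (c d : ConjClasses Γ) :
    ∑ γ : IrrChar Γ, ∑ γ' : IrrChar Γ,
      γ.1 (Quotient.out c)⁻¹ * (γ'.1 (Quotient.out d)⁻¹ * pairing ξ γ.1 γ'.1) =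
      if d = classInv c then zeta c * ξ (Quotient.out c) else 0 := by
  have h1 : ∀ γ γ' : IrrChar Γ, pairing ξ γ.1 γ'.1 =
      ∑ e, (zeta e)⁻¹ * (ξ (Quotient.out e) * γ.1 (Quotient.out e) * γ'.1 (Quotient.out e)⁻¹) := by
    intro γ γ'
    rw [sum_classes (fun x => ξ x * γ.1 x * γ'.1 x⁻¹)]
    · rfl
    · intro x y
      have hx : (y * x * y⁻¹)⁻¹ = y * x⁻¹ * y⁻¹ := by group
      simp only [hx, IrrChar.conj, hclass]
  have h2 : ∀ e : ConjClasses Γ, ∑ γ : IrrChar Γ, γ.1 (Quotient.out e) * γ.1 (Quotient.out c)⁻¹ =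
      if e = c then zeta c else 0 := by
    intro e
    rw [sum_irrChar_class, mk_out]
  have h3 : ∀ e : ConjClasses Γ, ∑ γ : IrrChar Γ, γ.1 (Quotient.out e)⁻¹ * γ.1 (Quotient.out d)⁻¹ =
      if d = classInv e then zeta d else 0 := by
    intro e
    rw [sum_irrChar_class, ← classInv_mk, mk_out]
    exact if_congr eq_comm rfl rfl
  calc _ = ∑ e, (zeta e)⁻¹ * ξ (Quotient.out e) *
        ((∑ γ : IrrChar Γ, γ.1 (Quotient.out e) * γ.1 (Quotient.out c)⁻¹) *
        ∑ γ : IrrChar Γ, γ.1 (Quotient.out e)⁻¹ * γ.1 (Quotient.out d)⁻¹) := by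
        simp only [h1, Finset.mul_sum, Finset.sum_mul]
        rw [Finset.sum_congr rfl fun γ _ => Finset.sum_comm, Finset.sum_comm]
        refine Finset.sum_congr rfl fun e _ => ?_
        rw [Finset.sum_comm]
        refine Finset.sum_congr rfl fun γ _ => Finset.sum_congr rfl fun γ' _ => ?_
        ring
    _ = _ := by
        rw [Finset.sum_eq_single c]
        · rw [h2, h3, if_pos rfl]
          split_ifs with hd
          · rw [hd, zeta_classInv]
            have := zeta_ne_zero c
            field_simp
          · simp
        · intro e _ he
          rw [h2, if_neg he]; simp
        · simp

/-- The derivation `∑_γ γ(c⁻¹) a_m(γ)`. -/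
def classDer (ξ : Γ → ℂ) (p : ConjClasses Γ × OddNat) : Derivation ℂ (Fock Γ) (Fock Γ) :=
  ∑ γ : IrrChar Γ, γ.1 (Quotient.out p.1)⁻¹ • constDer (fockPairing ξ) (p.2, γ)

theorem classDer_apply (p : ConjClasses Γ × OddNat) (u : Fock Γ) :
    classDer ξ p u =
      ∑ γ : IrrChar Γ, γ.1 (Quotient.out p.1)⁻¹ • constDer (fockPairing ξ) (p.2, γ) u := by
  rw [classDer, ← Derivation.coeFnAddMonoidHom_apply, map_sum, Finset.sum_apply]
  rfl

/-- The passage to classes diagonalizes the pairing up to `c ↦ c⁻¹`, by `sum_pairing`; the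
derivations then become multiples of partial derivatives. -/
theorem classDer_aNegClass (hclass : ∀ x y, ξ (y * x * y⁻¹) = ξ x)
    (p q : ConjClasses Γ × OddNat) : classDer ξ p (aNegClass q.2 q.1) =
      if q = (classInv p.1, p.2) then C (classWeight ξ p) else 0 := by
  have h1 : classDer ξ p (aNegClass q.2 q.1) = C (∑ γ : IrrChar Γ, ∑ γ' : IrrChar Γ,
      γ.1 (Quotient.out p.1)⁻¹ * (γ'.1 (Quotient.out q.1)⁻¹ *
        fockPairing ξ (p.2, γ) (q.2, γ'))) := by
    simp only [classDer_apply, aNegClass, map_sum, Derivation.map_smul, aNeg, constDer_X,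
      Finset.smul_sum]
    rw [Finset.sum_comm]
    simp only [smul_eq_C_mul, C_mul]
    exact Finset.sum_congr rfl fun γ _ => Finset.sum_congr rfl fun γ' _ => mul_left_comm _ _ _
  obtain ⟨d, k⟩ := q
  obtain ⟨c, m⟩ := p
  rw [h1]
  simp only at h1 ⊢
  by_cases h : m = k
  · subst h
    have hq : ((d, m) = (classInv c, m)) ↔ d = classInv c := by simp
    simp only [hq, fockPairing, if_true]
    rw [← C_0, ← apply_ite C, classWeight, ← mul_ite_zero, ← sum_pairing hclass]
    simp only [Finset.mul_sum]
    congr 1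
    refine Finset.sum_congr rfl fun γ _ => Finset.sum_congr rfl fun γ' _ => ?_
    ring
  · simp [fockPairing, h, Ne.symm h]

end ClassGenerators

/-! ### Pairings of monomials in the class generators -/

section FockMonomials

open MvPolynomial

variable {Γ : Type*} [Group Γ] [Fintype Γ] {ξ : Γ → ℂ}

/-- Both sides obey the Leibniz rule along `ofClasses` and agree on the variables. -/
theorem classDer_ofClasses (hclass : ∀ x y, ξ (y * x * y⁻¹) = ξ x)
    (p : ConjClasses Γ × OddNat) (u : MvPolynomial (ConjClasses Γ × OddNat) ℂ) :
    classDer ξ p (ofClasses u) =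
      classWeight ξ p • ofClasses (pderiv (classInv p.1, p.2) u) := by
  induction u using MvPolynomial.induction_on with
  | C a =>
    have h1 : (C a : MvPolynomial (ConjClasses Γ × OddNat) ℂ) = algebraMap ℂ _ a := rfl
    rw [pderiv_C, h1, AlgHom.commutes, Derivation.map_algebraMap, map_zero, smul_zero]
  | add u v hu hv => simp only [map_add, hu, hv, smul_add]
  | mul_X u q hu =>
    simp only [map_mul, Derivation.leibniz, hu, ofClasses_X, classDer_aNegClass hclass, pderiv_X,
      Pi.single_apply, map_add, smul_eq_mul, smul_eq_C_mul]
    split_ifs with h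
    · simp only [map_one]; ring
    · simp only [map_zero]; ring

namespace IsFockForm

variable {B : LinearMap.BilinForm ℂ (Fock Γ)}

theorem aNegClass_mul (hB : IsFockForm ξ B) (p : ConjClasses Γ × OddNat) (u v : Fock Γ) :
    B (aNegClass p.2 p.1 * u) v = B u (classDer ξ p v) := by
  simp only [aNegClass, classDer_apply, Finset.sum_mul, smul_mul_assoc, map_sum, map_smul,
    LinearMap.sum_apply, LinearMap.smul_apply]
  exact Finset.sum_congr rfl fun γ _ => by rw [← hB.X_mul]; rfl

theorem one_aNegClass_mul (hB : IsFockForm ξ B) (p : ConjClasses Γ × OddNat) (v : Fock Γ) :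
    B 1 (aNegClass p.2 p.1 * v) = 0 := by
  simp only [aNegClass, Finset.sum_mul, smul_mul_assoc, map_sum, map_smul]
  refine Finset.sum_eq_zero fun γ _ => ?_
  have := hB.one_X_mul (p.2, γ) v
  rw [aNeg, this, smul_zero]

/-- The squared norm of the monomial with exponents `α`. -/
def _root_.SpinWreath.monomialWeight (ξ : Γ → ℂ) (α : ConjClasses Γ × OddNat →₀ ℕ) : ℂ :=
  α.prod fun p k => (k.factorial : ℂ) * classWeight ξ p ^ k

/-- Only the factor at `p` changes. Taking both products over `insert p α.support` covers the cases
where `p` does and does not already occur in `α`. -/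
theorem _root_.SpinWreath.monomialWeight_add_single (α : ConjClasses Γ × OddNat →₀ ℕ)
    (p : ConjClasses Γ × OddNat) : monomialWeight ξ (α + Finsupp.single p 1) =
      classWeight ξ p * (α p + 1 : ℕ) * monomialWeight ξ α := by
  have hs : ∀ β : ConjClasses Γ × OddNat →₀ ℕ, β.support ⊆ insert p α.support →
      monomialWeight ξ β = ((β p).factorial : ℂ) * classWeight ξ p ^ β p *
        ∏ q ∈ (insert p α.support).erase p, ((β q).factorial : ℂ) * classWeight ξ q ^ β q := by
    intro β hβ
    rw [monomialWeight, Finsupp.prod_of_support_subset _ hβ _ (by simp),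
      ← Finset.mul_prod_erase _ _ (Finset.mem_insert_self p _)]
  rw [hs α (Finset.subset_insert _ _), hs (α + Finsupp.single p 1)]
  · have : ∀ q ∈ (insert p α.support).erase p,
        (α + Finsupp.single p 1 : ConjClasses Γ × OddNat →₀ ℕ) q = α q := by
      intro q hq
      simp [(Finset.ne_of_mem_erase hq).symm]
    rw [Finset.prod_congr rfl fun q hq => by rw [this q hq]]
    simp only [Finsupp.add_apply, Finsupp.single_eq_same, Nat.factorial_succ, pow_succ]
    push_cast
    ring
  · intro q hq
    by_contra h
    simp only [Finset.mem_insert, Finsupp.mem_support_iff, not_or, not_not] at h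
    simp [h.2, Ne.symm h.1] at hq

/-- Induction on the degree of `α`. A variable `p` removed on the left becomes a derivative on the
right in the variable of the inverse class. Its exponent there, collected over the steps, builds the
factorials in `monomialWeight`. -/
theorem monomial (hB : IsFockForm ξ B) (hclass : ∀ x y, ξ (y * x * y⁻¹) = ξ x)
    (α β : ConjClasses Γ × OddNat →₀ ℕ) :
    B (ofClasses (MvPolynomial.monomial α 1)) (ofClasses (MvPolynomial.monomial β 1)) =
      if ∀ c m, β (classInv c, m) = α (c, m) then monomialWeight ξ α else 0 := by
  have hsplit : ∀ (α : ConjClasses Γ × OddNat →₀ ℕ) p, ofClasses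
      (MvPolynomial.monomial (α + Finsupp.single p 1) 1) =
        aNegClass p.2 p.1 * ofClasses (MvPolynomial.monomial α 1) := by
    intro α p
    rw [add_comm, MvPolynomial.monomial_single_add, pow_one, map_mul, ofClasses_X]
  induction hn : α.degree generalizing α β with
  | zero =>
    obtain rfl : α = 0 := (Finsupp.degree_eq_zero_iff α).1 hn
    by_cases hβ : β = 0
    · subst hβ
      simp [hB.one_one, monomialWeight]
    · obtain ⟨p, hp⟩ := Finsupp.ne_iff.1 hβ
      have h1 : β = (β - Finsupp.single p 1) + Finsupp.single p 1 :=
        (tsub_add_cancel_of_le (Finsupp.single_le_iff.2 (Nat.one_le_iff_ne_zero.2 hp))).symm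
      have h2 : ofClasses (MvPolynomial.monomial 0 1) = (1 : Fock Γ) := by
        rw [← MvPolynomial.C_apply, C_1, map_one]
      rw [h1, hsplit, h2, hB.one_aNegClass_mul, if_neg]
      intro h
      have := h (classInv p.1) p.2
      rw [← h1, classInv_classInv] at this
      exact hp this
  | succ n ih =>
    have hα : α ≠ 0 := by rintro rfl; simp at hn
    obtain ⟨p, hp⟩ := Finsupp.ne_iff.1 hα
    obtain ⟨α', rfl⟩ : ∃ α', α = α' + Finsupp.single p 1 := ⟨α - Finsupp.single p 1,
      (tsub_add_cancel_of_le (Finsupp.single_le_iff.2 (Nat.one_le_iff_ne_zero.2 hp))).symm⟩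
    have hn' : α'.degree = n := by simpa using hn
    have hpd : pderiv (classInv p.1, p.2) (MvPolynomial.monomial β (1 : ℂ)) =
        (β (classInv p.1, p.2) : ℂ) • MvPolynomial.monomial
          (β - Finsupp.single (classInv p.1, p.2) 1) (1 : ℂ) := by
      rw [pderiv_monomial, smul_monomial]; simp
    rw [hsplit, hB.aNegClass_mul, classDer_ofClasses hclass, hpd]
    simp only [map_smul, ih _ _ hn', smul_eq_mul]
    rw [monomialWeight_add_single]
    -- If the dual variable is missing from `β`, the derivative is zero and the exponents cannot
    -- match either.
    by_cases h0 : β (classInv p.1, p.2) = 0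
    · have hneg : ¬ ∀ c m, β (classInv c, m) =
          (α' + Finsupp.single p 1 : ConjClasses Γ × OddNat →₀ ℕ) (c, m) := by
        intro h
        have := h p.1 p.2
        simp [h0] at this
      rw [h0, if_neg hneg, Nat.cast_zero, zero_mul, mul_zero]
    · obtain ⟨β', rfl⟩ : ∃ β', β = β' + Finsupp.single (classInv p.1, p.2) 1 :=
        ⟨β - Finsupp.single (classInv p.1, p.2) 1, (tsub_add_cancel_of_le
          (Finsupp.single_le_iff.2 (Nat.one_le_iff_ne_zero.2 h0))).symm⟩
      -- Removing `p` on one side and its dual on the other does not affect whether the exponents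
      -- match.
      have hiff : (∀ c m, (β' + Finsupp.single (classInv p.1, p.2) 1
          : ConjClasses Γ × OddNat →₀ ℕ) (classInv c, m) =
          (α' + Finsupp.single p 1 : ConjClasses Γ × OddNat →₀ ℕ) (c, m)) ↔
          ∀ c m, β' (classInv c, m) = α' (c, m) := by
        refine forall₂_congr fun c m => ?_
        have : Finsupp.single (classInv p.1, p.2) 1 (classInv c, m) =
            (Finsupp.single p 1 : ConjClasses Γ × OddNat →₀ ℕ) (c, m) := by
          simp only [Finsupp.single_apply, Prod.ext_iff]
          exact if_congr (and_congr_left' (classInvEquiv.apply_eq_iff_eq (x := p.1) (y := c))) rfl rfl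
        simp [this]
      simp only [add_tsub_cancel_right, hiff]
      split_ifs with h
      · have := h p.1 p.2
        simp only [Finsupp.add_apply, Finsupp.single_eq_same, this]
        ring
      · simp

end IsFockForm

/-- Families of partitions as exponents of monomials. -/
def exponents (X : Type*) [Fintype X] : (X → Multiset OddNat) ≃ (X × OddNat →₀ ℕ) :=
  ((Equiv.piCongrRight fun _ => Multiset.toFinsupp.toEquiv).trans
    Finsupp.equivFunOnFinite.symm).trans Finsupp.curryEquiv.symm

theorem exponents_apply {X : Type*} [Fintype X] (ρ : X → Multiset OddNat) (x : X) (m : OddNat) :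
    exponents X ρ (x, m) = (ρ x).count m := by
  simp [exponents, Finsupp.curryEquiv]

/-- The condition `hg` lets the product run over a rectangle that contains the support. -/
theorem exponents_prod {X M : Type*} [Fintype X] [CommMonoid M] (ρ : X → Multiset OddNat)
    (g : X × OddNat → ℕ → M) (hg : ∀ p, g p 0 = 1) :
    (exponents X ρ).prod g = ∏ x, ∏ m ∈ (ρ x).toFinset, g (x, m) ((ρ x).count m) := by
  have hsub : (exponents X ρ).support ⊆
      Finset.univ ×ˢ (Finset.univ.biUnion fun x => (ρ x).toFinset) := by
    rintro ⟨x, m⟩ hx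
    rw [Finsupp.mem_support_iff, exponents_apply, Multiset.count_ne_zero] at hx
    simp only [Finset.mem_product, Finset.mem_univ, true_and, Finset.mem_biUnion,
      Multiset.mem_toFinset]
    exact ⟨x, hx⟩
  rw [Finsupp.prod_of_support_subset _ hsub _ fun p _ => hg p, Finset.prod_product]
  refine Finset.prod_congr rfl fun x _ => ?_
  simp only [exponents_apply]
  refine (Finset.prod_subset ?_ ?_).symm
  · exact Finset.subset_biUnion_of_mem (fun x => (ρ x).toFinset) (Finset.mem_univ x)
  · intro m _ hm
    rw [Multiset.mem_toFinset] at hm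
    rw [Multiset.count_eq_zero_of_notMem hm, hg]

theorem aPrime_eq (ρ : ConjClasses Γ → Multiset OddNat) :
    aPrime ρ = ofClasses (MvPolynomial.monomial (exponents _ ρ) 1) := by
  rw [MvPolynomial.monomial_eq, C_1, one_mul, map_finsuppProd, exponents_prod]
  · simp only [map_pow, ofClasses_X, aPrime, Finset.prod_multiset_map_count]
  · simp

/-- `∏_c (ξ(c) / 2)^{l(ρ(c))}`. -/
def lengthWeight (ξ : Γ → ℂ) (ρ : ConjClasses Γ → Multiset OddNat) : ℂ :=
  ∏ c : ConjClasses Γ, (ξ (Quotient.out c) / 2) ^ Multiset.card (ρ c)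

/-- Split `classWeight` as $m\cdot\zeta_c\cdot\xi(c)/2$: the factorials, the parts $m$ and the
$\zeta_c$ make up $Z_\rho$, and each part leaves one factor $\xi(c)/2$. -/
theorem monomialWeight_exponents {n : ℕ} (ρ : OddPart (ConjClasses Γ) n) :
    monomialWeight ξ (exponents _ ρ.1) = bigZ ρ * lengthWeight ξ ρ.1 := by
  rw [monomialWeight, exponents_prod _ _ (by simp), bigZ, lengthWeight, ← Finset.prod_mul_distrib]
  refine Finset.prod_congr rfl fun c _ => ?_
  have : (∏ m ∈ (ρ.1 c).toFinset, (zeta c * (ξ (Quotient.out c) / 2)) ^ (ρ.1 c).count m) =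
      (zeta c * (ξ (Quotient.out c) / 2)) ^ Multiset.card (ρ.1 c) := by
    rw [Finset.prod_pow_eq_pow_sum, Multiset.toFinset_sum_count_eq]
  rw [mul_assoc, ← mul_pow, ← this, ← Finset.prod_mul_distrib]
  refine Finset.prod_congr rfl fun m _ => ?_
  rw [mul_assoc, ← mul_pow]
  congr 2
  simp only [classWeight]
  ring

/-- The Gram matrix on the Fock side, to be compared with `weightedForm_rMinusBasis`. -/
theorem IsFockForm.aPrime_aPrime {B : LinearMap.BilinForm ℂ (Fock Γ)} (hB : IsFockForm ξ B)
    (hclass : ∀ x y, ξ (y * x * y⁻¹) = ξ x) {n : ℕ} (ρ : OddPart (ConjClasses Γ) n)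
    (σ : ConjClasses Γ → Multiset OddNat) :
    B (aPrime ρ.1) (aPrime σ) =
      if σ = (fun c => ρ.1 (classInv c)) then bigZ ρ * lengthWeight ξ ρ.1 else 0 := by
  rw [aPrime_eq, aPrime_eq, hB.monomial hclass, monomialWeight_exponents]
  refine if_congr ?_ rfl rfl
  simp only [exponents_apply, funext_iff, Multiset.ext]
  exact ⟨fun h c m => by rw [← h, classInv_classInv],
    fun h c m => by rw [h, classInv_classInv]⟩

/-- The products `a'_{-ρ}` form a basis of the Fock space. -/
def aPrimeBasis (Γ : Type*) [Group Γ] [Fintype Γ] :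
    Module.Basis (Σ n, OddPart (ConjClasses Γ) n) ℂ (Fock Γ) :=
  ((basisMonomials (ConjClasses Γ × OddNat) ℂ).map classesEquiv.toLinearEquiv).reindex
    ((Equiv.sigmaFiberEquiv fun ρ : ConjClasses Γ → Multiset OddNat =>
      ∑ c, ((ρ c).map Subtype.val).sum).trans (exponents _)).symm

theorem aPrimeBasis_apply (ρ : Σ n, OddPart (ConjClasses Γ) n) :
    aPrimeBasis Γ ρ = aPrime ρ.2.1 := by
  rw [aPrime_eq]
  simp [aPrimeBasis]
  rfl

end FockMonomials

/-! ### Coefficients along cycles in the wreath product, and cycle labels -/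

section Wreath

open Equiv.Perm Function

variable {Γ : Type*} [Group Γ] {n : ℕ}

/-- The coefficient of `v` acting on `{1, …, n} × Γ` by `v (i, x) = (s i, transport v i * x)`, for
`v = (g, s)`. -/
def transport (v : Wreath Γ n) (i : Fin n) : Γ := v.left (v.right i)

theorem transport_mul (u v : Wreath Γ n) (i : Fin n) :
    transport (u * v) i = transport u (v.right i) * transport v i := by
  change u.left (u.right (v.right i)) * v.left (u.right.symm (u.right (v.right i))) = _
  rw [Equiv.symm_apply_apply]
  rfl

@[simp] theorem transport_one (i : Fin n) : transport (1 : Wreath Γ n) i = 1 := rfl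

@[simp] theorem right_zpow (v : Wreath Γ n) (k : ℤ) : (v ^ k).right = v.right ^ k :=
  map_zpow SemidirectProduct.rightHom v k

@[simp] theorem right_pow (v : Wreath Γ n) (k : ℕ) : (v ^ k).right = v.right ^ k :=
  map_pow SemidirectProduct.rightHom v k

theorem transport_inv (v : Wreath Γ n) (i : Fin n) :
    transport v⁻¹ (v.right i) = (transport v i)⁻¹ := by
  have := transport_mul v⁻¹ v i
  rw [inv_mul_cancel, transport_one] at this
  exact (inv_eq_of_mul_eq_one_left this.symm).symm

theorem wreath_ext {u v : Wreath Γ n} (h : ∀ i, u.right i = v.right i)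
    (h' : ∀ i, transport u i = transport v i) : u = v := by
  have hr : u.right = v.right := Equiv.ext h
  refine SemidirectProduct.ext (funext fun i => ?_) hr
  have := h' (u.right.symm i)
  rwa [transport, transport, ← hr, Equiv.apply_symm_apply] at this

/-- The element of the wreath product with given permutation and coefficients. -/
def ofTransport (s : Equiv.Perm (Fin n)) (t : Fin n → Γ) : Wreath Γ n := ⟨t ∘ s.symm, s⟩

@[simp] theorem transport_ofTransport (s : Equiv.Perm (Fin n)) (t : Fin n → Γ) (i : Fin n) :
    transport (ofTransport s t) i = t i := by
  simp [transport, ofTransport]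

theorem transport_zpow_of_fixed (v : Wreath Γ n) {i : Fin n} (h : v.right i = i) (k : ℤ) :
    transport (v ^ k) i = transport v i ^ k := by
  have hk : ∀ k : ℤ, (v.right ^ k) i = i := fun k => zpow_apply_eq_self_of_apply_eq_self h k
  induction k using Int.induction_on with
  | zero => simp
  | succ k ih => rw [zpow_add_one, transport_mul, h, ih, zpow_add_one]
  | pred k ih =>
    have := transport_mul (v ^ (-(k : ℤ) - 1)) v i
    rw [← zpow_add_one, sub_add_cancel, ih, h] at this
    rw [zpow_sub_one (transport v i), this, mul_inv_cancel_right]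

theorem zpow_apply_eq_iff (s : Equiv.Perm (Fin n)) (i : Fin n) (k : ℤ) :
    (s ^ k) i = i ↔ (minimalPeriod s i : ℤ) ∣ k := by
  have h := MulAction.zpow_smul_eq_iff_minimalPeriod_dvd (a := s) (b := i) (n := k)
  exact h

theorem minimalPeriod_pos (s : Equiv.Perm (Fin n)) (i : Fin n) : 0 < minimalPeriod s i :=
  IsPeriodicPt.minimalPeriod_pos (orderOf_pos s) <| by
    rw [IsPeriodicPt, IsFixedPt, iterate_eq_pow, pow_orderOf_eq_one, one_apply]

theorem pow_minimalPeriod_apply (s : Equiv.Perm (Fin n)) (i : Fin n) :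
    (s ^ minimalPeriod s i) i = i := by
  rw [← iterate_eq_pow]
  exact iterate_minimalPeriod

/-- The product of the coefficients along the cycle through `i`, starting at `i`. -/
def holonomy (w : Wreath Γ n) (i : Fin n) : Γ := transport (w ^ minimalPeriod w.right i) i

/-- The class of the cycle-product and the length of the cycle through `i`. -/
def label (w : Wreath Γ n) (i : Fin n) : ConjClasses Γ × ℕ :=
  (ConjClasses.mk (holonomy w i), minimalPeriod w.right i)

theorem right_of_semiconjBy {u v w : Wreath Γ n} (h : SemiconjBy v w u) (i : Fin n) :
    v.right (w.right i) = u.right (v.right i) :=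
  congrArg (fun x : Wreath Γ n => x.right i) h.eq

theorem minimalPeriod_of_semiconjBy {u v w : Wreath Γ n} (h : SemiconjBy v w u) (i : Fin n) :
    minimalPeriod u.right (v.right i) = minimalPeriod w.right i := by
  rw [minimalPeriod_eq_minimalPeriod_iff]
  intro k
  rw [IsPeriodicPt, IsPeriodicPt, IsFixedPt, IsFixedPt, iterate_eq_pow, iterate_eq_pow]
  have := right_of_semiconjBy (h.pow_right k) i
  rw [right_pow, right_pow] at this
  rw [← this, EmbeddingLike.apply_eq_iff_eq]

/-- Compare the coefficients at `i` in `v * w ^ m = u ^ m * v`, where `m` is the common period: both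
points return to themselves, so `transport v i` conjugates one holonomy into the other. -/
theorem holonomy_of_semiconjBy {u v w : Wreath Γ n} (h : SemiconjBy v w u) (i : Fin n) :
    holonomy u (v.right i) * transport v i = transport v i * holonomy w i := by
  have := congrArg (transport · i) (h.pow_right (minimalPeriod w.right i)).eq
  simp only [transport_mul, right_pow, pow_minimalPeriod_apply] at this
  rw [holonomy, holonomy, minimalPeriod_of_semiconjBy h, this]

theorem label_of_semiconjBy {u v w : Wreath Γ n} (h : SemiconjBy v w u) (i : Fin n) :
    label u (v.right i) = label w i := by
  rw [label, label, minimalPeriod_of_semiconjBy h]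
  congr 1
  rw [eq_comm, ConjClasses.mk_eq_mk_iff_isConj]
  exact ⟨toUnits (transport v i), (holonomy_of_semiconjBy h i).symm⟩

/-- Powers of `w` commute with `w`, so this is conjugation invariance with `u = w`. -/
theorem label_of_sameCycle (w : Wreath Γ n) {i j : Fin n} (h : w.right.SameCycle i j) :
    label w i = label w j := by
  obtain ⟨k, rfl⟩ := h
  rw [← right_zpow, label_of_semiconjBy (Commute.zpow_self w k)]

/-- The label of a cycle. -/
def cycleLabel (w : Wreath Γ n) (q : Cycles w.right) : ConjClasses Γ × ℕ := label w q.out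

/-- The cycle through `i`. -/
def cycleOfPoint (s : Equiv.Perm (Fin n)) (i : Fin n) : Cycles s :=
  Quotient.mk (SameCycle.setoid s) i

theorem cycleOfPoint_eq_iff {s : Equiv.Perm (Fin n)} {i j : Fin n} :
    cycleOfPoint s i = cycleOfPoint s j ↔ s.SameCycle i j := Quotient.eq

@[simp] theorem cycleOfPoint_out {s : Equiv.Perm (Fin n)} (q : Cycles s) :
    cycleOfPoint s q.out = q := Quotient.out_eq q

theorem sameCycle_out (s : Equiv.Perm (Fin n)) (i : Fin n) :
    s.SameCycle (cycleOfPoint s i).out i := cycleOfPoint_eq_iff.1 (cycleOfPoint_out _)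

theorem cycleLabel_cycleOfPoint (w : Wreath Γ n) (i : Fin n) :
    cycleLabel w (cycleOfPoint w.right i) = label w i :=
  label_of_sameCycle w (sameCycle_out _ i)

/-- `transport` reads `w.left` at the image of a point, whereas the cycle-product reads it at the
point itself; hence the start one step earlier. By `label_of_sameCycle` this shift does not change
the class. -/
theorem prod_eq_transport (w : Wreath Γ n) (i : Fin n) (m : ℕ) :
    ((List.range m).map fun k => w.left ((w.right ^ k) i)).reverse.prod =
      transport (w ^ m) (w.right⁻¹ i) := by
  induction m with
  | zero => simp
  | succ m ih =>
    rw [List.range_succ, List.map_append, List.reverse_append, List.prod_append, ih, pow_succ',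
      transport_mul, right_pow]
    congr 1
    have : w.right ((w.right ^ m) (w.right⁻¹ i)) = (w.right ^ m) i := by
      rw [← mul_apply, ← mul_apply, ← pow_succ', ← zpow_natCast, ← zpow_natCast,
        ← zpow_sub_one]
      simp
    rw [transport, this]
    simp

theorem mk_cycleProd (w : Wreath Γ n) (q : Cycles w.right) :
    ConjClasses.mk (cycleProd w.left q) = (cycleLabel w q).1 := by
  have hl : label w (w.right⁻¹ q.out) = label w q.out :=
    label_of_sameCycle w ⟨1, by simp⟩
  have hp : minimalPeriod w.right (w.right⁻¹ q.out) = minimalPeriod w.right q.out :=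
    congrArg Prod.snd hl
  rw [cycleProd, prod_eq_transport, cycleLen, ← hp]
  exact congrArg Prod.fst hl

theorem count_wreathType (w : Wreath Γ n) (c : ConjClasses Γ) (m : ℕ) :
    (wreathType w c).count m = Nat.card {q // cycleLabel w q = (c, m)} := by
  rw [wreathType, Multiset.count_map, Nat.card_eq_fintype_card, Fintype.card_subtype,
    ← Finset.filter_val, Finset.filter_filter]
  change Finset.card _ = _
  congr 1
  ext q
  simp only [Finset.mem_filter, Finset.mem_univ, true_and, mk_cycleProd, Prod.ext_iff]
  exact and_congr_right' eq_comm

end Wreath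

/-! ### Elements that conjugate one wreath product element to another -/

section Intertwiners

open Equiv.Perm Function

variable {Γ : Type*} [Group Γ] {n : ℕ} {u v w : Wreath Γ n}

/-- The possible images, in a cycle of `u`, of the base point of a cycle of `w` with its
coefficient, under an element that conjugates `w` to `u`. -/
def Frame (w u : Wreath Γ n) (q : Cycles w.right) (q' : Cycles u.right) : Type _ :=
  {x : Fin n × Γ // cycleOfPoint u.right x.1 = q' ∧
    holonomy u x.1 * x.2 = x.2 * holonomy w q.out}

/-- A power of `w` that fixes `i` is a multiple of the period, so its coefficient is a power of the
holonomy, and `g` intertwines the holonomies. -/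
theorem transport_zpow_mul_of_fixed {i j : Fin n} {g : Γ}
    (hp : minimalPeriod u.right j = minimalPeriod w.right i)
    (hg : holonomy u j * g = g * holonomy w i) {k : ℤ} (hk : (w.right ^ k) i = i) :
    (u.right ^ k) j = j ∧ transport (u ^ k) j * g = g * transport (w ^ k) i := by
  rw [zpow_apply_eq_iff] at hk
  refine ⟨(zpow_apply_eq_iff _ _ _).2 (hp ▸ hk), ?_⟩
  obtain ⟨d, rfl⟩ := hk
  have h1 : transport (w ^ ((minimalPeriod w.right i : ℤ) * d)) i = holonomy w i ^ d := by
    rw [zpow_mul, zpow_natCast, transport_zpow_of_fixed, holonomy]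
    rw [right_pow, pow_minimalPeriod_apply]
  have h2 : transport (u ^ ((minimalPeriod w.right i : ℤ) * d)) j = holonomy u j ^ d := by
    rw [← hp, zpow_mul, zpow_natCast, transport_zpow_of_fixed, holonomy]
    rw [right_pow, pow_minimalPeriod_apply]
  rw [h1, h2]
  have h3 : SemiconjBy g (holonomy w i) (holonomy u j) := hg.symm
  exact (h3.zpow_right d).eq.symm

/-- Well-definedness of the extension from a base point along its cycle: the result does not depend
on the power of `w` used to reach a point. -/
theorem transport_zpow_unique {i j : Fin n} {g : Γ}
    (hp : minimalPeriod u.right j = minimalPeriod w.right i)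
    (hg : holonomy u j * g = g * holonomy w i) {k l : ℤ}
    (hkl : (w.right ^ k) i = (w.right ^ l) i) :
    (u.right ^ k) j = (u.right ^ l) j ∧
      transport (u ^ k) j * g * (transport (w ^ k) i)⁻¹ =
        transport (u ^ l) j * g * (transport (w ^ l) i)⁻¹ := by
  obtain ⟨d, rfl⟩ : ∃ d, k = l + d := ⟨k - l, by ring⟩
  have hd : (w.right ^ d) i = i := by
    rw [zpow_add, mul_apply] at hkl
    exact (w.right ^ l).injective hkl
  obtain ⟨h1, h2⟩ := transport_zpow_mul_of_fixed hp hg hd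
  refine ⟨by rw [zpow_add, mul_apply, h1], ?_⟩
  rw [zpow_add, zpow_add, transport_mul, transport_mul, right_zpow, right_zpow, h1, hd,
    mul_assoc (transport (u ^ l) j), h2]
  group

/-- An intertwiner must send `w ^ k` applied to a base point to `u ^ k` applied to its image. Taking
this as the definition, for a chosen `k` at each point, works by `transport_zpow_unique`. -/
theorem exists_semiconjBy (π : Cycles w.right ≃ Cycles u.right)
    (hπ : ∀ q, cycleLabel u (π q) = cycleLabel w q) (x : ∀ q, Frame w u q (π q)) :
    ∃ v : Wreath Γ n, SemiconjBy v w u ∧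
      ∀ q, v.right q.out = (x q).1.1 ∧ transport v q.out = (x q).1.2 := by
  have hk : ∀ i, ∃ k : ℤ, (w.right ^ k) (cycleOfPoint w.right i).out = i := sameCycle_out w.right
  choose k hk using hk
  have hp : ∀ q, minimalPeriod u.right (x q).1.1 = minimalPeriod w.right q.out := by
    intro q
    have h1 := cycleLabel_cycleOfPoint u (x q).1.1
    rw [(x q).2.1, hπ] at h1
    exact (congrArg Prod.snd h1).symm
  let q := cycleOfPoint w.right
  let τ : Fin n → Fin n := fun i => (u.right ^ k i) (x (q i)).1.1
  have hτq : ∀ i, cycleOfPoint u.right (τ i) = π (q i) := by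
    intro i
    rw [← (x (q i)).2.1]
    exact cycleOfPoint_eq_iff.2 ⟨-k i, by simp [τ]⟩
  -- Different cycles stay apart because `π` is injective, and points of one cycle because the
  -- periods agree.
  have hτ : Injective τ := by
    intro i j hij
    have hq : q i = q j := π.injective <| by rw [← hτq, ← hτq, hij]
    have h1 : (u.right ^ k i) (x (q i)).1.1 = (u.right ^ k j) (x (q i)).1.1 := by
      simp only [τ] at hij
      rw [hij, hq]
    have hi : (w.right ^ k i) (q i).out = i := hk i
    have hj : (w.right ^ k j) (q i).out = j := by rw [hq]; exact hk j
    rw [← hi, ← hj]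
    have h2 : (u.right ^ (k i - k j)) (x (q i)).1.1 = (x (q i)).1.1 := by
      rw [sub_eq_neg_add, zpow_add, mul_apply, h1, ← mul_apply, ← zpow_add]
      simp
    rw [zpow_apply_eq_iff, hp, ← zpow_apply_eq_iff] at h2
    have h3 := congrArg (w.right ^ k j) h2
    rwa [← mul_apply, ← zpow_add, add_sub_cancel] at h3
  let s : Equiv.Perm (Fin n) := Equiv.ofBijective τ (Finite.injective_iff_bijective.1 hτ)
  let t : Fin n → Γ := fun i => transport (u ^ k i) (x (q i)).1.1 * (x (q i)).1.2 *
    (transport (w ^ k i) (q i).out)⁻¹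
  have key : ∀ i (l : ℤ), (w.right ^ l) (q i).out = i → τ i = (u.right ^ l) (x (q i)).1.1 ∧
      t i = transport (u ^ l) (x (q i)).1.1 * (x (q i)).1.2 *
        (transport (w ^ l) (q i).out)⁻¹ := fun i l hl =>
    transport_zpow_unique (hp _) (x (q i)).2.2 ((hk i).trans hl.symm)
  have hqs : ∀ i, q (w.right i) = q i := fun i => cycleOfPoint_eq_iff.2 ⟨-1, by simp⟩
  -- The exponent `1 + k i` also leads to `w.right i`; independence of the exponent then yields the
  -- intertwining relation.
  have hnext : ∀ i, (w.right ^ (1 + k i)) (q (w.right i)).out = w.right i := by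
    intro i
    rw [hqs, zpow_add, mul_apply, hk, zpow_one]
  refine ⟨ofTransport s t, ?_, fun c => ?_⟩
  · refine wreath_ext (fun i => ?_) fun i => ?_
    · change τ (w.right i) = u.right (τ i)
      rw [(key _ _ (hnext i)).1, hqs, zpow_add, mul_apply, zpow_one]
    · rw [transport_mul, transport_mul, transport_ofTransport, transport_ofTransport]
      change t (w.right i) * transport w i = transport u (τ i) * t i
      rw [(key _ _ (hnext i)).2, hqs, zpow_add, zpow_add, transport_mul, transport_mul, zpow_one,
        zpow_one, right_zpow, right_zpow, hk]
      simp only [t, τ]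
      group
  · have hc : q c.out = c := cycleOfPoint_out c
    have := key c.out 0 (by rw [hc]; rfl)
    rw [hc] at this
    rw [transport_ofTransport]
    exact ⟨(by simpa using this.1 : τ (Quotient.out c) = (x c).1.1), by simpa using this.2⟩

theorem semiconjBy_ext {v v' : Wreath Γ n} (h : SemiconjBy v w u) (h' : SemiconjBy v' w u)
    (hr : ∀ q : Cycles w.right, v.right q.out = v'.right q.out)
    (ht : ∀ q : Cycles w.right, transport v q.out = transport v' q.out) : v = v' := by
  have key : ∀ i, v.right i = v'.right i ∧ transport v i = transport v' i := by
    intro i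
    obtain ⟨k, hk⟩ := sameCycle_out w.right i
    have e := h.zpow_right k
    have e' := h'.zpow_right k
    have h1 := right_of_semiconjBy e (cycleOfPoint w.right i).out
    have h1' := right_of_semiconjBy e' (cycleOfPoint w.right i).out
    rw [right_zpow, right_zpow, hk] at h1 h1'
    refine ⟨by rw [h1, h1', hr], ?_⟩
    have h2 := congrArg (transport · (cycleOfPoint w.right i).out) e.eq
    have h2' := congrArg (transport · (cycleOfPoint w.right i).out) e'.eq
    simp only [transport_mul, right_zpow, hk] at h2 h2'
    rw [hr, ht, ← h2'] at h2
    exact mul_right_cancel h2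
  exact wreath_ext (fun i => (key i).1) fun i => (key i).2

/-- The bijection between the cycles of conjugate elements. -/
def cyclesEquiv (h : SemiconjBy v w u) : Cycles w.right ≃ Cycles u.right :=
  Quotient.congr v.right fun i j => by
    refine ⟨fun ⟨k, hk⟩ => ⟨k, ?_⟩, fun ⟨k, hk⟩ => ⟨k, ?_⟩⟩
    all_goals
      have := right_of_semiconjBy (h.zpow_right k) i
      rw [right_zpow, right_zpow] at this
    · rw [← this, hk]
    · exact v.right.injective (by rw [this, hk])

theorem cyclesEquiv_apply (h : SemiconjBy v w u) (q : Cycles w.right) :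
    cyclesEquiv h q = cycleOfPoint u.right (v.right q.out) := by
  conv_lhs => rw [← cycleOfPoint_out q]
  rfl

theorem cycleLabel_cyclesEquiv (h : SemiconjBy v w u) (q : Cycles w.right) :
    cycleLabel u (cyclesEquiv h q) = cycleLabel w q := by
  rw [cyclesEquiv_apply, cycleLabel_cycleOfPoint, label_of_semiconjBy h, cycleLabel]

/-- The elements conjugating `w` to `u` are determined by a bijection of cycles and the images of
base points. -/
def intertwinerFrames (v : {v : Wreath Γ n // SemiconjBy v w u}) :
    Σ π : {π : Cycles w.right ≃ Cycles u.right // ∀ q, cycleLabel u (π q) = cycleLabel w q},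
      ∀ q, Frame w u q (π.1 q) :=
  ⟨⟨cyclesEquiv v.2, cycleLabel_cyclesEquiv v.2⟩, fun q =>
    ⟨(v.1.right q.out, transport v.1 q.out), (cyclesEquiv_apply v.2 q).symm,
      holonomy_of_semiconjBy v.2 _⟩⟩

theorem intertwinerFrames_bijective : Bijective (intertwinerFrames (w := w) (u := u)) := by
  constructor
  · intro v v' h
    have h' : ∀ q, ((intertwinerFrames v).2 q).1 = ((intertwinerFrames v').2 q).1 := by
      rw [h]; exact fun _ => rfl
    exact Subtype.ext (semiconjBy_ext v.2 v'.2 (fun q => congrArg Prod.fst (h' q))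
      fun q => congrArg Prod.snd (h' q))
  · rintro ⟨⟨π, hπ⟩, x⟩
    obtain ⟨v, hv, hvx⟩ := exists_semiconjBy π hπ x
    refine ⟨⟨v, hv⟩, ?_⟩
    obtain rfl : π = cyclesEquiv hv := by
      ext1 q
      rw [cyclesEquiv_apply, (hvx q).1, (x q).2.1]
    refine Sigma.ext rfl (heq_of_eq (funext fun q => Subtype.ext (Prod.ext ?_ ?_)))
    · exact (hvx q).1
    · exact (hvx q).2

end Intertwiners

/-! ### Centralizer orders and class sizes -/

section Counting

open Equiv.Perm Function

theorem card_semiconjBy_of_isConj {G : Type*} [Group G] {a b : G} (h : IsConj b a) :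
    Nat.card {g : G // SemiconjBy g b a} = Nat.card {g : G // SemiconjBy g b b} := by
  obtain ⟨c, rfl⟩ := isConj_iff.1 h
  refine Nat.card_congr ((Equiv.mulLeft c⁻¹).subtypeEquiv fun g => ?_)
  simp only [SemiconjBy, Equiv.coe_mulLeft]
  constructor
  · intro h
    rw [mul_assoc, h]; group
  · intro h
    rw [mul_assoc, inv_mul_eq_iff_eq_mul] at h
    rw [h]; group

/-- Orbit–stabilizer: every fibre of `g ↦ g * b * g⁻¹` onto the class is a coset of the centralizer.
-/
theorem card_carrier_mul_card_semiconjBy {G : Type*} [Group G] [Finite G] (b : G) :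
    Nat.card (ConjClasses.mk b).carrier * Nat.card {g : G // SemiconjBy g b b} = Nat.card G := by
  have : Fintype G := Fintype.ofFinite G
  let f : G → (ConjClasses.mk b).carrier := fun g => ⟨g * b * g⁻¹, by
    rw [ConjClasses.mem_carrier_iff_mk_eq, ConjClasses.mk_eq_mk_iff_isConj]
    exact (isConj_iff.2 ⟨g, rfl⟩ : IsConj b _).symm⟩
  have hf : ∀ a : (ConjClasses.mk b).carrier, Nat.card {g // f g = a} =
      Nat.card {g : G // SemiconjBy g b b} := by
    intro a
    have ha : IsConj b a.1 := by
      have := a.2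
      rw [ConjClasses.mem_carrier_iff_mk_eq, ConjClasses.mk_eq_mk_iff_isConj] at this
      exact this.symm
    rw [← card_semiconjBy_of_isConj ha]
    refine Nat.card_congr (Equiv.subtypeEquivRight fun g => ?_)
    rw [Subtype.ext_iff, SemiconjBy, ← mul_inv_eq_iff_eq_mul]
  rw [← Nat.card_congr (Equiv.sigmaFiberEquiv f), Nat.card_sigma]
  rw [Finset.sum_congr rfl fun a _ => hf a, Finset.sum_const, Finset.card_univ, smul_eq_mul,
    Nat.card_eq_fintype_card (α := (ConjClasses.mk b).carrier)]

theorem zeta_mk {Γ : Type*} [Group Γ] [Fintype Γ] (x : Γ) :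
    zeta (ConjClasses.mk x) = Nat.card {g : Γ // SemiconjBy g x x} := by
  have : Nonempty (ConjClasses.mk x).carrier := ⟨⟨x, ConjClasses.mem_carrier_mk⟩⟩
  rw [zeta, ← card_carrier_mul_card_semiconjBy x, Nat.cast_mul, mul_div_cancel_left₀]
  exact Nat.cast_ne_zero.2 Nat.card_pos.ne'

theorem card_cycle {n : ℕ} {s : Equiv.Perm (Fin n)} (q : Cycles s) :
    Fintype.card {i // cycleOfPoint s i = q} = cycleLen q := by
  have h := MulAction.minimalPeriod_eq_card (a := s) (b := q.out)
  change cycleLen q = _ at h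
  rw [h]
  refine Fintype.card_congr (Equiv.subtypeEquivRight fun i => ?_)
  rw [← cycleOfPoint_out q, eq_comm, cycleOfPoint_eq_iff, cycleOfPoint_out]
  constructor
  · rintro ⟨k, hk⟩
    exact ⟨⟨s ^ k, k, rfl⟩, hk⟩
  · rintro ⟨⟨_, k, rfl⟩, hk⟩
    exact ⟨k, hk⟩

variable {Γ : Type*} [Group Γ] [Fintype Γ] {n : ℕ} {u w : Wreath Γ n}

/-- The image point ranges over a cycle of the common length, and for each point the coefficients
form a coset of the centralizer of the holonomy, of order `zeta`. -/
theorem card_frame {q : Cycles w.right} {q' : Cycles u.right}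
    (h : cycleLabel u q' = cycleLabel w q) :
    (Nat.card (Frame w u q q') : ℂ) = cycleLen q * zeta (ConjClasses.mk (cycleProd w.left q)) := by
  let e : Frame w u q q' ≃ Σ i : {i // cycleOfPoint u.right i = q'},
      {g : Γ // SemiconjBy g (holonomy w q.out) (holonomy u i.1)} :=
    { toFun := fun x => ⟨⟨x.1.1, x.2.1⟩, ⟨x.1.2, x.2.2.symm⟩⟩
      invFun := fun y => ⟨(y.1.1, y.2.1), y.1.2, y.2.2.symm⟩
      left_inv := fun _ => rfl
      right_inv := fun _ => rfl }
  have hc : ∀ i : {i // cycleOfPoint u.right i = q'},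
      Nat.card {g : Γ // SemiconjBy g (holonomy w q.out) (holonomy u i.1)} =
        Nat.card {g : Γ // SemiconjBy g (holonomy w q.out) (holonomy w q.out)} := by
    rintro ⟨i, rfl⟩
    refine card_semiconjBy_of_isConj ?_
    rw [cycleLabel_cycleOfPoint] at h
    exact ConjClasses.mk_eq_mk_iff_isConj.1 (congrArg Prod.fst h).symm
  have hlen : cycleLen q' = cycleLen q := congrArg Prod.snd h
  have hz : ConjClasses.mk (cycleProd w.left q) = ConjClasses.mk (holonomy w q.out) :=
    mk_cycleProd w q
  rw [Nat.card_congr e, Nat.card_sigma, Finset.sum_congr rfl fun i _ => hc i, Finset.sum_const,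
    Finset.card_univ, card_cycle, hlen, hz, zeta_mk, smul_eq_mul, Nat.cast_mul]

instance : Finite (Wreath Γ n) := Finite.of_equiv _ SemidirectProduct.equivProd.symm

instance frame_finite (q : Cycles w.right) (q' : Cycles u.right) : Finite (Frame w u q q') :=
  Subtype.finite

/-- By `intertwinerFrames_bijective` an intertwiner is a label-preserving bijection of cycles with
an independent choice of frame on each cycle; the number of frames does not depend on the bijection.
-/
theorem card_semiconjBy_wreath : (Nat.card {v : Wreath Γ n // SemiconjBy v w u} : ℂ) =
    Nat.card {π : Cycles w.right ≃ Cycles u.right // ∀ q, cycleLabel u (π q) = cycleLabel w q} *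
      ∏ q : Cycles w.right, (cycleLen q * zeta (ConjClasses.mk (cycleProd w.left q))) := by
  rw [Nat.card_congr (Equiv.ofBijective _ intertwinerFrames_bijective), Nat.card_sigma,
    Nat.cast_sum]
  have : ∀ π : {π : Cycles w.right ≃ Cycles u.right // ∀ q, cycleLabel u (π q) = cycleLabel w q},
      (Nat.card (∀ q, Frame w u q (π.1 q)) : ℂ) =
        ∏ q : Cycles w.right, (cycleLen q * zeta (ConjClasses.mk (cycleProd w.left q))) := by
    intro π
    rw [Nat.card_pi, Nat.cast_prod]
    exact Finset.prod_congr rfl fun q _ => card_frame (π.2 q)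
  rw [Finset.sum_congr rfl fun π _ => this π, Finset.sum_const, Finset.card_univ, nsmul_eq_mul,
    Nat.card_eq_fintype_card]

theorem prod_wreathType {M : Type*} [CommMonoid M] (w : Wreath Γ n) (c : ConjClasses Γ)
    (f : ℕ → M) : ((wreathType w c).map f).prod =
      ∏ q : Cycles w.right with ConjClasses.mk (cycleProd w.left q) = c, f (cycleLen q) := by
  rw [wreathType, Multiset.map_map]
  congr

/-- The element `w` has type `ρ`. -/
def HasType (w : Wreath Γ n) (ρ : ConjClasses Γ → Multiset OddNat) : Prop :=
  ∀ c, wreathType w c = (ρ c).map Subtype.val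

namespace HasType

variable {ρ : ConjClasses Γ → Multiset OddNat}

omit [Fintype Γ] in
theorem card_fiber (h : HasType w ρ) (c : ConjClasses Γ) (m : ℕ) :
    Nat.card {q // cycleLabel w q = (c, m)} = ((ρ c).map Subtype.val).count m := by
  rw [← h c, count_wreathType]

theorem prod_cycles (h : HasType w ρ) {M : Type*} [CommMonoid M]
    (F : ConjClasses Γ → ℕ → M) :
    ∏ q : Cycles w.right, F (ConjClasses.mk (cycleProd w.left q)) (cycleLen q) =
      ∏ c, ((ρ c).map fun m => F c m.1).prod := by
  have h1 := Finset.prod_fiberwise (s := Finset.univ)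
    (g := fun q : Cycles w.right => ConjClasses.mk (cycleProd w.left q)) (f := fun q => F
      (ConjClasses.mk (cycleProd w.left q)) (cycleLen q))
  refine h1.symm.trans (Finset.prod_congr rfl fun c _ => ?_)
  have h2 : ((ρ c).map fun m => F c m.1) = (((ρ c).map Subtype.val).map (F c)) := by
    rw [Multiset.map_map]; rfl
  rw [h2, ← h c, prod_wreathType]
  refine Finset.prod_congr ?_ fun q hq => ?_
  · ext q; simp
  · rw [(Finset.mem_filter.1 hq).2]

omit [Fintype Γ] in
theorem exists_equiv (hw : HasType w ρ) (hu : HasType u ρ) :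
    ∃ π : Cycles w.right ≃ Cycles u.right, ∀ q, cycleLabel u (π q) = cycleLabel w q := by
  have e : ∀ l, {q // cycleLabel w q = l} ≃ {q // cycleLabel u q = l} := fun l =>
    (Finite.card_eq.1 (by rw [hw.card_fiber l.1 l.2, hu.card_fiber l.1 l.2])).some
  refine ⟨(Equiv.sigmaFiberEquiv (cycleLabel w)).symm.trans
    ((Equiv.sigmaCongrRight e).trans (Equiv.sigmaFiberEquiv (cycleLabel u))), fun q => ?_⟩
  exact (e (cycleLabel w q) ⟨q, rfl⟩).2

/-- Equal types give a label-preserving bijection of cycles, so the count of intertwiners is nonzero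
and one exists. -/
theorem isConj (hw : HasType w ρ) (hu : HasType u ρ) : IsConj w u := by
  obtain ⟨π, hπ⟩ := hw.exists_equiv hu
  have hne : (Nat.card {v : Wreath Γ n // SemiconjBy v w u} : ℂ) ≠ 0 := by
    rw [card_semiconjBy_wreath]
    refine mul_ne_zero (Nat.cast_ne_zero.2 ?_) (Finset.prod_ne_zero_iff.2 fun q _ =>
      mul_ne_zero (Nat.cast_ne_zero.2 (minimalPeriod_pos _ _).ne') (zeta_ne_zero _))
    have : Nonempty {π : Cycles w.right ≃ Cycles u.right //
      ∀ q, cycleLabel u (π q) = cycleLabel w q} := ⟨⟨π, hπ⟩⟩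
    exact Nat.card_pos.ne'
  obtain ⟨⟨v, hv⟩⟩ := (Nat.card_ne_zero.1 (Nat.cast_ne_zero.1 hne)).1
  exact ⟨toUnits v, hv⟩

omit [Fintype Γ] in
theorem of_isConj (hw : HasType w ρ) (h : IsConj w u) : HasType u ρ := by
  obtain ⟨v, hv⟩ := h
  intro c
  rw [← hw c]
  ext m
  rw [count_wreathType, count_wreathType]
  exact (Nat.card_congr ((cyclesEquiv hv).subtypeEquiv fun q => by
    rw [cycleLabel_cyclesEquiv])).symm

/-- A permutation preserving the labels permutes each fibre of `cycleLabel` separately, and the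
fibre over `(c, m)` has as many elements as `m` has occurrences in `ρ c`. -/
theorem card_label_perm (h : HasType w ρ) :
    Nat.card {π : Cycles w.right ≃ Cycles w.right // ∀ q, cycleLabel w (π q) = cycleLabel w q} =
      ∏ c, ∏ m ∈ (ρ c).toFinset, ((ρ c).count m).factorial := by
  have h1 := DomMulAct.stabilizer_card' (cycleLabel w)
  have h2 : Finset.univ.image (cycleLabel w) =
      (Finset.univ.sigma fun c => (ρ c).toFinset).image fun x => (x.1, x.2.1) := by
    ext ⟨c, m⟩
    have h3 : (∃ q, cycleLabel w q = (c, m)) ↔ m ∈ (ρ c).map Subtype.val := by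
      rw [← Multiset.count_ne_zero, ← h.card_fiber, Nat.card_ne_zero]
      simp [Subtype.finite]
    simp only [Finset.mem_image, Finset.mem_univ, true_and, h3, Finset.mem_sigma,
      Multiset.mem_toFinset, Multiset.mem_map]
    constructor
    · rintro ⟨m, hm, rfl⟩
      exact ⟨⟨c, m⟩, hm, rfl⟩
    · rintro ⟨⟨c, m⟩, hm, h⟩
      cases h
      exact ⟨m, hm, rfl⟩
  rw [h2, Finset.prod_image, Finset.prod_sigma] at h1
  · have h3 : ∀ c (m : OddNat), Nat.card {q // cycleLabel w q = (c, m.1)} = (ρ c).count m :=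
      fun c m => by
        rw [h.card_fiber, Multiset.count_map_eq_count' _ _ Subtype.val_injective]
    simp only [← Nat.card_eq_fintype_card, h3] at h1
    rw [← h1]
    exact Nat.card_congr (Equiv.subtypeEquivRight fun π => funext_iff.symm)
  · rintro ⟨c, m⟩ - ⟨c', m'⟩ - h
    simp only [Prod.mk.injEq] at h
    obtain ⟨rfl, h⟩ := h
    rw [Subtype.ext h]

end HasType

/-- Label-preserving permutations of the cycles give the factorials of `bigZ`; the frames give the
powers of the parts and of `zeta`. -/
theorem HasType.card_centralizer {ρ : OddPart (ConjClasses Γ) n} (h : HasType w ρ.1) :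
    (Nat.card {v : Wreath Γ n // SemiconjBy v w w} : ℂ) = bigZ ρ := by
  rw [card_semiconjBy_wreath, h.card_label_perm, h.prod_cycles fun c m => (m : ℂ) * zeta c, bigZ,
    Nat.cast_prod, ← Finset.prod_mul_distrib]
  refine Finset.prod_congr rfl fun c _ => ?_
  rw [Multiset.prod_map_mul, Multiset.map_const', Multiset.prod_replicate, ← mul_assoc,
    Finset.prod_mul_distrib, Finset.prod_multiset_map_count, Nat.cast_prod]

theorem bigZ_ne_zero (ρ : OddPart (ConjClasses Γ) n) : bigZ ρ ≠ 0 :=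
  Finset.prod_ne_zero_iff.2 fun c _ => mul_ne_zero
    (Finset.prod_ne_zero_iff.2 fun i _ => mul_ne_zero (Nat.cast_ne_zero.2 (Nat.factorial_ne_zero _))
      (pow_ne_zero _ (Nat.cast_ne_zero.2 i.2.pos.ne'))) (pow_ne_zero _ (zeta_ne_zero c))

theorem HasType.card_hasType {ρ : OddPart (ConjClasses Γ) n} (h : HasType w ρ.1) :
    (Nat.card {u : Wreath Γ n // HasType u ρ.1} : ℂ) = (bigZ ρ)⁻¹ * Nat.card (Wreath Γ n) := by
  rw [← card_carrier_mul_card_semiconjBy w, Nat.cast_mul, h.card_centralizer, mul_comm,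
    mul_assoc, mul_inv_cancel₀ (bigZ_ne_zero ρ), mul_one]
  congr 1
  refine Nat.card_congr (Equiv.subtypeEquivRight fun u => ?_)
  rw [ConjClasses.mem_carrier_iff_mk_eq, ConjClasses.mk_eq_mk_iff_isConj]
  exact ⟨fun hu => hu.isConj h, fun hu => h.of_isConj hu.symm⟩

end Counting

/-! ### Types of inverses, existence of types, averages over the wreath product -/

section Types

open Equiv.Perm Function

variable {Γ : Type*} [Group Γ] {n : ℕ} {w : Wreath Γ n}

theorem minimalPeriod_inv (s : Equiv.Perm (Fin n)) (i : Fin n) :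
    minimalPeriod (s⁻¹ : Equiv.Perm (Fin n)) i = minimalPeriod s i := by
  rw [minimalPeriod_eq_minimalPeriod_iff]
  intro k
  rw [IsPeriodicPt, IsPeriodicPt, IsFixedPt, IsFixedPt, iterate_eq_pow, iterate_eq_pow, inv_pow,
    inv_eq_iff_eq, eq_comm]

theorem label_inv (w : Wreath Γ n) (i : Fin n) :
    label w⁻¹ i = (classInv (label w i).1, (label w i).2) := by
  have h : minimalPeriod w⁻¹.right i = minimalPeriod w.right i := minimalPeriod_inv w.right i
  have h2 : holonomy w⁻¹ i = (holonomy w i)⁻¹ := by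
    have h3 : (w ^ minimalPeriod w.right i).right i = i := by
      rw [right_pow, pow_minimalPeriod_apply]
    have := transport_inv (w ^ minimalPeriod w.right i) i
    rw [h3] at this
    rw [holonomy, h, holonomy, ← this, inv_pow]
  rw [label, label, h, h2]
  rfl

/-- The cycles of `s⁻¹` are those of `s`. -/
def cyclesInv (w : Wreath Γ n) : Cycles w.right ≃ Cycles w⁻¹.right :=
  Quotient.congr (Equiv.refl _) fun i j => (sameCycle_inv (f := w.right) (x := i) (y := j)).symm

theorem cycleLabel_cyclesInv (w : Wreath Γ n) (q : Cycles w.right) :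
    cycleLabel w⁻¹ (cyclesInv w q) = (classInv (cycleLabel w q).1, (cycleLabel w q).2) := by
  have : cyclesInv w q = cycleOfPoint w⁻¹.right q.out := by
    conv_lhs => rw [← cycleOfPoint_out q]
    rfl
  rw [this, cycleLabel_cycleOfPoint, label_inv, cycleLabel]

theorem HasType.inv {ρ : ConjClasses Γ → Multiset OddNat} (h : HasType w ρ) :
    HasType w⁻¹ fun c => ρ (classInv c) := by
  intro c
  rw [← h (classInv c)]
  ext m
  rw [count_wreathType, count_wreathType]
  refine (Nat.card_congr ((cyclesInv w).subtypeEquiv fun q => ?_)).symm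
  rw [cycleLabel_cyclesInv, Prod.ext_iff, Prod.ext_iff]
  refine and_congr_left' ?_
  change (cycleLabel w q).1 = classInv c ↔ classInv (cycleLabel w q).1 = c
  exact ⟨fun h => by rw [h, classInv_classInv], fun h => by rw [← h, classInv_classInv]⟩

theorem odd_minimalPeriod_of_hasType {ρ : ConjClasses Γ → Multiset OddNat} (h : HasType w ρ)
    (i : Fin n) : Odd (minimalPeriod w.right i) := by
  have h1 := cycleLabel_cycleOfPoint w i
  have h2 : minimalPeriod w.right i ∈ wreathType w (label w i).1 := by
    rw [← Multiset.count_ne_zero, count_wreathType, Nat.card_ne_zero]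
    exact ⟨⟨⟨_, h1⟩⟩, Subtype.finite⟩
  rw [h] at h2
  obtain ⟨m, -, hm⟩ := Multiset.mem_map.1 h2
  exact hm ▸ m.2

theorem sum_cycleLen (s : Equiv.Perm (Fin n)) : ∑ q : Cycles s, cycleLen q = n := by
  rw [← Finset.sum_congr rfl fun q _ => card_cycle q, ← Fintype.card_sigma,
    Fintype.card_congr (Equiv.sigmaFiberEquiv (cycleOfPoint s)), Fintype.card_fin]

variable [Fintype Γ]

theorem exists_hasType_of_odd (h : ∀ i, Odd (minimalPeriod w.right i)) :
    ∃ ρ : OddPart (ConjClasses Γ) n, HasType w ρ.1 := by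
  have h1 : ∀ c, ∃ r : Multiset OddNat, wreathType w c = r.map Subtype.val := by
    intro c
    have : ∀ m ∈ wreathType w c, Odd m := by
      intro m hm
      obtain ⟨q, -, rfl⟩ := Multiset.mem_map.1 hm
      exact h _
    lift wreathType w c to Multiset OddNat using this with r
    exact ⟨r, rfl⟩
  choose ρ hρ using h1
  have hw : HasType w ρ := hρ
  refine ⟨⟨ρ, ?_⟩, hw⟩
  have h2 := hw.prod_cycles (M := Multiplicative ℕ) fun _ m => Multiplicative.ofAdd m
  rw [← sum_cycleLen w.right]
  exact h2.symm

omit [Fintype Γ] in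
theorem hasType_of_equiv {ρ : ConjClasses Γ → Multiset OddNat}
    (e : (Σ c, (ρ c).ToType) ≃ Cycles w.right)
    (h : ∀ q, cycleLabel w (e q) = (q.1, q.2.1.1)) : HasType w ρ := by
  intro c
  ext m
  rw [count_wreathType]
  conv_rhs => rw [← Multiset.map_univ_coe (ρ c)]
  rw [Multiset.map_map, Multiset.count_map, ← Finset.filter_val]
  change _ = Finset.card _
  rw [← Fintype.card_subtype, ← Nat.card_eq_fintype_card]
  let e' : {x : (ρ c).ToType // m = x.1.1} ≃ {q // cycleLabel w q = (c, m)} :=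
    Equiv.ofBijective (fun x => ⟨e ⟨c, x.1⟩, by rw [h]; exact Prod.ext rfl x.2.symm⟩) <| by
      constructor
      · intro x y hxy
        have := e.injective (congrArg Subtype.val hxy)
        exact Subtype.ext (eq_of_heq (Sigma.mk.inj this).2)
      · rintro ⟨q, hq⟩
        obtain ⟨⟨c', x⟩, rfl⟩ := e.surjective q
        rw [h, Prod.mk.injEq] at hq
        obtain ⟨rfl, hm⟩ := hq
        exact ⟨⟨x, hm.symm⟩, rfl⟩
  exact (Nat.card_congr e').symm

-- The model is translation by `1` on the disjoint union of the `ZMod (ℓ q)`, with coefficient `x q`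
-- at the point `0` of each cycle and `1` elsewhere.
omit [Fintype Γ] in
theorem exists_hasType_of_card {Q : Type*} [Fintype Q] (ℓ : Q → ℕ) [∀ q, NeZero (ℓ q)]
    (x : Q → Γ) (hn : ∑ q, ℓ q = n) :
    ∃ (w : Wreath Γ n) (e : Q ≃ Cycles w.right),
      ∀ q, cycleLabel w (e q) = (ConjClasses.mk (x q), ℓ q) := by
  let M := Σ q, ZMod (ℓ q)
  let e : M ≃ Fin n := Fintype.equivFinOfCardEq (by simp [M, hn])
  let r : Equiv.Perm M := Equiv.sigmaCongrRight fun q => Equiv.addRight (1 : ZMod (ℓ q))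
  have hr : ∀ (k : ℕ) q a, (r ^ k) ⟨q, a⟩ = ⟨q, a + k⟩ := by
    intro k q a
    induction k with
    | zero => simp
    | succ k ih =>
      rw [pow_succ', mul_apply, ih]
      change (⟨q, a + k + 1⟩ : M) = _
      rw [Nat.cast_succ, add_assoc]
  let s : Equiv.Perm (Fin n) := e.permCongr r
  have hs : ∀ (k : ℕ) q a, (s ^ k) (e ⟨q, a⟩) = e ⟨q, a + k⟩ := by
    intro k q a
    have : s ^ k = e.permCongr (r ^ k) := (map_pow e.permCongrHom r k).symm
    rw [this, Equiv.permCongr_apply, Equiv.symm_apply_apply, hr]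
  let t : M → Γ := fun p => if p.2 = 0 then x p.1 else 1
  let w : Wreath Γ n := ofTransport s (t ∘ e.symm)
  have ht : ∀ p, transport w (e p) = t p := by
    intro p
    simp [w]
  have hwr : w.right = s := rfl
  have hper : ∀ q a, minimalPeriod s (e ⟨q, a⟩) = ℓ q := by
    intro q a
    refine Nat.dvd_right_iff_eq.1 fun k => ?_
    rw [← isPeriodicPt_iff_minimalPeriod_dvd, IsPeriodicPt, IsFixedPt, iterate_eq_pow, hs,
      ← ZMod.natCast_eq_zero_iff, e.injective.eq_iff]
    refine ⟨fun h => ?_, fun h => by rw [h, add_zero]⟩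
    simpa using eq_of_heq (Sigma.mk.inj h).2
  -- Within one turn starting at `0`, the nontrivial coefficient is met only in the first step.
  have hhol : ∀ q (k : ℕ), k < ℓ q → transport (w ^ (k + 1)) (e ⟨q, 0⟩) = x q := by
    intro q k hk
    induction k with
    | zero => simp [ht, t]
    | succ k ih =>
      rw [pow_succ', transport_mul, ih (Nat.lt_of_succ_lt hk), right_pow, hwr, hs, ht]
      have : ¬ ((k + 1 : ℕ) : ZMod (ℓ q)) = 0 := by
        rw [ZMod.natCast_eq_zero_iff]
        exact Nat.not_dvd_of_pos_of_lt k.succ_pos hk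
      simp only [t, zero_add, this, if_false, one_mul]
  have hlabel : ∀ q, label w (e ⟨q, 0⟩) = (ConjClasses.mk (x q), ℓ q) := by
    intro q
    have hpos := NeZero.pos (ℓ q)
    have := hhol q (ℓ q - 1) (by omega)
    rw [Nat.sub_add_cancel hpos] at this
    rw [label, holonomy, hwr, hper, this]
  refine ⟨w, Equiv.ofBijective (fun q => cycleOfPoint w.right (e ⟨q, 0⟩)) ⟨?_, ?_⟩, fun q => ?_⟩
  · intro q q' h
    obtain ⟨k, hk⟩ := (cycleOfPoint_eq_iff.1 h).exists_pow_eq'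
    rw [hwr, hs] at hk
    exact congrArg Sigma.fst (e.injective hk.2)
  · intro c
    obtain ⟨⟨q, a⟩, hp⟩ := e.surjective c.out
    refine ⟨q, ?_⟩
    rw [← cycleOfPoint_out c, ← hp]
    refine cycleOfPoint_eq_iff.2 ⟨(ZMod.val a : ℤ), ?_⟩
    rw [zpow_natCast, hwr, hs]
    simp
  · exact (cycleLabel_cycleOfPoint w _).trans (hlabel q)

theorem exists_hasType (ρ : OddPart (ConjClasses Γ) n) : ∃ w : Wreath Γ n, HasType w ρ.1 := by
  have : ∀ q : Σ c, (ρ.1 c).ToType, NeZero q.2.1.1 := fun q => ⟨q.2.1.2.pos.ne'⟩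
  obtain ⟨w, e, he⟩ := exists_hasType_of_card (Γ := Γ) (n := n)
    (fun q : Σ c, (ρ.1 c).ToType => q.2.1.1) (fun q => Quotient.out q.1) (by
      rw [Fintype.sum_sigma]
      refine Eq.trans ?_ ρ.2
      refine Finset.sum_congr rfl fun c _ => ?_
      conv_rhs => rw [← Multiset.map_univ_coe (ρ.1 c), Multiset.map_map]
      rfl)
  refine ⟨w, hasType_of_equiv e fun q => ?_⟩
  rw [he, mk_out]

theorem HasType.unique {ρ σ : OddPart (ConjClasses Γ) n} (h : HasType w ρ.1)
    (h' : HasType w σ.1) : ρ = σ :=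
  Subtype.ext <| funext fun c => Multiset.map_injective Subtype.val_injective <|
    (h c).symm.trans (h' c)

/-- Elements with an even cycle drop out by `h0`. Every other element has a unique odd type, and
type `ρ` accounts for the fraction `(bigZ ρ)⁻¹` of the group. -/
theorem sum_wreath [Fintype (Wreath Γ n)] (F : Wreath Γ n → ℂ) (f : OddPart (ConjClasses Γ) n → ℂ)
    (hF : ∀ w ρ, HasType w ρ.1 → F w = f ρ)
    (h0 : ∀ w, (∃ i, ¬ Odd (minimalPeriod w.right i)) → F w = 0) :
    (Fintype.card (Wreath Γ n) : ℂ)⁻¹ * ∑ w, F w = ∑ ρ, (bigZ ρ)⁻¹ * f ρ := by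
  have h1 : ∀ w : Wreath Γ n,
      F w = ∑ ρ : OddPart (ConjClasses Γ) n, if HasType w ρ.1 then f ρ else 0 := by
    intro w
    by_cases h : ∃ i, ¬ Odd (minimalPeriod w.right i)
    · rw [h0 w h, Finset.sum_eq_zero]
      intro ρ _
      obtain ⟨i, hi⟩ := h
      rw [if_neg fun hρ => hi (odd_minimalPeriod_of_hasType hρ i)]
    · push Not at h
      obtain ⟨ρ, hρ⟩ := exists_hasType_of_odd h
      rw [Finset.sum_eq_single ρ, if_pos hρ, hF w ρ hρ]
      · intro σ _ hσ
        rw [if_neg fun h' => hσ (h'.unique hρ)]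
      · simp
  rw [Finset.sum_congr rfl fun w _ => h1 w, Finset.sum_comm, Finset.mul_sum]
  refine Finset.sum_congr rfl fun ρ _ => ?_
  obtain ⟨w, hw⟩ := exists_hasType ρ
  have h2 := hw.card_hasType
  rw [Nat.card_eq_fintype_card, Nat.card_eq_fintype_card, Fintype.card_subtype] at h2
  rw [← Finset.sum_filter, Finset.sum_const, nsmul_eq_mul, h2]
  have : (Fintype.card (Wreath Γ n) : ℂ) ≠ 0 := Nat.cast_ne_zero.2 Fintype.card_ne_zero
  field_simp

theorem HasType.prod_half {ξ : Γ → ℂ} (hclass : ∀ x y, ξ (y * x * y⁻¹) = ξ x)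
    {ρ : ConjClasses Γ → Multiset OddNat} (h : HasType w ρ) :
    eta ξ w * (2⁻¹ : ℂ) ^ Fintype.card (Cycles w.right) = lengthWeight ξ ρ := by
  have h1 := h.prod_cycles fun c _ => ξ (Quotient.out c) / 2
  have h2 : ∀ q : Cycles w.right, ξ (Quotient.out (ConjClasses.mk (cycleProd w.left q))) / 2 =
      ξ (cycleProd w.left q) * 2⁻¹ := fun q => by
    rw [conj_invariant_of_isConj hclass (isConj_out _), div_eq_mul_inv]
  rw [Finset.prod_congr rfl fun q _ => h2 q, Finset.prod_mul_distrib, Finset.prod_const,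
    Finset.card_univ] at h1
  rw [eta, h1, lengthWeight]
  simp [Multiset.map_const', Multiset.prod_replicate]

end Types

/-! ### Signs in `Π_n` -/

namespace PiGroup

open Function

variable {n : ℕ}

/-- The central element `z ^ e`. -/
def zPow (e : ZMod 2) : PiGroup n := ⟨e, 0⟩

@[simp] theorem zPow_mul_sgn (e : ZMod 2) (x : PiGroup n) : (zPow e * x).sgn = e + x.sgn := by
  simp [zPow, cocycle]

@[simp] theorem zPow_mul_vec (e : ZMod 2) (x : PiGroup n) : (zPow e * x).vec = x.vec := by
  simp [zPow]

theorem zPow_mul_comm (e : ZMod 2) (x : PiGroup n) : zPow e * x = x * zPow e := by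
  ext1
  · simp [zPow, cocycle, add_comm]
  · simp [zPow]

theorem zPow_add (e e' : ZMod 2) : (zPow (e + e') : PiGroup n) = zPow e * zPow e' := by
  ext1
  · rw [zPow_mul_sgn]; rfl
  · rw [zPow_mul_vec]; rfl

theorem zPow_zero : (zPow 0 : PiGroup n) = 1 := rfl

theorem zPow_inv (e : ZMod 2) : (zPow e : PiGroup n)⁻¹ = zPow e := by
  rw [inv_eq_iff_mul_eq_one, ← zPow_add, CharTwo.add_self_eq_zero, zPow_zero]

theorem zPow_mul_left_injective {e e' : ZMod 2} {x : PiGroup n} (h : zPow e * x = zPow e' * x) :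
    e = e' :=
  congrArg sgn (mul_right_cancel h)

theorem exists_eq_zPow_mul {x y : PiGroup n} (h : x.vec = y.vec) : ∃ e, x = zPow e * y :=
  ⟨x.sgn - y.sgn, PiGroup.ext (by rw [zPow_mul_sgn, sub_add_cancel]) (by rw [zPow_mul_vec, h])⟩

theorem perm_vec (s : Equiv.Perm (Fin n)) (x : PiGroup n) : (perm n s x).vec = x.vec ∘ s.symm := rfl

theorem perm_zPow_mul (s : Equiv.Perm (Fin n)) (e : ZMod 2) (x : PiGroup n) :
    perm n s (zPow e * x) = zPow e * perm n s x := by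
  have : perm n s (zPow e) = zPow e := by
    ext1
    · change e + inversions s 0 = e
      simp [inversions]
    · rfl
  rw [map_mul, this]

/-- The conditions `j ≤ i` and `i ≤ j` together cover all pairs once and the diagonal twice. Hence
$a_I$ and $a_J$ commute up to $z$ to the power $|I||J|+|I\cap J|$. -/
theorem cocycle_add_swap (u v : Fin n → ZMod 2) :
    cocycle u v + cocycle v u = (∑ i, u i) * (∑ i, v i) + ∑ i, u i * v i := by
  have h1 : cocycle v u = ∑ i, ∑ j, if i ≤ j then u i * v j else 0 := by
    rw [cocycle, Finset.sum_comm]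
    exact Finset.sum_congr rfl fun i _ => Finset.sum_congr rfl fun j _ =>
      if_congr Iff.rfl (mul_comm _ _) rfl
  have h2 : ∑ i, u i * v i = ∑ i, ∑ j, if i = j then u i * v j else 0 := by simp
  rw [h1, h2, cocycle, Finset.sum_mul_sum]
  simp only [← Finset.sum_add_distrib]
  refine Finset.sum_congr rfl fun i _ => Finset.sum_congr rfl fun j _ => ?_
  rcases lt_trichotomy i j with h | h | h
  · simp [h.le, h.ne, not_le.2 h]
  · simp [h]
  · simp [h.le, h.ne', not_le.2 h]

theorem mul_eq_zPow_mul (x y : PiGroup n) : x * y =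
    zPow ((∑ i, x.vec i) * (∑ i, y.vec i) + ∑ i, x.vec i * y.vec i) * (y * x) := by
  ext1
  · rw [zPow_mul_sgn, ← cocycle_add_swap, mul_sgn, mul_sgn]
    have h2 : (2 : ZMod 2) = 0 := rfl
    linear_combination (-cocycle y.vec x.vec) * h2
  · rw [zPow_mul_vec, mul_vec, mul_vec, add_comm]

/-- Lets a permutation be replaced by one of its cycles when it acts on an element supported there.
-/
theorem perm_congr {s t : Equiv.Perm (Fin n)} {x : PiGroup n}
    (h : ∀ i, x.vec i ≠ 0 → s i = t i) : perm n s x = perm n t x := by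
  ext1
  · change x.sgn + inversions s x.vec = x.sgn + inversions t x.vec
    congr 1
    refine Finset.sum_congr rfl fun i _ => Finset.sum_congr rfl fun j _ => ?_
    by_cases hi : x.vec i = 0
    · simp [hi]
    by_cases hj : x.vec j = 0
    · simp [hj]
    rw [h i hi, h j hj]
  · funext i
    rw [perm_vec, perm_vec, comp_apply, comp_apply]
    by_cases h1 : x.vec (s.symm i) = 0
    · by_cases h2 : x.vec (t.symm i) = 0
      · rw [h1, h2]
      · have := h _ h2
        rw [Equiv.apply_symm_apply, ← Equiv.eq_symm_apply] at this
        rw [this]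
    · have := h _ h1
      rw [Equiv.apply_symm_apply, eq_comm, ← Equiv.eq_symm_apply] at this
      rw [this]

/-- Applying `s` to `x` an odd number `N` of times multiplies it by `zPow (N * e)`, which is `zPow
e`, yet `s ^ N = 1`. -/
theorem eq_zero_of_perm_eq {s : Equiv.Perm (Fin n)} {N : ℕ} (hN : Odd N) (hs : s ^ N = 1)
    {e : ZMod 2} {x : PiGroup n} (h : perm n s x = zPow e * x) : e = 0 := by
  have key : ∀ k : ℕ, perm n (s ^ k) x = zPow (k * e) * x := by
    intro k
    induction k with
    | zero => simp [zPow_zero]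
    | succ k ih =>
      rw [pow_succ', map_mul, MulAut.mul_apply, ih, perm_zPow_mul, h, ← mul_assoc, ← zPow_add,
        Nat.cast_succ, add_mul, one_mul]
  have h1 := key N
  rw [hs, map_one, MulAut.one_apply, ZMod.natCast_eq_one_iff_odd.2 hN, one_mul] at h1
  refine (zPow_mul_left_injective (x := x) (e := 0) ?_).symm
  rw [← h1, zPow_zero, one_mul]

/-- The product `a_j a_{s(j)} ⋯ a_{s^{N-1}(j)}`. -/
def orbitProd (s : Equiv.Perm (Fin n)) (j : Fin n) (N : ℕ) : PiGroup n :=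
  ((List.range N).map fun i => gen ((s ^ i) j)).prod

theorem orbitProd_vec (s : Equiv.Perm (Fin n)) (j : Fin n) (N : ℕ) (i : Fin n) :
    (orbitProd s j N).vec i = ∑ k ∈ Finset.range N, if (s ^ k) j = i then 1 else 0 := by
  induction N with
  | zero => rfl
  | succ N ih =>
    have : (orbitProd s j (N + 1)) = orbitProd s j N * gen ((s ^ N) j) := List.prod_range_succ _ _
    rw [this, mul_vec, Pi.add_apply, ih, Finset.sum_range_succ]
    simp only [gen, Pi.single_apply, eq_comm]

theorem sum_orbitProd_vec_mul (s : Equiv.Perm (Fin n)) (j : Fin n) (N : ℕ) (v : Fin n → ZMod 2) :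
    ∑ i, (orbitProd s j N).vec i * v i = ∑ k ∈ Finset.range N, v ((s ^ k) j) := by
  simp only [orbitProd_vec, Finset.sum_mul]
  rw [Finset.sum_comm]
  simp

theorem sum_orbitProd_vec (s : Equiv.Perm (Fin n)) (j : Fin n) (N : ℕ) :
    ∑ i, (orbitProd s j N).vec i = N := by
  have := sum_orbitProd_vec_mul s j N 1
  simpa using this

theorem perm_orbitProd {s : Equiv.Perm (Fin n)} {j : Fin n} {N : ℕ} (h : (s ^ N) j = j) :
    perm n s (orbitProd s j N) = zPow (N + (orbitProd s j N).vec j) * orbitProd s j N := by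
  have h1 : perm n s (orbitProd s j N) =
      ((List.range N).map fun i => gen ((s ^ (i + 1)) j)).prod := by
    rw [orbitProd, map_list_prod, List.map_map]
    congr 2
    funext i
    rw [comp_apply, perm_gen, pow_succ', Equiv.Perm.mul_apply]
  -- Both sides are $a_ja_{s(j)}\cdots a_{s^N(j)}$ with $s^N(j)=j$, split after the first or before
  -- the last factor. Moving `gen j` across then gives the sign.
  have h2 : gen j * perm n s (orbitProd s j N) = orbitProd s j N * gen j := by
    have h3 := List.prod_range_succ (fun i => (gen ((s ^ i) j) : PiGroup n)) N
    have h4 := List.prod_range_succ' (fun i => (gen ((s ^ i) j) : PiGroup n)) N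
    rw [h3, h] at h4
    rw [h1]
    exact h4.symm
  have h5 : ∑ i, (gen j : PiGroup n).vec i = 1 := by simp [gen]
  have h6 : ∑ i, (orbitProd s j N).vec i * (gen j : PiGroup n).vec i = (orbitProd s j N).vec j := by
    simp [gen, Pi.single_apply]
  rw [mul_eq_zPow_mul (orbitProd s j N), h5, h6, sum_orbitProd_vec, mul_one, ← mul_assoc,
    zPow_mul_comm, mul_assoc] at h2
  exact mul_left_cancel h2

/-- The sign has two sources: `perm_orbitProd`, and moving the orbit product past the even element
`a`. -/
theorem conj_orbitProd {s : Equiv.Perm (Fin n)} {j : Fin n} {N : ℕ} (h : (s ^ N) j = j)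
    {a : PiGroup n} (ha : ∑ i, a.vec i = 0) :
    orbitProd s j N * a * (perm n s (orbitProd s j N))⁻¹ =
      zPow (N + (orbitProd s j N).vec j + ∑ k ∈ Finset.range N, a.vec ((s ^ k) j)) * a := by
  rw [perm_orbitProd h, mul_inv_rev, zPow_inv, mul_eq_zPow_mul (orbitProd s j N) a, ha, mul_zero,
    zero_add, sum_orbitProd_vec_mul, zPow_add _ (∑ k ∈ _, _), ← mul_assoc, mul_assoc _ _ (_⁻¹),
    mul_assoc a, mul_inv_cancel, mul_one, ← zPow_mul_comm, mul_assoc]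

/-- A vector whose sums along all orbits vanish is a coboundary, for a permutation of odd order. -/
theorem exists_coboundary {s : Equiv.Perm (Fin n)} {N : ℕ} (hN : Odd N) (v : Fin n → ZMod 2)
    (h : ∀ j, ∑ k ∈ Finset.range N, v ((s ^ k) j) = 0) : ∃ u, v = u + u ∘ s.symm := by
  obtain ⟨M, rfl⟩ := hN
  -- Take every second term along the orbit. Then `u` and `u ∘ s.symm` together run over the
  -- exponents from `1` to `2 * M`, and the vanishing orbit sum identifies the total with `v j`.
  refine ⟨fun j => ∑ k ∈ Finset.range M, v ((s ^ (2 * k + 2)) j), funext fun j => ?_⟩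
  have h1 : ∀ k, (s ^ (2 * k + 2)) (s.symm j) = (s ^ (2 * k + 1)) j := by
    intro k
    rw [pow_succ, Equiv.Perm.mul_apply, Equiv.apply_symm_apply]
  have h2 : ∀ M, ∑ k ∈ Finset.range (2 * M + 1), v ((s ^ k) j) = v j +
      ∑ k ∈ Finset.range M, (v ((s ^ (2 * k + 2)) j) + v ((s ^ (2 * k + 1)) j)) := by
    intro M
    induction M with
    | zero => simp
    | succ M ih =>
      rw [show 2 * (M + 1) + 1 = 2 * M + 1 + 1 + 1 by ring, Finset.sum_range_succ,
        Finset.sum_range_succ, ih, Finset.sum_range_succ _ M]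
      ring
  have h3 := h j
  rw [h2, CharTwo.add_eq_zero] at h3
  rw [h3, Finset.sum_add_distrib]
  simp only [Pi.add_apply, comp_apply, h1]

end PiGroup

/-! ### The elements at which spin class functions can be nonzero -/

section Spin

open Function PiGroup

variable {Γ : Type*} [Group Γ] {n : ℕ}

theorem spin_ext {x y : SpinGroup Γ n} (h1 : x.left.1 = y.left.1) (h2 : x.left.2 = y.left.2)
    (h3 : x.right = y.right) : x = y :=
  SemidirectProduct.ext (Prod.ext h1 h2) h3

theorem spin_mul_fst (x y : SpinGroup Γ n) :
    (x * y).left.1 = x.left.1 * (y.left.1 ∘ x.right.symm) := rfl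

theorem spin_mul_snd (x y : SpinGroup Γ n) :
    (x * y).left.2 = x.left.2 * perm n x.right y.left.2 := rfl

theorem spin_mul_right (x y : SpinGroup Γ n) : (x * y).right = x.right * y.right := rfl

theorem parity_mul (x y : SpinGroup Γ n) : parity (x * y) = parity x + parity y := by
  unfold parity
  rw [spin_mul_snd, mul_vec, perm_vec]
  simp only [Pi.add_apply, Finset.sum_add_distrib]
  congr 1
  exact Equiv.sum_comp x.right.symm y.left.2.vec

theorem parity_conj (x y : SpinGroup Γ n) : parity (y * x * y⁻¹) = parity x := by
  have h : parity y + parity y⁻¹ = 0 := by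
    rw [← parity_mul, mul_inv_cancel]
    simp [parity]
  rw [parity_mul, parity_mul, add_right_comm, h, zero_add]

/-- Multiplication by a power of the central element. -/
def spinZ (e : ZMod 2) : SpinGroup Γ n := ⟨(1, zPow e), 1⟩

theorem spinZ_mul (e : ZMod 2) (x : SpinGroup Γ n) :
    spinZ e * x = ⟨(x.left.1, zPow e * x.left.2), x.right⟩ := by
  refine spin_ext ?_ ?_ ?_
  · rw [spin_mul_fst]; exact one_mul _
  · rw [spin_mul_snd]; exact congrArg (zPow e * ·) (by rw [spinZ, map_one]; rfl)
  · exact one_mul _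

theorem spinZ_comm (e : ZMod 2) (x : SpinGroup Γ n) : spinZ e * x = x * spinZ e := by
  rw [spinZ_mul]
  refine spin_ext ?_ ?_ ?_
  · rw [spin_mul_fst]; exact (mul_one _).symm
  · rw [spin_mul_snd, zPow_mul_comm]
    have := perm_zPow_mul x.right e 1
    rw [mul_one, map_one, mul_one] at this
    exact congrArg (x.left.2 * ·) this.symm
  · exact (mul_one _).symm

theorem spinZ_mul_self (e : ZMod 2) : (spinZ e * spinZ e : SpinGroup Γ n) = 1 := by
  rw [spinZ_mul]
  refine spin_ext rfl ?_ rfl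
  change zPow e * zPow e = (1 : PiGroup n)
  rw [← zPow_add, CharTwo.add_self_eq_zero, zPow_zero]

theorem spinZ_zero : (spinZ 0 : SpinGroup Γ n) = 1 := rfl

theorem spinZ_one : (spinZ 1 : SpinGroup Γ n) = zed := rfl

theorem zmod_two_eq (e : ZMod 2) : e = 0 ∨ e = 1 := by
  revert e; decide

/-- The inclusion of `Γ_n` in `Γ̃_n`. -/
def evenHom : Wreath Γ n →* SpinGroup Γ n where
  toFun := evenLift
  map_one' := rfl
  map_mul' v w := by
    refine spin_ext rfl ?_ rfl
    rw [spin_mul_snd]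
    change 1 = 1 * perm n v.right 1
    rw [map_one, mul_one]

/-- The projection from `Γ̃_n` to `Γ_n`. -/
def wreathHom : SpinGroup Γ n →* Wreath Γ n where
  toFun := toWreath
  map_one' := rfl
  map_mul' _ _ := rfl

theorem parity_evenLift (w : Wreath Γ n) : parity (evenLift w) = 0 := by
  simp [parity, evenLift]

/-- The element of `Γ̃_n` given by `b ∈ Π_n`. -/
def ofPi (b : PiGroup n) : SpinGroup Γ n := ⟨(1, b), 1⟩

theorem ofPi_conj (b : PiGroup n) (x : SpinGroup Γ n) : ofPi b * x * (ofPi b)⁻¹ =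
    ⟨(x.left.1, b * x.left.2 * (perm n x.right b)⁻¹), x.right⟩ := by
  rw [mul_inv_eq_iff_eq_mul]
  refine spin_ext ?_ ?_ ?_
  · rw [spin_mul_fst, spin_mul_fst]
    change 1 * x.left.1 = x.left.1 * 1
    rw [one_mul, mul_one]
  · rw [spin_mul_snd, spin_mul_snd]
    change b * perm n 1 x.left.2 = b * x.left.2 * (perm n x.right b)⁻¹ * perm n x.right b
    rw [map_one, inv_mul_cancel_right]
    rfl
  · rw [spin_mul_right, spin_mul_right]
    exact (one_mul _).trans (mul_one _).symm

variable {f h : SpinGroup Γ n → ℂ}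

theorem RMinus.eq_zero_of_conj (hf : f ∈ RMinus Γ n) {x y : SpinGroup Γ n}
    (hxy : y * x * y⁻¹ = spinZ 1 * x) : f x = 0 := by
  have h1 := hf.1 x y
  rw [hxy, spinZ_one, hf.2.1] at h1
  linear_combination (-1 / 2 : ℂ) * h1

theorem RMinus.eq_zero_of_spinZ_mul (hf : f ∈ RMinus Γ n) (e : ZMod 2) {x : SpinGroup Γ n}
    (hx : f (spinZ e * x) = 0) : f x = 0 := by
  rcases zmod_two_eq e with rfl | rfl
  · rwa [spinZ_zero, one_mul] at hx
  · rwa [spinZ_one, hf.2.1, neg_eq_zero] at hx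

theorem RMinus.spinZ_mul_spinZ (hf : f ∈ RMinus Γ n) (hh : h ∈ RMinus Γ n) (e : ZMod 2)
    (x : SpinGroup Γ n) : f (spinZ e * x) * h (spinZ e * x)⁻¹ = f x * h x⁻¹ := by
  rcases zmod_two_eq e with rfl | rfl
  · rw [spinZ_zero, one_mul]
  · have : (spinZ 1 * x)⁻¹ = spinZ 1 * x⁻¹ := by
      rw [mul_inv_rev, inv_eq_of_mul_eq_one_left (spinZ_mul_self (Γ := Γ) (n := n) 1), spinZ_comm]
    rw [this, spinZ_one, hf.2.1, hh.2.1, neg_mul_neg]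

/-- Spin super class functions impose a parity condition along each cycle. -/
theorem RMinus.sum_range_eq (hf : f ∈ RMinus Γ n) {x : SpinGroup Γ n} (hx : f x ≠ 0)
    {j : Fin n} {N : ℕ} (hN : (x.right ^ N) j = j) :
    N + (orbitProd x.right j N).vec j +
      ∑ k ∈ Finset.range N, x.left.2.vec ((x.right ^ k) j) = 0 := by
  have hp : ∑ i, x.left.2.vec i = 0 := (zmod_two_eq (parity x)).resolve_right fun h =>
    hx (hf.2.2 x h)
  -- If this exponent were `1`, conjugation by the orbit product would turn `x` into `z x`.
  refine (zmod_two_eq _).resolve_right fun h => hx (RMinus.eq_zero_of_conj hf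
    (y := ofPi (orbitProd x.right j N)) ?_)
  rw [ofPi_conj, conj_orbitProd hN hp, h, spinZ_mul]

theorem orbitProd_minimalPeriod_vec (s : Equiv.Perm (Fin n)) (j i : Fin n) :
    (orbitProd s j (minimalPeriod s j)).vec i = if s.SameCycle j i then 1 else 0 := by
  rw [orbitProd_vec]
  split_ifs with h
  · obtain ⟨k, rfl⟩ := h.exists_nat_pow_eq
    rw [Finset.sum_eq_single (k % minimalPeriod s j), if_pos]
    · rw [← Equiv.Perm.iterate_eq_pow, ← Equiv.Perm.iterate_eq_pow, iterate_mod_minimalPeriod_eq]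
    · intro l hl hlk
      rw [if_neg]
      intro h2
      rw [← Equiv.Perm.iterate_eq_pow, ← Equiv.Perm.iterate_eq_pow,
        ← iterate_mod_minimalPeriod_eq (n := k),
        iterate_eq_iterate_iff_of_lt_minimalPeriod (Finset.mem_range.1 hl)
          (Nat.mod_lt _ (minimalPeriod_pos s j))] at h2
      exact hlk h2
    · intro h2
      exact absurd (Finset.mem_range.2 (Nat.mod_lt _ (minimalPeriod_pos s j))) h2
  · refine Finset.sum_eq_zero fun k _ => if_neg fun hk => h ⟨k, by rwa [zpow_natCast]⟩

/-- Spin super class functions vanish on elements whose permutation has an even cycle. -/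
theorem RMinus.odd_minimalPeriod (hf : f ∈ RMinus Γ n) {x : SpinGroup Γ n} (hx : f x ≠ 0)
    (j : Fin n) : Odd (minimalPeriod x.right j) := by
  by_contra hodd
  rw [Nat.not_odd_iff_even] at hodd
  refine hx ?_
  have hsum := RMinus.sum_range_eq hf hx (pow_minimalPeriod_apply x.right j)
  rw [(ZMod.natCast_eq_zero_iff_even).2 hodd, ← sum_orbitProd_vec_mul] at hsum
  simp only [orbitProd_minimalPeriod_vec] at hsum
  obtain ⟨⟨g, a⟩, s⟩ := x
  simp only [Equiv.Perm.SameCycle.refl, if_true, zero_add] at hsum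
  -- Up to a power of `z`, split `x` into a part on the cycle of `j` and a part off it. The first is
  -- odd by `hsum`, so the second is odd because `x` is even. Odd elements with disjoint supports
  -- commute up to `z`, so conjugation by the first part turns `x` into `z x`.
  let aK : PiGroup n := ⟨0, fun i => if s.SameCycle j i then a.vec i else 0⟩
  let aL : PiGroup n := ⟨0, fun i => if s.SameCycle j i then 0 else a.vec i⟩
  let gK : Fin n → Γ := fun i => if s.SameCycle j i then g i else 1
  have hp : ∑ i, a.vec i = 0 := (zmod_two_eq (parity _)).resolve_right fun h =>
    hx (hf.2.2 ⟨⟨g, a⟩, s⟩ h)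
  have hK : ∑ i, aK.vec i = 1 := by
    rw [CharTwo.add_eq_zero] at hsum
    rw [hsum]
    exact Finset.sum_congr rfl fun i _ => by simp only [aK]; split_ifs <;> simp
  have hL : ∑ i, aL.vec i = 1 := by
    have : ∑ i, aK.vec i + ∑ i, aL.vec i = 0 := by
      rw [← Finset.sum_add_distrib, ← hp]
      exact Finset.sum_congr rfl fun i _ => by simp only [aK, aL]; split_ifs <;> simp
    rw [hK, CharTwo.add_eq_zero] at this
    exact this.symm
  obtain ⟨e, ha⟩ : ∃ e, a = zPow e * (aK * aL) := exists_eq_zPow_mul (by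
    funext i; simp only [aK, aL, mul_vec, Pi.add_apply]; split_ifs <;> simp)
  have hsame : ∀ i, s.SameCycle j (s.symm i) ↔ s.SameCycle j i := fun i =>
    Equiv.Perm.sameCycle_symm_apply_right
  have hcyc : ∀ i, s.SameCycle j i → s.cycleOf j i = s i := fun i h => h.cycleOf_apply
  have hcyc' : ∀ i, ¬ s.SameCycle j i → s.cycleOf j i = i := fun i h =>
    Equiv.Perm.cycleOf_apply_of_not_sameCycle h
  have hsymm : ∀ i, s.SameCycle j i → (s.cycleOf j).symm i = s.symm i := fun i h => by
    rw [Equiv.symm_apply_eq, hcyc _ ((hsame i).2 h), Equiv.apply_symm_apply]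
  have hsymm' : ∀ i, ¬ s.SameCycle j i → (s.cycleOf j).symm i = i := fun i h => by
    rw [Equiv.symm_apply_eq, hcyc' _ h]
  have hcL : perm n (s.cycleOf j) aL = aL := by
    rw [perm_congr (t := 1), map_one, MulAut.one_apply]
    intro i hi
    exact hcyc' i fun h => hi (if_pos h)
  have hcK : perm n (s.cycleOf j) aK = perm n s aK :=
    perm_congr fun i hi => hcyc i (by_contra fun h => hi (if_neg h))
  -- Two odd factors without common indices: the exponent of `z` is `1 * 1 + 0`.
  have hswap : aL * perm n s aK = zPow 1 * (perm n s aK * aL) := by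
    rw [mul_eq_zPow_mul, hL]
    congr 2
    have h1 : ∑ i, (perm n s aK).vec i = 1 := by
      rw [← hK]; exact Equiv.sum_comp s.symm aK.vec
    rw [h1, mul_one, Finset.sum_eq_zero, add_zero]
    intro i _
    simp only [perm_vec, comp_apply, aK, aL, hsame]
    split_ifs <;> simp
  refine RMinus.eq_zero_of_conj hf (y := ⟨(gK, aK), s.cycleOf j⟩) ?_
  rw [mul_inv_eq_iff_eq_mul, mul_assoc, spinZ_mul]
  refine spin_ext ?_ ?_ ?_
  · funext i
    change gK i * g ((s.cycleOf j).symm i) = g i * gK (s.symm i)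
    by_cases h : s.SameCycle j i
    · simp only [gK, hsame, if_pos h, hsymm i h]
    · simp only [gK, hsame, if_neg h, hsymm' i h, one_mul, mul_one]
  · simp only [spin_mul_snd]
    have h1 : perm n (s.cycleOf j) a = zPow e * (perm n s aK * aL) := by
      rw [ha, perm_zPow_mul, map_mul, hcL, hcK]
    rw [h1, ha, mul_assoc (zPow e), mul_assoc aK, hswap, zPow_mul_comm e, zPow_mul_comm e]
    simp only [← mul_assoc]
    rw [zPow_mul_comm 1 aK]
    simp only [mul_assoc, ← zPow_mul_comm]
    rw [← mul_assoc (zPow 1) (zPow 1), ← zPow_add]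
    simp only [CharTwo.add_self_eq_zero, zPow_zero, one_mul]
  · ext i
    simp only [spin_mul_right, Equiv.Perm.mul_apply]
    by_cases h : s.SameCycle j i
    · rw [hcyc i h, hcyc _ (Equiv.Perm.sameCycle_apply_right.2 h)]
    · rw [hcyc' i h, hcyc' _ (Equiv.Perm.sameCycle_apply_right.not.2 h)]

/-- A permutation all of whose cycles have odd length has odd order. -/
theorem exists_odd_pow_eq_one {s : Equiv.Perm (Fin n)} (h : ∀ i, Odd (minimalPeriod s i)) :
    ∃ N, Odd N ∧ s ^ N = 1 := by
  refine ⟨∏ i, minimalPeriod s i, Finset.prod_induction _ Odd (fun _ _ => Odd.mul) odd_one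
    fun i _ => h i, Equiv.ext fun i => ?_⟩
  obtain ⟨k, hk⟩ := Finset.dvd_prod_of_mem (fun i => minimalPeriod s i) (Finset.mem_univ i)
  rw [← Equiv.Perm.iterate_eq_pow]
  exact ((isPeriodicPt_minimalPeriod s i).mul_const k |> fun h => by rw [hk]; exact h)

/-- Take an odd `N` with `s ^ N = 1` in `RMinus.sum_range_eq`. By `eq_zero_of_perm_eq` the sign
attached to the orbit product is trivial, so the vector sums to zero along every orbit. -/
theorem RMinus.exists_coboundary (hf : f ∈ RMinus Γ n) {x : SpinGroup Γ n} (hx : f x ≠ 0) :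
    ∃ u, x.left.2.vec = u + u ∘ x.right.symm := by
  obtain ⟨N, hN, hs⟩ := exists_odd_pow_eq_one (RMinus.odd_minimalPeriod hf hx)
  refine PiGroup.exists_coboundary hN _ fun j => ?_
  have hj : (x.right ^ N) j = j := by rw [hs]; rfl
  have := RMinus.sum_range_eq hf hx hj
  rwa [eq_zero_of_perm_eq hN hs (perm_orbitProd hj), zero_add] at this

/-- Conjugating $(g,s)$ by $b\in\Pi_n$ inserts $b\,s(b)^{-1}$, whose vector is the coboundary of
that of $b$; so a coboundary can be conjugated away, up to a power of `z`. -/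
theorem exists_conj_evenLift {x : SpinGroup Γ n} {u : Fin n → ZMod 2}
    (hu : x.left.2.vec = u + u ∘ x.right.symm) :
    ∃ e y, x = spinZ e * (y * evenLift (toWreath x) * y⁻¹) := by
  obtain ⟨e, he⟩ := exists_eq_zPow_mul (x := x.left.2)
    (y := ⟨0, u⟩ * (perm n x.right ⟨0, u⟩)⁻¹) (by
    rw [hu, mul_vec, inv_vec, perm_vec])
  refine ⟨e, ofPi ⟨0, u⟩, ?_⟩
  rw [ofPi_conj, spinZ_mul]
  refine spin_ext rfl ?_ rfl
  rw [he]
  change _ = zPow e * (_ * 1 * _)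
  rw [mul_one]
  rfl

theorem RMinus.mul_inv_conj (hf : f ∈ RMinus Γ n) (hh : h ∈ RMinus Γ n) (x y : SpinGroup Γ n) :
    f (y * x * y⁻¹) * h (y * x * y⁻¹)⁻¹ = f x * h x⁻¹ := by
  rw [hf.1, show (y * x * y⁻¹)⁻¹ = y * x⁻¹ * y⁻¹ by group, hh.1]

/-- The unknown sign from `exists_conj_evenLift` occurs in both factors and cancels. -/
theorem RMinus.mul_inv_evenLift (hf : f ∈ RMinus Γ n) (hh : h ∈ RMinus Γ n) {x : SpinGroup Γ n}
    {u : Fin n → ZMod 2} (hu : x.left.2.vec = u + u ∘ x.right.symm) :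
    f x * h x⁻¹ = f (evenLift (toWreath x)) * h (evenLift (toWreath x)⁻¹) := by
  obtain ⟨e, y, hxy⟩ := exists_conj_evenLift hu
  have : evenLift (toWreath x)⁻¹ = (evenLift (toWreath x))⁻¹ := map_inv evenHom _
  rw [this, ← RMinus.mul_inv_conj hf hh (evenLift _) y,
    ← RMinus.spinZ_mul_spinZ hf hh e (y * _ * _), ← hxy]

end Spin

/-! ### The weighted form in terms of values on classes -/

section Pairing

open Function PiGroup

variable {Γ : Type*} [Group Γ] {n : ℕ}

/-- The map `u ↦ u + s u` on `𝔽₂^n`. -/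
def coboundary (s : Equiv.Perm (Fin n)) : (Fin n → ZMod 2) →+ (Fin n → ZMod 2) :=
  AddMonoidHom.mk' (fun u => u + u ∘ s.symm) fun u v => by
    funext i; simp only [Pi.add_apply, comp_apply]; ring

/-- The kernel of `coboundary s` consists of the functions constant on the cycles of `s`. -/
def kerCoboundary (s : Equiv.Perm (Fin n)) : (coboundary s).ker ≃ (Cycles s → ZMod 2) where
  toFun u := Quotient.lift u.1 fun i j hij => by
    have h : ∀ i, u.1 (s i) = u.1 i := fun i => by
      have h1 := congrFun (AddMonoidHom.mem_ker.1 u.2) (s i)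
      change u.1 (s i) + u.1 (s.symm (s i)) = 0 at h1
      rwa [Equiv.symm_apply_apply, CharTwo.add_eq_zero] at h1
    obtain ⟨k, rfl⟩ := Equiv.Perm.SameCycle.exists_nat_pow_eq hij
    induction k with
    | zero => rfl
    | succ k ih => rw [pow_succ', Equiv.Perm.mul_apply, h]; exact ih ⟨k, zpow_natCast s k ▸ rfl⟩
  invFun φ := ⟨fun i => φ (cycleOfPoint s i), AddMonoidHom.mem_ker.2 (funext fun i => by
    change φ (cycleOfPoint s i) + φ (cycleOfPoint s (s.symm i)) = 0
    rw [cycleOfPoint_eq_iff.2 (Equiv.Perm.sameCycle_symm_apply_left.2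
      (Equiv.Perm.SameCycle.refl s i)),
      CharTwo.add_self_eq_zero])⟩
  left_inv u := rfl
  right_inv φ := funext fun q => Quotient.inductionOn q fun _ => rfl

/-- The kernel has one free value in `ZMod 2` per cycle, so its order is 2 to the number of cycles.
-/
theorem card_range_coboundary (s : Equiv.Perm (Fin n)) :
    (Nat.card (coboundary s).range : ℂ) = 2 ^ n * 2⁻¹ ^ Fintype.card (Cycles s) := by
  have h1 := (coboundary s).ker.card_mul_index
  rw [AddSubgroup.index_ker, Nat.card_congr (kerCoboundary s)] at h1
  have h2 : Nat.card (Cycles s → ZMod 2) = 2 ^ Fintype.card (Cycles s) := by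
    rw [Nat.card_fun, Nat.card_zmod, Nat.card_eq_fintype_card]
  have h3 : Nat.card (Fin n → ZMod 2) = 2 ^ n := by
    rw [Nat.card_fun, Nat.card_zmod, Nat.card_fin]
  rw [h2, h3] at h1
  have h4 : (2 : ℂ) ^ Fintype.card (Cycles s) * Nat.card (coboundary s).range = 2 ^ n := by
    exact_mod_cast h1
  rw [← h4, mul_right_comm, ← mul_pow, mul_inv_cancel₀ two_ne_zero, one_pow, one_mul]

variable {f h : SpinGroup Γ n → ℂ}

/-- Elements of `Π_n` whose vector is not a coboundary contribute nothing, and all others contribute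
equally. This is the group-side origin of the factor $\frac12$ in $\frac m2$: one for each cycle. -/
theorem RMinus.sum_piGroup (hf : f ∈ RMinus Γ n) (hh : h ∈ RMinus Γ n) (w : Wreath Γ n) :
    ∑ a : PiGroup n, f ⟨(w.left, a), w.right⟩ * h (⟨(w.left, a), w.right⟩ : SpinGroup Γ n)⁻¹ =
      2 ^ (n + 1) * (2⁻¹ ^ Fintype.card (Cycles w.right) *
        (f (evenLift w) * h (evenLift w⁻¹))) := by
  have key : ∀ a : PiGroup n,
      f ⟨(w.left, a), w.right⟩ * h (⟨(w.left, a), w.right⟩ : SpinGroup Γ n)⁻¹ =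
        if a.vec ∈ (coboundary w.right).range then f (evenLift w) * h (evenLift w⁻¹) else 0 := by
    intro a
    split_ifs with ha
    · obtain ⟨u, hu⟩ := ha
      exact RMinus.mul_inv_evenLift hf hh (x := ⟨(w.left, a), w.right⟩) hu.symm
    · rw [mul_eq_zero]
      left
      by_contra h0
      obtain ⟨u, hu⟩ := RMinus.exists_coboundary hf h0
      exact ha ⟨u, hu.symm⟩
  rw [Finset.sum_congr rfl fun a _ => key a, ← (equivProd n).symm.sum_comp, Fintype.sum_prod_type]
  have h1 : ∀ e : ZMod 2, ∑ v : Fin n → ZMod 2, (if ((equivProd n).symm (e, v)).vec ∈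
      (coboundary w.right).range then f (evenLift w) * h (evenLift w⁻¹) else 0) =
      2 ^ n * 2⁻¹ ^ Fintype.card (Cycles w.right) * (f (evenLift w) * h (evenLift w⁻¹)) := by
    intro e
    rw [← Finset.sum_filter, Finset.sum_const, nsmul_eq_mul, ← card_range_coboundary]
    congr 2
    rw [← Fintype.card_subtype, ← Nat.card_eq_fintype_card]
    rfl
  rw [Finset.sum_congr rfl fun e _ => h1 e, Finset.sum_const, Finset.card_univ, ZMod.card,
    nsmul_eq_mul]
  push_cast
  ring

/-- The family `ρ̄` with `ρ̄(c) = ρ(c⁻¹)`. -/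
def barEquiv (Γ : Type*) [Group Γ] [Fintype Γ] (n : ℕ) :
    OddPart (ConjClasses Γ) n ≃ OddPart (ConjClasses Γ) n :=
  Equiv.subtypeEquiv (Equiv.arrowCongr classInvEquiv (Equiv.refl _)) fun ρ => by
    rw [← Equiv.sum_comp (classInvEquiv (Γ := Γ)).symm]
    rfl

variable [Fintype Γ]

theorem barEquiv_apply (ρ : OddPart (ConjClasses Γ) n) :
    (barEquiv Γ n ρ).1 = fun c => ρ.1 (classInv c) := rfl

theorem bigZ_barEquiv (ρ : OddPart (ConjClasses Γ) n) : bigZ (barEquiv Γ n ρ) = bigZ ρ := by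
  unfold bigZ
  rw [← Equiv.prod_comp (classInvEquiv (Γ := Γ))]
  refine Finset.prod_congr rfl fun c _ => ?_
  have : (barEquiv Γ n ρ).1 (classInvEquiv c) = ρ.1 c := congrArg ρ.1 (classInv_classInv c)
  rw [this]
  congr 2
  exact zeta_classInv c

theorem lengthWeight_barEquiv {ξ : Γ → ℂ} (hclass : ∀ x y, ξ (y * x * y⁻¹) = ξ x)
    (hdual : ∀ x, ξ x⁻¹ = ξ x) (ρ : OddPart (ConjClasses Γ) n) :
    lengthWeight ξ (barEquiv Γ n ρ).1 = lengthWeight ξ ρ.1 := by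
  unfold lengthWeight
  rw [← Equiv.prod_comp (classInvEquiv (Γ := Γ))]
  refine Finset.prod_congr rfl fun c _ => ?_
  have h1 : (barEquiv Γ n ρ).1 (classInvEquiv c) = ρ.1 c := congrArg ρ.1 (classInv_classInv c)
  have h2 : ξ (Quotient.out (classInvEquiv c)) = ξ (Quotient.out c) := by
    rw [← hdual (Quotient.out c)]
    refine conj_invariant_of_isConj hclass (ConjClasses.mk_eq_mk_iff_isConj.1 ?_)
    rw [mk_out, ← classInv_mk, mk_out]
    rfl
  rw [h1, h2]

/-- The element chosen in `valueAt` is immaterial: elements of the same type are conjugate in `Γ_n`,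
hence so are their lifts. -/
theorem valueAt_eq {ρ : OddPart (ConjClasses Γ) n} {w : Wreath Γ n} (hw : HasType w ρ.1)
    (f : RMinus Γ n) : valueAt ρ f = f.1 (evenLift w) := by
  have hne : (classD ρ).Nonempty := ⟨evenLift w, w, hw, IsConj.refl _⟩
  have h1 : valueAt ρ f = f.1 hne.some := by
    rw [valueAt, dif_pos hne]; rfl
  obtain ⟨u, hu, hux⟩ := hne.some_mem
  have h2 : IsConj (evenLift w) hne.some :=
    (MonoidHom.map_isConj (evenHom (Γ := Γ) (n := n)) (hw.isConj hu)).trans hux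
  obtain ⟨y, hy⟩ := isConj_iff.1 h2
  rw [h1, ← hy, f.2.1]

/-- Sum over the fibres of the projection to `Γ_n`: the factor `2 ^ (n + 1)` from
`RMinus.sum_piGroup` cancels the order of `Π_n`. Then average over types; the inverse of an element
of type `ρ` has type `barEquiv Γ n ρ`. -/
theorem weightedForm_eq {ξ : Γ → ℂ} (hclass : ∀ x y, ξ (y * x * y⁻¹) = ξ x) (f h : RMinus Γ n) :
    weightedForm ξ n f h = ∑ ρ : OddPart (ConjClasses Γ) n, (bigZ ρ)⁻¹ *
      (lengthWeight ξ ρ.1 * (valueAt ρ f * valueAt (barEquiv Γ n ρ) h)) := by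
  have : Fintype (Wreath Γ n) := Fintype.ofFinite _
  let E : Wreath Γ n × PiGroup n ≃ SpinGroup Γ n :=
    { toFun := fun p => ⟨(p.1.left, p.2), p.1.right⟩
      invFun := fun x => (toWreath x, x.left.2)
      left_inv := fun _ => rfl
      right_inv := fun _ => rfl }
  change (Fintype.card (SpinGroup Γ n) : ℂ)⁻¹ *
    ∑ x : SpinGroup Γ n, eta ξ (toWreath x) * f.1 x * h.1 x⁻¹ = _
  rw [← Fintype.card_congr E, Fintype.card_prod, PiGroup.card_eq, ← E.sum_comp,
    Fintype.sum_prod_type]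
  have h1 : ∀ w : Wreath Γ n, ∑ a : PiGroup n, eta ξ (toWreath (E (w, a))) * f.1 (E (w, a)) *
      h.1 (E (w, a))⁻¹ = 2 ^ (n + 1) * (eta ξ w * 2⁻¹ ^ Fintype.card (Cycles w.right) *
        (f.1 (evenLift w) * h.1 (evenLift w⁻¹))) := by
    intro w
    simp only [mul_assoc]
    rw [mul_left_comm, ← RMinus.sum_piGroup f.2 h.2 w, Finset.mul_sum]
    rfl
  rw [Finset.sum_congr rfl fun w _ => h1 w, ← Finset.mul_sum, Nat.cast_mul, mul_inv, mul_assoc,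
    Nat.cast_pow, Nat.cast_ofNat, inv_mul_cancel_left₀ (pow_ne_zero _ two_ne_zero)]
  refine sum_wreath _ _ (fun w ρ hw => ?_) fun w ⟨i, hi⟩ => ?_
  · rw [hw.prod_half hclass, valueAt_eq hw, valueAt_eq (ρ := barEquiv Γ n ρ) hw.inv]
  · have : f.1 (evenLift w) = 0 := by
      by_contra h0
      exact hi (RMinus.odd_minimalPeriod f.2 h0 i)
    rw [this, zero_mul, mul_zero]

end Pairing

/-! ### Values on the classes as free coordinates on spin class functions -/

section Values

open Function PiGroup

variable {Γ : Type*} [Group Γ] {n : ℕ}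

/-- The `Π_n`-component of such a `y` would be multiplied by `z` under a permutation of odd order,
against `eq_zero_of_perm_eq`. -/
theorem conj_evenLift_ne {w : Wreath Γ n} (hw : ∀ i, Odd (minimalPeriod w.right i))
    (y : SpinGroup Γ n) : y * evenLift w * y⁻¹ ≠ spinZ 1 * evenLift w := by
  intro h
  rw [mul_inv_eq_iff_eq_mul, mul_assoc, spinZ_mul] at h
  have h2 : y.left.2 * perm n y.right 1 = zPow 1 * (1 * perm n w.right y.left.2) :=
    congrArg (fun x : SpinGroup Γ n => x.left.2) h
  rw [map_one, mul_one, one_mul] at h2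
  obtain ⟨N, hN, hs⟩ := exists_odd_pow_eq_one hw
  have h3 : perm n w.right y.left.2 = zPow 1 * y.left.2 := by
    conv_rhs => rw [h2]
    rw [← mul_assoc, ← zPow_add, CharTwo.add_self_eq_zero, zPow_zero, one_mul]
  exact one_ne_zero (eq_zero_of_perm_eq hN hs h3)

variable [Fintype Γ]

/-- The spin class function supported on the classes of `(g, s)` and `z (g, s)`. -/
def spinIndicator (w : Wreath Γ n) : RMinus Γ n where
  val x := ∑ y : SpinGroup Γ n, ((if y * x * y⁻¹ = evenLift w then 1 else 0) -
    if y * x * y⁻¹ = spinZ 1 * evenLift w then 1 else 0)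
  property := by
    have hz : ∀ x t : SpinGroup Γ n, spinZ 1 * x = t ↔ x = spinZ 1 * t := fun x t => by
      constructor <;> rintro rfl <;> rw [← mul_assoc, spinZ_mul_self, one_mul]
    refine ⟨fun x t => ?_, fun x => ?_, fun x hx => ?_⟩
    · refine Fintype.sum_equiv (Equiv.mulRight t) _ _ fun y => ?_
      have : y * (t * x * t⁻¹) * y⁻¹ = y * t * x * (y * t)⁻¹ := by group
      rw [this]
      rfl
    · rw [← Finset.sum_neg_distrib]
      refine Finset.sum_congr rfl fun y _ => ?_
      have : y * (zed * x) * y⁻¹ = spinZ 1 * (y * x * y⁻¹) := by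
        rw [← spinZ_one, ← mul_assoc y, ← spinZ_comm, mul_assoc, mul_assoc, mul_assoc]
      rw [this, neg_sub, if_congr (hz _ _) rfl rfl, if_congr (mul_right_inj _) rfl rfl]
    · have h0 : parity (spinZ 1 * evenLift w) = 0 := by
        rw [parity_mul, parity_evenLift, add_zero]
        exact Finset.sum_const_zero
      refine Finset.sum_eq_zero fun y _ => ?_
      rw [if_neg, if_neg, sub_zero]
      · intro h
        rw [← parity_conj x y, h, h0] at hx
        exact zero_ne_one hx
      · intro h
        rw [← parity_conj x y, h, parity_evenLift] at hx
        exact zero_ne_one hx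

theorem spinIndicator_apply (w : Wreath Γ n) (x : SpinGroup Γ n) : (spinIndicator w).1 x =
    ∑ y : SpinGroup Γ n, ((if y * x * y⁻¹ = evenLift w then 1 else 0) -
      if y * x * y⁻¹ = spinZ 1 * evenLift w then 1 else 0) := rfl

theorem valueAt_spinIndicator_of_ne {w : Wreath Γ n} {ρ σ : OddPart (ConjClasses Γ) n}
    (hw : HasType w ρ.1) (h : σ ≠ ρ) : valueAt σ (spinIndicator w) = 0 := by
  obtain ⟨v, hv⟩ := exists_hasType σ
  have key : ∀ (y : SpinGroup Γ n), wreathHom y * v * (wreathHom y)⁻¹ ≠ w := fun y hy =>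
    h (HasType.unique (hv.of_isConj (isConj_iff.2 ⟨_, hy⟩)) hw)
  rw [valueAt_eq hv, spinIndicator_apply]
  refine Finset.sum_eq_zero fun y _ => ?_
  rw [if_neg, if_neg, sub_zero]
  · intro hy
    refine key y ?_
    have := congrArg wreathHom hy
    rw [map_mul, map_mul, map_inv, spinZ_mul] at this
    exact this
  · intro hy
    refine key y ?_
    have := congrArg wreathHom hy
    rw [map_mul, map_mul, map_inv] at this
    exact this

/-- The negative terms never occur, by `conj_evenLift_ne`, and `y = 1` gives a positive one. -/
theorem valueAt_spinIndicator_self {w : Wreath Γ n} {ρ : OddPart (ConjClasses Γ) n}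
    (hw : HasType w ρ.1) : valueAt ρ (spinIndicator w) ≠ 0 := by
  rw [valueAt_eq hw, spinIndicator_apply]
  simp only [if_neg (conj_evenLift_ne (fun i => odd_minimalPeriod_of_hasType hw i) _), sub_zero]
  rw [Finset.sum_boole, Nat.cast_ne_zero, ← Nat.pos_iff_ne_zero, Finset.card_pos]
  exact ⟨1, by simp⟩

/-- A spin class function is determined by its values on the classes `D_ρ^+`. -/
theorem RMinus.eq_zero_of_valueAt {f : RMinus Γ n} (h : ∀ ρ, valueAt ρ f = 0) : f = 0 := by
  refine Subtype.ext (funext fun x => ?_)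
  by_contra hx
  obtain ⟨u, hu⟩ := RMinus.exists_coboundary f.2 hx
  obtain ⟨e, y, hxy⟩ := exists_conj_evenLift hu
  obtain ⟨ρ, hρ⟩ := exists_hasType_of_odd (w := toWreath x) (RMinus.odd_minimalPeriod f.2 hx)
  have h1 := h ρ
  rw [valueAt_eq hρ, ← f.2.1 _ y] at h1
  refine hx (RMinus.eq_zero_of_spinZ_mul f.2 e ?_)
  have h2 : spinZ e * x = y * evenLift (toWreath x) * y⁻¹ := by
    conv_lhs => rw [hxy]
    rw [← mul_assoc, spinZ_mul_self, one_mul]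
  rw [h2, h1]

/-- Evaluation on the classes `D_ρ^+`. -/
def values (Γ : Type*) [Group Γ] [Fintype Γ] (n : ℕ) :
    RMinus Γ n →ₗ[ℂ] (OddPart (ConjClasses Γ) n → ℂ) :=
  LinearMap.pi fun ρ => valueAt ρ

theorem values_bijective : Bijective (values Γ n) := by
  constructor
  · rw [← LinearMap.ker_eq_bot, LinearMap.ker_eq_bot']
    exact fun f hf => RMinus.eq_zero_of_valueAt fun ρ => congrFun hf ρ
  · choose w hw using fun ρ : OddPart (ConjClasses Γ) n => exists_hasType ρ
    intro φ
    refine ⟨∑ ρ, (φ ρ / valueAt ρ (spinIndicator (w ρ))) • spinIndicator (w ρ), funext fun σ => ?_⟩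
    change valueAt σ _ = _
    rw [map_sum, Finset.sum_eq_single σ]
    · rw [map_smul, smul_eq_mul, div_mul_cancel₀ _ (valueAt_spinIndicator_self (hw σ))]
    · intro ρ _ hρ
      rw [map_smul, valueAt_spinIndicator_of_ne (hw ρ) hρ.symm, smul_zero]
    · exact fun h => absurd (Finset.mem_univ _) h

/-- The basis of `R^-(Γ̃_n)` dual to the evaluations on the classes `D_ρ^+`. -/
def rMinusBasis (Γ : Type*) [Group Γ] [Fintype Γ] (n : ℕ) :
    Module.Basis (OddPart (ConjClasses Γ) n) ℂ (RMinus Γ n) :=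
  Module.Basis.ofEquivFun (LinearEquiv.ofBijective (values Γ n) values_bijective)

theorem valueAt_rMinusBasis (ρ σ : OddPart (ConjClasses Γ) n) :
    valueAt σ (rMinusBasis Γ n ρ) = if σ = ρ then 1 else 0 := by
  have h : valueAt σ (rMinusBasis Γ n ρ) = (rMinusBasis Γ n).equivFun (rMinusBasis Γ n ρ) σ := by
    rw [rMinusBasis, Module.Basis.equivFun_ofEquivFun]; rfl
  rw [h, Module.Basis.equivFun_self]
  exact if_congr eq_comm rfl rfl

end Values

/-! ### Comparison of the two Gram matrices -/

section Isometry

open Function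

variable {Γ : Type*} [Group Γ] [Fintype Γ] {n : ℕ}

/-- The basis of `R_Γ^-` dual to the evaluations on the classes `D_ρ^+`. -/
def rSpaceBasis (Γ : Type*) [Group Γ] [Fintype Γ] :
    Module.Basis (Σ n, OddPart (ConjClasses Γ) n) ℂ (RSpace Γ) :=
  DFinsupp.basis fun n => rMinusBasis Γ n

theorem rSpaceBasis_apply (ρ : OddPart (ConjClasses Γ) n) :
    rSpaceBasis Γ ⟨n, ρ⟩ = DirectSum.lof ℂ ℕ (fun n => RMinus Γ n) n (rMinusBasis Γ n ρ) := by
  change (rSpaceBasis Γ).repr.symm (Finsupp.single _ 1) = _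
  rw [LinearEquiv.symm_apply_eq]
  change _ = (DFinsupp.basis fun n => rMinusBasis Γ n).repr (DFinsupp.single n (rMinusBasis Γ n ρ))
  simp only [DFinsupp.basis, LinearEquiv.trans_apply]
  rw [LinearEquiv.eq_symm_apply]
  erw [DFinsupp.mapRange.linearEquiv_apply]
  rw [DFinsupp.mapRange_single, Module.Basis.repr_self]
  exact sigmaFinsuppEquivDFinsupp_single _ _

theorem weightedForm_rMinusBasis {ξ : Γ → ℂ} (hclass : ∀ x y, ξ (y * x * y⁻¹) = ξ x)
    (ρ σ : OddPart (ConjClasses Γ) n) : weightedForm ξ n (rMinusBasis Γ n ρ) (rMinusBasis Γ n σ) =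
      if σ = barEquiv Γ n ρ then (bigZ ρ)⁻¹ * lengthWeight ξ ρ.1 else 0 := by
  rw [weightedForm_eq hclass, Finset.sum_eq_single ρ]
  · rw [valueAt_rMinusBasis, valueAt_rMinusBasis, if_pos rfl, if_congr eq_comm rfl rfl]
    split_ifs <;> ring
  · intro τ _ hτ
    rw [valueAt_rMinusBasis, if_neg hτ]
    ring
  · exact fun h => absurd (Finset.mem_univ _) h

theorem RForm_lof (ξ : Γ → ℂ) {m : ℕ} (f : RMinus Γ n) (h : RMinus Γ m) :
    RForm ξ (DirectSum.lof ℂ ℕ (fun n => RMinus Γ n) n f)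
      (DirectSum.lof ℂ ℕ (fun n => RMinus Γ n) m h) =
      weightedForm ξ n f (DirectSum.component ℂ ℕ (fun n => RMinus Γ n) n
        (DirectSum.lof ℂ ℕ (fun n => RMinus Γ n) m h)) := by
  rw [RForm, DirectSum.toModule_lof]
  rfl

theorem OddPart.eq_of_val_eq {X : Type*} [Fintype X] {m n : ℕ} {ρ : OddPart X m} {σ : OddPart X n}
    (h : ρ.1 = σ.1) : m = n := by
  rw [← ρ.2, h, σ.2]

/-- A map that sends the dual basis of `R_Γ^-` to the vectors `Z_ρ⁻¹ a'_{-ε(ρ)}` is a bijective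
isometry, when the permutation `ε` commutes with `ρ ↦ ρ̄` and preserves the weights. -/
theorem bijective_isometry {ξ : Γ → ℂ} (hclass : ∀ x y, ξ (y * x * y⁻¹) = ξ x)
    {B : LinearMap.BilinForm ℂ (Fock Γ)} (hB : IsFockForm ξ B) (L : RSpace Γ →ₗ[ℂ] Fock Γ)
    (ε : ∀ n, OddPart (ConjClasses Γ) n ≃ OddPart (ConjClasses Γ) n)
    (hL : ∀ n ρ, L (rSpaceBasis Γ ⟨n, ρ⟩) = (bigZ ρ)⁻¹ • aPrime (ε n ρ).1)
    (hbar : ∀ n ρ, barEquiv Γ n (ε n ρ) = ε n (barEquiv Γ n ρ))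
    (hZ : ∀ n ρ, bigZ (ε n ρ) = bigZ ρ)
    (hW : ∀ n ρ, lengthWeight ξ (ε n ρ).1 = lengthWeight ξ ρ.1) :
    Bijective L ∧ ∀ u v, B (L u) (L v) = RForm ξ u v := by
  constructor
  -- `L` carries a basis to a permuted basis rescaled by nonzero scalars.
  · let b' := ((aPrimeBasis Γ).reindex (Equiv.sigmaCongrRight ε).symm).isUnitSMul
      (w := fun ρ => (bigZ ρ.2)⁻¹) fun ρ => (inv_ne_zero (bigZ_ne_zero ρ.2)).isUnit
    have : L = ((rSpaceBasis Γ).equiv b' (Equiv.refl _)).toLinearMap := by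
      refine (rSpaceBasis Γ).ext fun ⟨n, ρ⟩ => ?_
      rw [hL, LinearEquiv.coe_coe, Module.Basis.equiv_apply, Module.Basis.isUnitSMul_apply,
        Module.Basis.reindex_apply, aPrimeBasis_apply]
      rfl
    rw [this]
    exact LinearEquiv.bijective _
  · have : B.compl₁₂ L L = RForm ξ := by
      refine LinearMap.ext_basis (rSpaceBasis Γ) (rSpaceBasis Γ) ?_
      rintro ⟨n, ρ⟩ ⟨m, σ⟩
      rw [LinearMap.compl₁₂_apply, hL, hL, map_smul, map_smul, LinearMap.smul_apply, smul_eq_mul,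
        smul_eq_mul, hB.aPrime_aPrime hclass, rSpaceBasis_apply, rSpaceBasis_apply, RForm_lof,
        ← barEquiv_apply, hZ, hW]
      by_cases hnm : m = n
      · subst hnm
        rw [DirectSum.component.lof_self, weightedForm_rMinusBasis hclass,
          if_congr (Subtype.val_injective.eq_iff.trans (by rw [hbar, (ε m).apply_eq_iff_eq]))
            rfl rfl]
        -- For a matching pair, the two factors $Z_\rho^{-1}$ against the Fock norm with its factor
        -- $Z_\rho$ leave $Z_\rho^{-1}$ times the length weight.
        split_ifs with h
        · rw [h, bigZ_barEquiv]
          field_simp [bigZ_ne_zero ρ]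
        · simp
      -- In different degrees both sides vanish: equal families have equal total size.
      · rw [if_neg fun h => hnm (OddPart.eq_of_val_eq h), DirectSum.component.of, dif_neg hnm,
          map_zero, mul_zero, mul_zero]
    intro u v
    rw [← this]
    rfl

theorem sum_smulRight_rMinusBasis (w : OddPart (ConjClasses Γ) n → Fock Γ)
    (ρ : OddPart (ConjClasses Γ) n) :
    (∑ σ, (valueAt σ).smulRight (w σ)) (rMinusBasis Γ n ρ) = w ρ := by
  rw [LinearMap.sum_apply, Finset.sum_eq_single ρ]
  · rw [LinearMap.smulRight_apply, valueAt_rMinusBasis, if_pos rfl, one_smul]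
  · intro σ _ hσ
    rw [LinearMap.smulRight_apply, valueAt_rMinusBasis, if_neg hσ, zero_smul]
  · exact fun h => absurd (Finset.mem_univ _) h

theorem ch_rSpaceBasis (ρ : OddPart (ConjClasses Γ) n) :
    ch Γ (rSpaceBasis Γ ⟨n, ρ⟩) = (bigZ ρ)⁻¹ • aPrime (barEquiv Γ n ρ).1 := by
  rw [rSpaceBasis_apply, ch, DirectSum.toModule_lof, sum_smulRight_rMinusBasis]
  rfl

theorem chPlain_rSpaceBasis (ρ : OddPart (ConjClasses Γ) n) :
    chPlain Γ (rSpaceBasis Γ ⟨n, ρ⟩) = (bigZ ρ)⁻¹ • aPrime ρ.1 := by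
  rw [rSpaceBasis_apply, chPlain, DirectSum.toModule_lof, sum_smulRight_rMinusBasis]

end Isometry
end
end SpinWreath

theorem mainTheorem8 {Γ : Type*} [Group Γ] [Fintype Γ] (ξ : Γ → ℂ)
    (hclass : ∀ x y, ξ (y * x * y⁻¹) = ξ x) (hdual : ∀ x, ξ x⁻¹ = ξ x) :
    (∃! B, SpinWreath.IsFockForm ξ B) ∧
    ∀ B, SpinWreath.IsFockForm ξ B →
      (Function.Bijective (SpinWreath.ch Γ) ∧
        ∀ u v, B (SpinWreath.ch Γ u) (SpinWreath.ch Γ v) = SpinWreath.RForm ξ u v) ∧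
      (Function.Bijective (SpinWreath.chPlain Γ) ∧
        ∀ u v, B (SpinWreath.chPlain Γ u) (SpinWreath.chPlain Γ v) = SpinWreath.RForm ξ u v) := by
  refine ⟨SpinWreath.existsUnique_fockForm hdual, fun B hB => ⟨?_, ?_⟩⟩
  -- The barred map is the case where `ε` is `ρ ↦ ρ̄`, the plain one the case where it is the
  -- identity.
  · exact SpinWreath.bijective_isometry hclass hB _ (SpinWreath.barEquiv Γ)
      (fun _ => SpinWreath.ch_rSpaceBasis) (fun _ _ => rfl) (fun _ => SpinWreath.bigZ_barEquiv)
      fun _ => SpinWreath.lengthWeight_barEquiv hclass hdual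
  · exact SpinWreath.bijective_isometry hclass hB _ (fun _ => Equiv.refl _)
      (fun _ => SpinWreath.chPlain_rSpaceBasis) (fun _ _ => rfl) (fun _ _ => rfl) fun _ _ => rfl
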